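/- **Setting.** Fix bandwidths $\Omega_1,\Omega_2,\Omega_3>0$, numbers $\overline\tau_1,\overline\tau_2,\overline\tau_3>0$, $0<s_0\le 1$, and sampling periods $\tau_j=\tau_{j,n_j}>0$ ($j=1,2,3$, $n_j\ge 1$). Let $$\varphi(x_1,x_2,x_3)=\prod_{j=1}^3\frac{\sin(\Omega_jx_j)}{\pi x_j}\qquad(\text{the factor being }\Omega_j/\pi\text{ at }x_j=0),$$ and let $R=[0,\overline\tau_1]\times[0,\overline\tau_2]\times[0,\overline\tau_3]$. For $n=(n_1,n_2,n_3)$, $n_j\geq1$, the data are $$y_{i_1,i_2,i_3}=f_n(i_1\tau_1,i_2\tau_2,i_3\tau_3)+\varepsilon_{i_1,i_2,i_3},\qquad 1\le i_j\le n_j,$$ and, given a reference signal $f_0$, the detection process is $$\mathcal F_n(s,t,r_2,r_3)=\sqrt{\tau_1\tau_2\tau_3}\sum_{l_1=1}^{\lfloor n_1s\rfloor}\sum_{l_2=1}^{n_2}\sum_{l_3=1}^{n_3}\bigl[y_{l_1,l_2,l_3}-f_0(l_1\tau_1,l_2\tau_2,l_3\tau_3)\bigr]\,\varphi(t-l_1\tau_1,r_2-l_2\tau_2,r_3-l_3\tau_3).$$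 **Noise assumption.** $\{\varepsilon_{\boldsymbol i}\}_{\boldsymbol i\in\mathbb Z^3}$ is a weakly stationary random field with mean zero such that, for some $\sigma\in(0,\infty)$, $$(n_1n_2n_3)^{-1/2}\sum_{i_1=1}^{\lfloor n_1v_1\rfloor}\sum_{i_2=1}^{\lfloor n_2v_2\rfloor}\sum_{i_3=1}^{\lfloor n_3v_3\rfloor}\varepsilon_{i_1,i_2,i_3}\Rightarrow\sigma B(v_1,v_2,v_3)$$ in the Skorohod space $D([0,1]^3)$ as $\min_jn_j\to\infty$. Here $B$ is the standard Brownian motion on $[0,1]^3$: its paths are a.s. continuous and vanish where some coordinate is $0$, and its increments around pairwise disjoint blocks $\prod_j(s_j,t_j]$ are independent, centred normal, with variances the volumes of the blocks. The Skorohod space $D$ over a box consists of the functions that have limits from all quadrants and are continuous from above. Its distance is the infimum over coordinatewise increasing bijections $\lambda$ of the box of $\max(\sup|\lambda-\mathrm{id}|,\sup|f-g\circ\lambda|)$, and $\Rightarrow$ is weak convergence of laws. **Local alternative.** There is a deterministic function $\delta$, defined on $R$ and at all sampling sites $(i_1\tau_1,i_2\tau_2,i_3\tau_3)$ with $1\le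 i_j\le n_j$, such that on this set, for all $n$, $$f_n-f_0=\frac{\delta}{n_1^{1/2}n_2^{1/2}n_3^{1/2}}$$ (that is, $f_n-f_0=\delta/n^{3/2}$ when $n_1=n_2=n_3=n$). Suppose that one of the following holds: (a) $\delta$ is continuous on this set, and $n_j\tau_{j,n_j}\to\overline\tau_j$ as $n_j\to\infty$ for $j=1,2,3$; or (b) $\delta$ is of bounded variation in the sense of Hardy and Krause on $R$, and $n_j\tau_{j,n_j}=\overline\tau_j$ for all $n_j\ge1$ and $j=1,2,3$. **Theorem.** As $\min_jn_j\to\infty$, $$\mathcal F_n\Rightarrow\mathcal F^\delta\qquad\text{in } D\bigl([s_0,1]\times R\bigr),$$ where $$\mathcal F^\delta(s,t,r_2,r_3)=\mathcal F(s,t,r_2,r_3)+\frac1{\sqrt{\overline\tau_1\overline\tau_2\overline\tau_3}}\int_0^{s\overline\tau_1}\!\int_0^{\overline\tau_2}\!\int_0^{\overline\tau_3}\varphi(t-z_1,r_2-z_2,r_3-z_3)\,\delta(z_1,z_2,z_3)\,dz_3\,dz_2\,dz_1,$$ $$\mathcal F(s,t,r_2,r_3)=\sqrt{\overline\tau_1\overline\tau_2\overline\tau_3}\;\sigma\int_0^s\!\int_0^1\!\int_0^1\varphi(t-\overline\tau_1z_1,r_2-\overline\tau_2z_2,r_3-\overline\tau_3z_3)\,dB(z_1,z_2,z_3).$$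 The last integral is the pathwise multivariate Riemann–Stieltjes integral defined through integration by parts: on $[\boldsymbol a,\boldsymbol b]\subset\mathbb R^3$, $$\int_{\boldsymbol a}^{\boldsymbol b}\psi\,dB:=\sum_{v\subseteq\{1,2,3\}}(-1)^{|v|}\sum_{w\subseteq v^c}(-1)^{|w|}\int_{[\boldsymbol a_v,\boldsymbol b_v]}B(x_v:\boldsymbol a_w:\boldsymbol b)\,d\psi(x_v:\boldsymbol a_w:\boldsymbol b),$$ where $(x_v:\boldsymbol a_w:\boldsymbol b)$ has the coordinates of $x$ in $v$, of $\boldsymbol a$ in $w$ and of $\boldsymbol b$ elsewhere, and where the term $v=\emptyset$ is the increment of $B\psi$ over the box. Both integrals in $\mathcal F^\delta$ are well defined for all $s\in[s_0,1]$ and $(t,r_2,r_3)\in R$, the second one for almost every path of $B$. -/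

import Mathlib

open MeasureTheory ProbabilityTheory Filter Topology
open scoped ENNReal

noncomputable section

/-! ### The Skorohod space over a box -/

/-- The box `∏ₚ [aₚ, bₚ]`. -/
abbrev Box {q : ℕ} (a b : Fin q → ℝ) : Type := (p : Fin q) → Set.Icc (a p) (b p)

/-- The quadrant at `x` with the relation `<` in the coordinates in `L` and `≥` in the others. -/
def quadrant {q : ℕ} {a b : Fin q → ℝ} (L : Finset (Fin q)) (x : Box a b) : Set (Box a b) :=
  {y | ∀ p, (p ∈ L → y p < x p) ∧ (p ∉ L → x p ≤ y p)}

/-- `f` has limits from all `2 ^ q` quadrants and is continuous from above. -/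
def IsSkorohodRegular {q : ℕ} {a b : Fin q → ℝ} (f : Box a b → ℝ) : Prop :=
  (∀ (x : Box a b) (L : Finset (Fin q)), ∃ y : ℝ, Tendsto f (𝓝[quadrant L x] x) (𝓝 y)) ∧
    ∀ x : Box a b, Tendsto f (𝓝[quadrant ∅ x] x) (𝓝 (f x))

/-- The space `D(∏ₚ [aₚ, bₚ])`. -/
def SkorohodSpace {q : ℕ} (a b : Fin q → ℝ) : Type :=
  {f : Box a b → ℝ // IsSkorohodRegular f}

/-- A time change: an increasing bijection of each of the intervals `[aₚ, bₚ]`. -/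
abbrev TimeChange {q : ℕ} (a b : Fin q → ℝ) : Type :=
  (p : Fin q) → (Set.Icc (a p) (b p) ≃o Set.Icc (a p) (b p))

/-- The map of the box given by a time change. -/
def TimeChange.map {q : ℕ} {a b : Fin q → ℝ} (lam : TimeChange a b) (x : Box a b) : Box a b :=
  fun p => lam p (x p)

/-- `max (sup |λ x - x|) (sup |f x - g (λ x)|)`. -/
def skorohodCost {q : ℕ} {a b : Fin q → ℝ} (f g : Box a b → ℝ) (lam : TimeChange a b) : ℝ≥0∞ :=
  (⨆ x : Box a b, edist (lam.map x) x) ⊔ (⨆ x : Box a b, edist (f x) (g (lam.map x)))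

theorem skorohodCost_symm {q : ℕ} {a b : Fin q → ℝ} (f g : Box a b → ℝ) (lam : TimeChange a b) :
    skorohodCost g f (fun p => (lam p).symm) ≤ skorohodCost f g lam := by
  have key : ∀ x : Box a b, lam.map (TimeChange.map (fun p => (lam p).symm) x) = x := by
    intro x; funext p; simp [TimeChange.map]
  refine sup_le (iSup_le fun x => ?_) (iSup_le fun x => ?_)
  · refine le_trans ?_ le_sup_left
    refine le_trans ?_ (le_iSup (fun x : Box a b => edist (lam.map x) x)
      (TimeChange.map (fun p => (lam p).symm) x))
    simp only [key]
    rw [edist_comm]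
  · refine le_trans ?_ le_sup_right
    refine le_trans ?_ (le_iSup (fun x : Box a b => edist (f x) (g (lam.map x)))
      (TimeChange.map (fun p => (lam p).symm) x))
    simp only [key]
    rw [edist_comm]

theorem skorohodCost_trans {q : ℕ} {a b : Fin q → ℝ} (f g h : Box a b → ℝ)
    (lam mu : TimeChange a b) :
    skorohodCost f h (fun p => (lam p).trans (mu p)) ≤
      skorohodCost f g lam + skorohodCost g h mu := by
  have key : ∀ x : Box a b,
      TimeChange.map (fun p => (lam p).trans (mu p)) x = mu.map (lam.map x) := by
    intro x; funext p; simp [TimeChange.map]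
  refine sup_le (iSup_le fun x => ?_) (iSup_le fun x => ?_)
  · rw [key, add_comm]
    refine (edist_triangle _ (lam.map x) _).trans (add_le_add ?_ ?_)
    · exact le_trans (le_iSup (fun x : Box a b => edist (mu.map x) x) (lam.map x)) le_sup_left
    · exact le_trans (le_iSup (fun x : Box a b => edist (lam.map x) x) x) le_sup_left
  · rw [key]
    refine (edist_triangle _ (g (lam.map x)) _).trans (add_le_add ?_ ?_)
    · exact le_trans (le_iSup (fun x : Box a b => edist (f x) (g (lam.map x))) x) le_sup_right
    · exact le_trans (le_iSup (fun x : Box a b => edist (g x) (h (mu.map x))) (lam.map x))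
        le_sup_right

/-- The Skorohod distance: the infimum over all time changes of
`max (sup |λ x - x|) (sup |f x - g (λ x)|)`. -/
instance {q : ℕ} (a b : Fin q → ℝ) : PseudoEMetricSpace (SkorohodSpace a b) where
  edist f g := ⨅ lam : TimeChange a b, skorohodCost f.1 g.1 lam
  edist_self f := by
    have key : ∀ x : Box a b, TimeChange.map (fun p => OrderIso.refl _) x = x := fun x => rfl
    refine le_antisymm (iInf_le_of_le (fun p => OrderIso.refl _) ?_) bot_le
    refine sup_le (iSup_le fun x => ?_) (iSup_le fun x => ?_) <;>
      simp only [key, edist_self, le_refl]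
  edist_comm f g := by
    refine le_antisymm ?_ ?_ <;>
      exact le_iInf fun lam => iInf_le_of_le (fun p => (lam p).symm) (skorohodCost_symm _ _ lam)
  edist_triangle f g h := by
    simp only [ENNReal.iInf_add, ENNReal.add_iInf]
    refine le_iInf fun lam => le_iInf fun mu => ?_
    exact iInf_le_of_le (fun p => (mu p).trans (lam p)) (skorohodCost_trans _ _ _ mu lam)

instance {q : ℕ} (a b : Fin q → ℝ) : MeasurableSpace (SkorohodSpace a b) := borel _

instance {q : ℕ} (a b : Fin q → ℝ) : BorelSpace (SkorohodSpace a b) := ⟨rfl⟩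

/-- Weak convergence `X i ⇒ Z` in `D(∏ₚ [aₚ, bₚ])` along `l`: restricted to the box, almost all
paths of the processes lie in `D`, the resulting `D`-valued maps are (a.e.) Borel measurable, and
their laws converge weakly for the Skorohod topology. -/
def ConvergesWeakly {q : ℕ} (a b : Fin q → ℝ) {ι Ω Ω' : Type*}
    [MeasurableSpace Ω] [MeasurableSpace Ω']
    (P : Measure Ω) [IsProbabilityMeasure P] (P' : Measure Ω') [IsProbabilityMeasure P']
    (X : ι → Ω → (Fin q → ℝ) → ℝ) (l : Filter ι) (Z : Ω' → (Fin q → ℝ) → ℝ) : Prop :=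
  ∃ (X' : ι → Ω → SkorohodSpace a b) (Z' : Ω' → SkorohodSpace a b),
    (∀ i, ∀ᵐ ω ∂P, ∀ x : Box a b, (X' i ω).1 x = X i ω (fun p => (x p : ℝ))) ∧
    (∀ᵐ ω ∂P', ∀ x : Box a b, (Z' ω).1 x = Z ω (fun p => (x p : ℝ))) ∧
    TendstoInDistribution X' l Z' (fun _ => P) P'

/-! ### Alternating sums, Hardy-Krause variation, Riemann-Stieltjes integrals -/

/-- The alternating sum `∑_{v ⊆ u} (-1)^|v| f(a_v : b_{-v})` in the coordinates in `u`. -/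
def altSum {q : ℕ} (u : Finset (Fin q)) (f : (Fin q → ℝ) → ℝ) (a b : Fin q → ℝ) : ℝ :=
  ∑ v ∈ u.powerset, (-1) ^ v.card * f (v.piecewise a b)

/-- A grid (product of finite partitions) of the box `∏ⱼ [aⱼ, bⱼ]`. -/
structure Grid {q : ℕ} (a b : Fin q → ℝ) where
  size : Fin q → ℕ
  pt : Fin q → ℕ → ℝ
  mono : ∀ j, Monotone (pt j)
  pt_zero : ∀ j, pt j 0 = a j
  pt_size : ∀ j, pt j (size j) = b j

/-- The indices of the cells of the grid in the coordinates in `u`. -/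
def Grid.cells {q : ℕ} {a b : Fin q → ℝ} (G : Grid a b) (u : Finset (Fin q)) :
    Finset (Fin q → ℕ) :=
  Fintype.piFinset fun j => if j ∈ u then Finset.range (G.size j) else {0}

/-- Lower corner of a cell; the coordinates outside `u` are those of `c`. -/
def Grid.lower {q : ℕ} {a b : Fin q → ℝ} (G : Grid a b) (u : Finset (Fin q)) (c : Fin q → ℝ)
    (k : Fin q → ℕ) : Fin q → ℝ :=
  u.piecewise (fun j => G.pt j (k j)) c

/-- Upper corner of a cell; the coordinates outside `u` are those of `c`. -/
def Grid.upper {q : ℕ} {a b : Fin q → ℝ} (G : Grid a b) (u : Finset (Fin q)) (c : Fin q → ℝ)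
    (k : Fin q → ℕ) : Fin q → ℝ :=
  u.piecewise (fun j => G.pt j (k j + 1)) c

/-- The Vitali variation on `[a_u, b_u]` of `x_u ↦ f(x_u : c_{-u})`. -/
def vitaliVariation {q : ℕ} (u : Finset (Fin q)) (c : Fin q → ℝ) (f : (Fin q → ℝ) → ℝ)
    (a b : Fin q → ℝ) : ℝ≥0∞ :=
  ⨆ G : Grid a b, ∑ k ∈ G.cells u,
    ENNReal.ofReal |altSum u f (G.lower u c k) (G.upper u c k)|

/-- The variation in the sense of Hardy and Krause,
`∑_{∅ ≠ u} V_{[a_u, b_u]} f(x_u : b_{-u})`. -/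
def hardyKrauseVariation {q : ℕ} (f : (Fin q → ℝ) → ℝ) (a b : Fin q → ℝ) : ℝ≥0∞ :=
  ∑ u ∈ (Finset.univ : Finset (Finset (Fin q))).erase ∅, vitaliVariation u b f a b

/-- `I` is the Riemann-Stieltjes integral over `[a_v, b_v]` of `x_v ↦ h(x_v : c_{-v})` with respect
to `x_v ↦ f(x_v : c_{-v})`: the limit of the Riemann-Stieltjes sums, with arbitrary tags in the
cells, as the mesh tends to zero. For `v = ∅` this is `h c * f c`. -/
def HasRSIntegral {q : ℕ} (v : Finset (Fin q)) (c : Fin q → ℝ) (h f : (Fin q → ℝ) → ℝ)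
    (a b : Fin q → ℝ) (I : ℝ) : Prop :=
  ∀ ε > 0, ∃ η > 0, ∀ (G : Grid a b) (tag : (Fin q → ℕ) → Fin q → ℝ),
    (∀ j ∈ v, ∀ i < G.size j, G.pt j (i + 1) - G.pt j i < η) →
    (∀ k ∈ G.cells v, ∀ j ∈ v, tag k j ∈ Set.Icc (G.pt j (k j)) (G.pt j (k j + 1))) →
    |∑ k ∈ G.cells v,
        h (v.piecewise (tag k) c) * altSum v f (G.lower v c k) (G.upper v c k) - I| < ε

open Classical in
/-- The Riemann-Stieltjes integral (`0` if it does not exist). -/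
def rsIntegral {q : ℕ} (v : Finset (Fin q)) (c : Fin q → ℝ) (h f : (Fin q → ℝ) → ℝ)
    (a b : Fin q → ℝ) : ℝ :=
  if H : ∃ I, HasRSIntegral v c h f a b I then H.choose else 0

/-- All the Riemann-Stieltjes integrals in the integration by parts formula for `∫ f dh` exist. -/
def ByPartsExists {q : ℕ} (f h : (Fin q → ℝ) → ℝ) (a b : Fin q → ℝ) : Prop :=
  ∀ v w : Finset (Fin q), w ⊆ vᶜ → ∃ I, HasRSIntegral v (w.piecewise a b) h f a b I

/-- The integral `∫_a^b f dh` with respect to a possibly nowhere BV integrator `h`, defined by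
integration by parts as
`∑_v (-1)^|v| ∑_{w ⊆ -v} (-1)^|w| ∫_{[a_v, b_v]} h(x_v : a_w : b) df(x_v : a_w : b)`.
The term `v = ∅` is the increment of `h * f` over the box, the term in which `v` contains every
coordinate is `(-1)^q ∫_a^b h df`. -/
def byPartsIntegral {q : ℕ} (f h : (Fin q → ℝ) → ℝ) (a b : Fin q → ℝ) : ℝ :=
  ∑ v : Finset (Fin q), (-1) ^ v.card *
    ∑ w ∈ vᶜ.powerset, (-1) ^ w.card * rsIntegral v (w.piecewise a b) h f a b

/-! ### Brownian motion on the unit cube and the assumption on the noise -/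

/-- `B` is a standard Brownian motion on `[0,1]^q`: almost all paths are continuous and vanish
where some coordinate is zero, and the increments around pairwise disjoint blocks `∏ⱼ (sⱼ, tⱼ]` are
independent centred normal variables with variances the volumes of the blocks. -/
structure IsBrownianSheet {q : ℕ} {Ω : Type*} [MeasurableSpace Ω] (P : Measure Ω)
    (B : Ω → (Fin q → ℝ) → ℝ) : Prop where
  continuous_paths : ∀ᵐ ω ∂P, ContinuousOn (B ω) (Set.Icc 0 1)
  zero_on_axes : ∀ᵐ ω ∂P, ∀ x ∈ Set.Icc (0 : Fin q → ℝ) 1, (∃ j, x j = 0) → B ω x = 0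
  increments_normal : ∀ s t : Fin q → ℝ, 0 ≤ s → s ≤ t → t ≤ 1 →
    HasLaw (fun ω => altSum Finset.univ (B ω) s t)
      (gaussianReal 0 (Real.toNNReal (∏ j, (t j - s j)))) P
  increments_indep : ∀ (k : ℕ) (s t : Fin k → Fin q → ℝ),
    (∀ i, 0 ≤ s i ∧ s i ≤ t i ∧ t i ≤ 1) →
    (Pairwise fun i i' => Disjoint (Set.univ.pi fun j => Set.Ioc (s i j) (t i j))
      (Set.univ.pi fun j => Set.Ioc (s i' j) (t i' j))) →
    iIndepFun (fun i ω => altSum Finset.univ (B ω) (s i) (t i)) P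

/-- The normalised partial sum process
`Z_n(v) = (n₁n₂n₃)^{-1/2} ∑_{1 ≤ iⱼ ≤ ⌊nⱼ vⱼ⌋} ε_{i₁,i₂,i₃}`. -/
def partialSumProcess {Ω : Type*} (ε : (Fin 3 → ℤ) → Ω → ℝ) (n : Fin 3 → ℕ) (ω : Ω)
    (v : Fin 3 → ℝ) : ℝ :=
  (√(∏ j, (n j : ℝ)))⁻¹ *
    ∑ i ∈ Finset.Icc (1 : Fin 3 → ℕ) (fun j => ⌊(n j : ℝ) * v j⌋₊), ε (fun j => (i j : ℤ)) ω

/-- The noise is a centred weakly stationary random field that satisfies the functional central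
limit theorem `Z_n ⇒ σ B` in `D[0,1]³` as `min n_j → ∞`. (`atTop` on `Fin 3 → ℕ` is the filter
`min n_j → ∞`.) -/
structure NoiseAssumption {Ω Ω' : Type*} [MeasurableSpace Ω] [MeasurableSpace Ω']
    (P : Measure Ω) [IsProbabilityMeasure P] (P' : Measure Ω') [IsProbabilityMeasure P']
    (ε : (Fin 3 → ℤ) → Ω → ℝ) (σ : ℝ) (B : Ω' → (Fin 3 → ℝ) → ℝ) : Prop where
  memLp : ∀ i, MemLp (ε i) 2 P
  mean_zero : ∀ i, ∫ ω, ε i ω ∂P = 0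
  stationary : ∀ i j h, cov[ε (i + h), ε (j + h); P] = cov[ε i, ε j; P]
  fclt : ConvergesWeakly 0 1 P P' (partialSumProcess ε) atTop (fun ω v => σ * B ω v)

/-! ### The detection process and its limit -/

/-- The reconstruction kernel `φ(x) = ∏ⱼ sin(wⱼ xⱼ) / (π xⱼ)`, with the value `wⱼ / π` of a factor
at `xⱼ = 0`; `w` are the bandwidths. -/
def kernel (w x : Fin 3 → ℝ) : ℝ := ∏ j, (w j / Real.pi) * Real.sinc (w j * x j)

theorem kernel_factor (w x : ℝ) (hx : x ≠ 0) :
    w / Real.pi * Real.sinc (w * x) = Real.sin (w * x) / (Real.pi * x) := by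
  by_cases hw : w = 0
  · simp [hw]
  · rw [Real.sinc_of_ne_zero (mul_ne_zero hw hx)]
    field_simp

/-- The sampling site `(i₁τ₁, i₂τ₂, i₃τ₃)` for the sample size `n`, where `τⱼ = τ j (n j)`. -/
def site (τ : Fin 3 → ℕ → ℝ) (n i : Fin 3 → ℕ) : Fin 3 → ℝ := fun j => (i j : ℝ) * τ j (n j)

/-- The observation box `∏ⱼ [0, τbarⱼ]` together with all the sampling sites (which may lie slightly
outside the box if `nⱼ τⱼ > τbarⱼ`). -/
def samplingDomain (τbar : Fin 3 → ℝ) (τ : Fin 3 → ℕ → ℝ) : Set (Fin 3 → ℝ) :=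
  Set.Icc 0 τbar ∪ {x | ∃ n i : Fin 3 → ℕ, 1 ≤ i ∧ i ≤ n ∧ x = site τ n i}

/-- The detection process `F_n(s, r)`, `r = (t, r₂, r₃)`, computed from the data `y`. -/
def detectionProcess (w : Fin 3 → ℝ) (τ : Fin 3 → ℕ → ℝ) (f0 : (Fin 3 → ℝ) → ℝ)
    (n : Fin 3 → ℕ) (y : (Fin 3 → ℕ) → ℝ) (s : ℝ) (r : Fin 3 → ℝ) : ℝ :=
  √(∏ j, τ j (n j)) *
    ∑ i ∈ Finset.Icc (1 : Fin 3 → ℕ) (Function.update n 0 ⌊(n 0 : ℝ) * s⌋₊),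
      (y i - f0 (site τ n i)) * kernel w (r - site τ n i)

/-- The integrand `z ↦ φ(t - τbar₁ z₁, r₂ - τbar₂ z₂, r₃ - τbar₃ z₃)` on the unit cube. -/
def scaledKernel (w τbar r z : Fin 3 → ℝ) : ℝ := kernel w (fun j => r j - τbar j * z j)

/-- The null limit `F(s, r) = (τbar₁τbar₂τbar₃)^{1/2} σ ∫_0^s ∫_0^1 ∫_0^1 φ(r - τbar z) dB(z)`
for the path `B`. -/
def nullLimit (w τbar : Fin 3 → ℝ) (σ : ℝ) (B : (Fin 3 → ℝ) → ℝ) (s : ℝ) (r : Fin 3 → ℝ) : ℝ :=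
  √(∏ j, τbar j) * σ * byPartsIntegral (scaledKernel w τbar r) B 0 (Function.update 1 0 s)

/-- The drift
`(τbar₁τbar₂τbar₃)^{-1/2} ∫_0^{s τbar₁} ∫_0^{τbar₂} ∫_0^{τbar₃} φ(r - z) δ(z) dz`. -/
def drift (w τbar : Fin 3 → ℝ) (δ : (Fin 3 → ℝ) → ℝ) (s : ℝ) (r : Fin 3 → ℝ) : ℝ :=
  (√(∏ j, τbar j))⁻¹ *
    ∫ z in Set.Icc 0 (Function.update τbar 0 (s * τbar 0)), kernel w (r - z) * δ z

end

noncomputable section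

/-! The detection process splits into a noise part and a deterministic drift. Each factor of the
kernel is a `C¹` function, so its value at a grid point is its value at the end `b` of the range
plus the integral of its derivative up to `b`. Multiplying this out over the three coordinates is a
multivariate Abel summation: the weighted noise sum equals, exactly, the functional
`stieltjesByParts` of the normalised partial sum process, with scaling `T j = n j * τ j`
(`sum_mul_prod_valueFactor`, `noise_part_eq`).

This functional integrates the path itself against bounded densities. It therefore makes sense for
jump paths, and it is stable in the supremum norm of the path and in `T`, uniformly in the time and
space parameters (`abs_stieltjesByParts_sub_le`, `stieltjesByParts_close`). Brownian paths are
continuous, and Skorohod closeness to a continuous function is uniform closeness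
(`exists_forall_abs_sub_le_of_edist_lt`). So whenever the partial sums are close to a fixed path of
`σ B`, the detection process is uniformly close to the limit path. Since the map depends on `n`, an
extended continuous mapping theorem converts this into weak convergence
(`tendstoInDistribution_of_eventually_edist_lt`).

For a continuous path vanishing on the axes, the limiting functional is the integral defined by
parts: the Riemann-Stieltjes integrals against the smooth kernel exist and have the mixed
derivatives as densities, and all lower boundary terms are zero (`byPartsIntegral_eq`).

The rate of the local alternative makes the drift of the detection process a Riemann sum. It
converges uniformly as soon as the disturbance is bounded and almost everywhere continuous
(`AdmissibleDrift.drift_close`). Under condition (a) this comes from continuity and compactness.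
Under condition (b), bounded Hardy-Krause variation dominates the increments of the disturbance by
those of monotone functions of single coordinates (`exists_monotone_majorant`), and these have only
countably many discontinuities. -/

/-! ### An extended continuous mapping theorem -/

/-- An extended continuous mapping theorem: if `Z i ⇒ Z'` and `X i` is eventually close to `X' ω'`
whenever `Z i` is close to `Z' ω'`, for almost all `ω'`, then `X i ⇒ X'`. -/
theorem tendstoInDistribution_of_eventually_edist_lt {ι Ω Ω' S S' : Type*}
    [MeasurableSpace Ω] [MeasurableSpace Ω'] [PseudoEMetricSpace S] [MeasurableSpace S]
    [BorelSpace S] [PseudoEMetricSpace S'] [MeasurableSpace S'] [BorelSpace S']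
    {P : Measure Ω} [IsProbabilityMeasure P] {P' : Measure Ω'} [IsProbabilityMeasure P']
    {Z : ι → Ω → S} {Z' : Ω' → S} {X : ι → Ω → S'} {X' : Ω' → S'} {l : Filter ι}
    [l.IsCountablyGenerated] (hZ : TendstoInDistribution Z l Z' (fun _ => P) P')
    (hX : ∀ i, AEMeasurable (X i) P) (hX' : AEMeasurable X' P')
    (G : ι → Set Ω) (hG : ∀ i, ∀ᵐ ω ∂P, ω ∈ G i)
    (h : ∀ᵐ ω' ∂P', ∀ e > 0, ∃ η > 0, ∀ᶠ i in l, ∀ ω ∈ G i,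
      edist (Z i ω) (Z' ω') < η → edist (X i ω) (X' ω') < e) :
    TendstoInDistribution X l X' (fun _ => P) P' := by
  refine ⟨hX, hX', tendsto_of_forall_isClosed_limsup_le' fun F hF => ?_⟩
  simp only [ProbabilityMeasure.coe_mk]
  obtain ⟨U, hU⟩ := l.exists_antitone_basis
  -- The event `X i ∈ F` is transported to the state space of `Z i`. The closure makes the set
  -- Borel, whatever the image and `G i` are, and gives the closed set to which the portmanteau
  -- theorem for `Z` is applied.
  set A : ℕ → Set S := fun k => closure (⋃ i ∈ U k, Z i '' (G i ∩ X i ⁻¹' F)) with hA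
  have hAc : ∀ k, IsClosed (A k) := fun k => isClosed_closure
  have hAanti : Antitone A := fun k k' hkk => closure_mono
    (Set.biUnion_subset_biUnion_left (hU.antitone hkk))
  have step : ∀ k, limsup (fun i => P.map (X i) F) l ≤ P'.map Z' (A k) := by
    intro k
    refine le_trans (limsup_le_limsup ?_)
      (ProbabilityMeasure.limsup_measure_closed_le_of_tendsto hZ.tendsto (hAc k))
    filter_upwards [hU.mem k] with i hi
    simp only [ProbabilityMeasure.coe_mk]
    rw [Measure.map_apply_of_aemeasurable (hX i) hF.measurableSet,
      Measure.map_apply_of_aemeasurable (hZ.forall_aemeasurable i) (hAc k).measurableSet]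
    refine measure_mono_ae ?_
    filter_upwards [hG i] with ω hω hωF
    exact subset_closure (Set.mem_biUnion hi ⟨ω, ⟨hω, hωF⟩, rfl⟩)
  have lim : Tendsto (fun k => P'.map Z' (A k)) atTop (𝓝 (P'.map Z' (⋂ k, A k))) :=
    tendsto_measure_iInter_atTop (fun k => (hAc k).measurableSet.nullMeasurableSet) hAanti
      ⟨0, by
        rw [Measure.map_apply_of_aemeasurable hZ.aemeasurable_limit (hAc 0).measurableSet]
        exact measure_ne_top _ _⟩
  refine (ge_of_tendsto' lim step).trans ?_
  rw [Measure.map_apply_of_aemeasurable hX' hF.measurableSet,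
    Measure.map_apply_of_aemeasurable hZ.aemeasurable_limit
      (isClosed_iInter hAc).measurableSet]
  refine measure_mono_ae ?_
  filter_upwards [h] with ω' hω' hmem
  -- On the intersection of the `A k`, the point `Z' ω'` is a limit of points `Z i ω` with `X i ω ∈
  -- F` and `i` arbitrarily far along `l`; by `h` there are points of `F` arbitrarily close to `X'
  -- ω'`.
  have hmem' : ∀ k, Z' ω' ∈ A k := fun k => Set.mem_iInter.1 hmem k
  show X' ω' ∈ F
  rw [← hF.closure_eq, EMetric.mem_closure_iff]
  intro e he
  obtain ⟨η, hη, hev⟩ := hω' e he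
  obtain ⟨k, hk⟩ := hU.mem_iff.1 hev
  obtain ⟨z, hz, hd⟩ := EMetric.mem_closure_iff.1 (hmem' k) η hη
  obtain ⟨i, hi, ω, ⟨hωG, hωF⟩, rfl⟩ := Set.mem_iUnion₂.1 hz
  refine ⟨X i ω, hωF, ?_⟩
  rw [edist_comm]
  rw [edist_comm] at hd
  exact hk hi ω hωG hd

/-! ### The Skorohod space -/

theorem SkorohodSpace.edist_le_of_forall {q : ℕ} {a b : Fin q → ℝ} {f g : SkorohodSpace a b}
    {C : ℝ≥0∞} (h : ∀ x, edist (f.1 x) (g.1 x) ≤ C) : edist f g ≤ C := by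
  refine iInf_le_of_le (fun p => OrderIso.refl _) ?_
  have key : ∀ x : Box a b, TimeChange.map (fun p => OrderIso.refl _) x = x := fun x => rfl
  refine sup_le (iSup_le fun x => ?_) (iSup_le fun x => ?_)
  · simp [key]
  · simpa [key] using h x

theorem SkorohodSpace.exists_timeChange {q : ℕ} {a b : Fin q → ℝ} {f g : SkorohodSpace a b}
    {C : ℝ≥0∞} (h : edist f g < C) :
    ∃ lam : TimeChange a b, ∀ x, edist (lam.map x) x < C ∧ edist (f.1 x) (g.1 (lam.map x)) < C := by
  obtain ⟨lam, hlam⟩ := iInf_lt_iff.1 h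
  refine ⟨lam, fun x => ⟨lt_of_le_of_lt ?_ hlam, lt_of_le_of_lt ?_ hlam⟩⟩
  · exact le_sup_of_le_left (le_iSup (fun x : Box a b => edist (lam.map x) x) x)
  · exact le_sup_of_le_right (le_iSup (fun x : Box a b => edist (f.1 x) (g.1 (lam.map x))) x)

theorem Continuous.isSkorohodRegular {q : ℕ} {a b : Fin q → ℝ} {f : Box a b → ℝ}
    (hf : Continuous f) : IsSkorohodRegular f :=
  ⟨fun x _ => ⟨f x, hf.continuousAt.continuousWithinAt⟩, fun _ =>
    hf.continuousAt.continuousWithinAt⟩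

theorem IsSkorohodRegular.add {q : ℕ} {a b : Fin q → ℝ} {f g : Box a b → ℝ}
    (hf : IsSkorohodRegular f) (hg : IsSkorohodRegular g) :
    IsSkorohodRegular (fun x => f x + g x) := by
  refine ⟨fun x L => ?_, fun x => (hf.2 x).add (hg.2 x)⟩
  obtain ⟨y, hy⟩ := hf.1 x L
  obtain ⟨z, hz⟩ := hg.1 x L
  exact ⟨y + z, hy.add hz⟩

theorem IsSkorohodRegular.mul {q : ℕ} {a b : Fin q → ℝ} {f g : Box a b → ℝ}
    (hf : IsSkorohodRegular f) (hg : IsSkorohodRegular g) :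
    IsSkorohodRegular (fun x => f x * g x) := by
  refine ⟨fun x L => ?_, fun x => (hf.2 x).mul (hg.2 x)⟩
  obtain ⟨y, hy⟩ := hf.1 x L
  obtain ⟨z, hz⟩ := hg.1 x L
  exact ⟨y * z, hy.mul hz⟩

theorem IsSkorohodRegular.sum {q : ℕ} {a b : Fin q → ℝ} {ι : Type*} (s : Finset ι)
    {f : ι → Box a b → ℝ} (hf : ∀ i ∈ s, IsSkorohodRegular (f i)) :
    IsSkorohodRegular (fun x => ∑ i ∈ s, f i x) := by
  classical
  induction s using Finset.induction_on with
  | empty => simpa using (continuous_const (y := (0 : ℝ))).isSkorohodRegular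
  | insert i s hi ih =>
    simp only [Finset.sum_insert hi]
    exact (hf i (Finset.mem_insert_self i s)).add
      (ih fun j hj => hf j (Finset.mem_insert_of_mem hj))

/-- The detection process depends on time through such indicators. In a quadrant that approaches
coordinate `p` from below the limit is the indicator of the strict inequality, otherwise the value
itself; the closed inequality gives continuity from above. -/
theorem isSkorohodRegular_ite_le {q : ℕ} {a b : Fin q → ℝ} (p : Fin q) (c : ℝ) :
    IsSkorohodRegular (fun x : Box a b => if c ≤ (x p : ℝ) then (1 : ℝ) else 0) := by
  have hcont : ∀ x : Box a b, Tendsto (fun y : Box a b => (y p : ℝ)) (𝓝 x) (𝓝 (x p : ℝ)) :=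
    fun x => (continuous_subtype_val.comp (continuous_apply p)).tendsto x
  have key : ∀ (x : Box a b) (L : Finset (Fin q)),
      Tendsto (fun x : Box a b => if c ≤ (x p : ℝ) then (1 : ℝ) else 0) (𝓝[quadrant L x] x)
        (𝓝 (if p ∈ L then (if c < (x p : ℝ) then 1 else 0) else
          if c ≤ (x p : ℝ) then 1 else 0)) := by
    intro x L
    refine tendsto_const_nhds.congr' ?_
    have hmem : ∀ᶠ y in 𝓝[quadrant L x] x, y ∈ quadrant L x := self_mem_nhdsWithin
    by_cases hp : p ∈ L
    · by_cases hc : c < (x p : ℝ)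
      · filter_upwards [nhdsWithin_le_nhds ((hcont x).eventually (lt_mem_nhds hc))] with y hy
        simp [hp, hc, le_of_lt hy]
      · filter_upwards [hmem] with y hy
        have : (y p : ℝ) < x p := (hy p).1 hp
        simp [hp, hc, not_le.2 (this.trans_le (not_lt.1 hc))]
    · by_cases hc : c ≤ (x p : ℝ)
      · filter_upwards [hmem] with y hy
        have : (x p : ℝ) ≤ y p := (hy p).2 hp
        simp [hp, hc, hc.trans this]
      · filter_upwards [nhdsWithin_le_nhds ((hcont x).eventually
          (gt_mem_nhds (not_le.1 hc)))] with y hy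
        simp [hp, hc, not_le.2 hy]
  exact ⟨fun x L => ⟨_, key x L⟩, fun x => by simpa using key x ∅⟩

/-- A `D`-valued finite random combination of fixed elements of `D` is measurable. -/
theorem aemeasurable_skorohod_sum {q : ℕ} {a b : Fin q → ℝ} {Ω ι : Type*} [MeasurableSpace Ω]
    {P : Measure Ω} [Fintype ι] (c : ι → Ω → ℝ) (hc : ∀ i, AEMeasurable (c i) P)
    (ψ : ι → Box a b → ℝ) (M : ℝ) (hM : ∀ i x, |ψ i x| ≤ M)
    (X : Ω → SkorohodSpace a b) (hX : ∀ ω x, (X ω).1 x = ∑ i, c i ω * ψ i x)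
    (hψ : ∀ i, IsSkorohodRegular (ψ i)) :
    AEMeasurable X P := by
  -- Randomness enters through finitely many coefficients. The map from coefficients to paths is
  -- Lipschitz, because the Skorohod distance is at most the supremum distance, so Borel
  -- measurability in `D` reduces to that of the coefficients.
  set Φ : (ι → ℝ) → SkorohodSpace a b := fun d =>
    ⟨fun x => ∑ i, d i * ψ i x, IsSkorohodRegular.sum _ fun i _ =>
      (continuous_const.isSkorohodRegular).mul (hψ i)⟩ with hΦ
  have hΦc : LipschitzWith (Real.toNNReal (Fintype.card ι * M)) Φ := by
    intro d d'
    refine SkorohodSpace.edist_le_of_forall fun x => ?_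
    rw [edist_dist, edist_dist, ← ENNReal.ofReal_coe_nnreal,
      ← ENNReal.ofReal_mul (NNReal.coe_nonneg _)]
    refine ENNReal.ofReal_le_ofReal ?_
    have h1 : dist ((Φ d).1 x) ((Φ d').1 x) = |∑ i, (d i - d' i) * ψ i x| := by
      simp only [hΦ, Real.dist_eq, ← Finset.sum_sub_distrib, sub_mul]
    rw [h1]
    calc |∑ i, (d i - d' i) * ψ i x| ≤ ∑ i, |(d i - d' i) * ψ i x| :=
          Finset.abs_sum_le_sum_abs _ _
      _ ≤ ∑ _i : ι, dist d d' * M := by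
          refine Finset.sum_le_sum fun i _ => ?_
          rw [abs_mul]
          refine mul_le_mul ?_ (hM i x) (abs_nonneg _) dist_nonneg
          rw [← Real.dist_eq]; exact dist_le_pi_dist d d' i
      _ = Fintype.card ι * M * dist d d' := by
          rw [Finset.sum_const, Finset.card_univ, nsmul_eq_mul]; ring
      _ ≤ _ := mul_le_mul_of_nonneg_right (Real.le_coe_toNNReal _) dist_nonneg
  have : X = Φ ∘ fun ω i => c i ω := by
    funext ω; apply Subtype.ext; funext x; exact hX ω x
  rw [this]
  exact hΦc.continuous.measurable.comp_aemeasurable (aemeasurable_pi_lambda _ hc)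

/-! ### Random continuous functions -/

/-- Since `C(K, ℝ)` is separable, every open set is a countable union of closed balls. A closed ball
is described by countably many point evaluations, those at a dense set of points of `K`. -/
theorem aemeasurable_continuousMap {Ω K : Type*} [MeasurableSpace Ω] {P : Measure Ω}
    [MetricSpace K] [CompactSpace K] [MeasurableSpace C(K, ℝ)] [BorelSpace C(K, ℝ)]
    (F : Ω → C(K, ℝ)) (hF : ∀ x, AEMeasurable (fun ω => F ω x) P) : AEMeasurable F P := by
  suffices h : NullMeasurable F P from h.aemeasurable
  obtain ⟨t, htc, htd⟩ := TopologicalSpace.exists_countable_dense K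
  obtain ⟨s, hsc, hsd⟩ := TopologicalSpace.exists_countable_dense C(K, ℝ)
  have hball : ∀ (g : C(K, ℝ)) (r : ℝ), 0 ≤ r →
      NullMeasurableSet (F ⁻¹' Metric.closedBall g r) P := by
    intro g r hr
    have : F ⁻¹' Metric.closedBall g r = ⋂ x ∈ t, {ω | |F ω x - g x| ≤ r} := by
      ext ω
      simp only [Set.mem_preimage, Metric.mem_closedBall, Set.mem_iInter, Set.mem_ofPred_eq]
      rw [ContinuousMap.dist_le hr]
      refine ⟨fun h x _ => h x, fun h x => ?_⟩
      have hcl : IsClosed {x | dist (F ω x) (g x) ≤ r} :=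
        isClosed_le (by fun_prop) continuous_const
      exact (hcl.closure_subset_iff.2 fun y hy => h y hy) (htd x)
    rw [this]
    refine NullMeasurableSet.biInter htc fun x _ => ?_
    exact nullMeasurableSet_le (((hF x).sub aemeasurable_const).norm) aemeasurable_const
  have hopen : ∀ U : Set C(K, ℝ), IsOpen U → NullMeasurableSet (F ⁻¹' U) P := by
    intro U hU
    have hc : ({p : C(K, ℝ) × ℕ | p.1 ∈ s ∧
        Metric.closedBall p.1 (1 / ((p.2 : ℝ) + 1)) ⊆ U}).Countable :=
      (hsc.prod (Set.countable_univ (α := ℕ))).mono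
        (fun p hp => Set.mem_prod.2 ⟨hp.1, Set.mem_univ _⟩)
    have : F ⁻¹' U = ⋃ p ∈ {p : C(K, ℝ) × ℕ | p.1 ∈ s ∧
        Metric.closedBall p.1 (1 / ((p.2 : ℝ) + 1)) ⊆ U},
        F ⁻¹' Metric.closedBall p.1 (1 / ((p.2 : ℝ) + 1)) := by
      ext ω
      simp only [Set.mem_preimage, Set.mem_iUnion]
      constructor
      · intro hω
        obtain ⟨ε, hε, hεU⟩ := Metric.isOpen_iff.1 hU _ hω
        obtain ⟨n, hn⟩ := exists_nat_one_div_lt (half_pos hε)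
        obtain ⟨g, hg, hgs⟩ := Metric.dense_iff.1 hsd (F ω) (1 / ((n : ℝ) + 1)) (by positivity)
        refine ⟨(g, n), ⟨hgs, fun f hf => hεU ?_⟩, ?_⟩
        · rw [Metric.mem_ball] at hg ⊢
          rw [Metric.mem_closedBall] at hf
          linarith [dist_triangle f g (F ω)]
        · rw [Metric.mem_closedBall, dist_comm]
          exact (Metric.mem_ball.1 hg).le
      · rintro ⟨p, hp, hω⟩
        exact hp.2 hω
    rw [this]
    exact NullMeasurableSet.biUnion hc fun p _ => hball _ _ (by positivity)
  intro u hu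
  have : @Measurable (NullMeasurableSpace Ω P) _ _ _ F := measurable_of_isOpen hopen
  exact this hu

/-! ### The factors of the kernel -/

/-- At `0`, `sinc` is the divided slope of the analytic function `sin`, hence analytic; elsewhere it
is a quotient of analytic functions. -/
theorem Real.contDiff_sinc {n : WithTop ℕ∞} : ContDiff ℝ n Real.sinc := by
  rw [contDiff_iff_contDiffAt]
  intro x
  refine AnalyticAt.contDiffAt ?_
  by_cases hx : x = 0
  · subst hx
    obtain ⟨p, hp⟩ : AnalyticAt ℝ Real.sin 0 := Real.contDiff_sin.contDiffAt.analyticAt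
    rw [Real.sinc_eq_dslope]
    exact hp.has_fpower_series_dslope_fslope.analyticAt
  · have h : AnalyticAt ℝ (fun y => Real.sin y / y) x :=
      (Real.contDiff_sin.contDiffAt.analyticAt).div analyticAt_id hx
    refine h.congr ?_
    filter_upwards [isOpen_ne.mem_nhds hx] with y hy
    exact (Real.sinc_of_ne_zero hy).symm

/-- The factor `x ↦ sin (w x) / (π x)` of the reconstruction kernel. -/
def kernelFactor (w x : ℝ) : ℝ := (w / Real.pi) * Real.sinc (w * x)

theorem contDiff_kernelFactor (w : ℝ) : ContDiff ℝ 1 (kernelFactor w) :=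
  contDiff_const.mul (Real.contDiff_sinc.comp (contDiff_const.mul contDiff_id))

theorem kernel_eq_prod (w x : Fin 3 → ℝ) : kernel w x = ∏ j, kernelFactor (w j) (x j) := rfl

/-! ### The uniform measure on the unit cube -/

/-- Lebesgue measure on the unit cube. -/
def cubeMeasure (q : ℕ) : Measure (Fin q → ℝ) :=
  Measure.pi fun _ => volume.restrict (Set.Icc (0 : ℝ) 1)

instance isProbabilityMeasure_unitInterval :
    IsProbabilityMeasure (volume.restrict (Set.Icc (0 : ℝ) 1)) :=
  ⟨by simp⟩

instance (q : ℕ) : IsProbabilityMeasure (cubeMeasure q) := by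
  unfold cubeMeasure; infer_instance

theorem cubeMeasure_eq_restrict (q : ℕ) :
    cubeMeasure q = volume.restrict (Set.Icc (0 : Fin q → ℝ) 1) := by
  rw [cubeMeasure, ← Measure.restrict_pi_pi, ← volume_pi, ← Set.pi_univ_Icc]
  rfl

theorem ae_cubeMeasure_mem (q : ℕ) : ∀ᵐ x ∂cubeMeasure q, x ∈ Set.Icc (0 : Fin q → ℝ) 1 := by
  rw [cubeMeasure_eq_restrict]
  exact ae_restrict_mem measurableSet_Icc

theorem ae_cubeMeasure_of_ae {q : ℕ} (j : Fin q) {p : ℝ → Prop} (h : ∀ᵐ t, p t) :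
    ∀ᵐ x ∂cubeMeasure q, p (x j) := by
  have := (measurePreserving_eval (fun _ : Fin q => volume.restrict (Set.Icc (0 : ℝ) 1))
    j).quasiMeasurePreserving.ae (ae_restrict_of_ae h)
  exact this

/-- The cutoffs in the integrands below jump only on hyperplanes `x j = b j`; these are negligible.
-/
theorem ae_cubeMeasure_ne {q : ℕ} (b : Fin q → ℝ) :
    ∀ᵐ x ∂cubeMeasure q, ∀ j, x j ≠ b j :=
  ae_all_iff.2 fun j => ae_cubeMeasure_of_ae j (p := fun t => t ≠ b j)
    (by simp [ae_iff])

theorem integral_cubeMeasure_prod {q : ℕ} (f : Fin q → ℝ → ℝ) :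
    ∫ x, ∏ j, f j (x j) ∂cubeMeasure q = ∏ j, ∫ t in Set.Icc (0 : ℝ) 1, f j t :=
  integral_fintype_prod_eq_prod f

/-! ### Integration against the mixed derivatives of a product kernel -/

section productKernel

variable {q : ℕ}

/-- The derivative of `x ↦ - φ (r - T x)` in each coordinate. -/
def slopeFactor (φ : Fin q → ℝ → ℝ) (T r x : Fin q → ℝ) : Fin q → ℝ :=
  fun j => T j * deriv (φ j) (r j - T j * x j)

/-- The values `φ (r - T x)` in each coordinate. -/
def valueFactor (φ : Fin q → ℝ → ℝ) (T r x : Fin q → ℝ) : Fin q → ℝ :=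
  fun j => φ j (r j - T j * x j)

/-- The density on `[0, b]` in the coordinates in `v`, the mass at `b` in the others. -/
def mixedFactor (φ : Fin q → ℝ → ℝ) (T r b : Fin q → ℝ) (v : Finset (Fin q)) (x : Fin q → ℝ) :
    Fin q → ℝ :=
  fun j => if j ∈ v then (if x j ≤ b j then slopeFactor φ T r x j else 0)
    else valueFactor φ T r b j

/-- `∫_0^b φ (r - T x) dh(x)` for the product kernel `φ` and `h` vanishing on the axes, written by
means of integration by parts. -/
def stieltjesByParts (φ : Fin q → ℝ → ℝ) (h : (Fin q → ℝ) → ℝ) (T r b : Fin q → ℝ) : ℝ :=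
  ∑ v : Finset (Fin q), ∫ x, h (v.piecewise x b) * ∏ j, mixedFactor φ T r b v x j ∂cubeMeasure q

theorem continuous_slopeFactor {φ : Fin q → ℝ → ℝ} (hφ : ∀ j, ContDiff ℝ 1 (φ j)) :
    Continuous fun p : (Fin q → ℝ) × (Fin q → ℝ) × (Fin q → ℝ) =>
      slopeFactor φ p.1 p.2.1 p.2.2 := by
  have hd : ∀ j, Continuous (deriv (φ j)) := fun j => (hφ j).continuous_deriv le_rfl
  refine continuous_pi fun j => ?_
  unfold slopeFactor
  exact Continuous.mul (by fun_prop) ((hd j).comp (by fun_prop))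

theorem continuous_valueFactor {φ : Fin q → ℝ → ℝ} (hφ : ∀ j, ContDiff ℝ 1 (φ j)) :
    Continuous fun p : (Fin q → ℝ) × (Fin q → ℝ) × (Fin q → ℝ) =>
      valueFactor φ p.1 p.2.1 p.2.2 := by
  refine continuous_pi fun j => ?_
  exact (hφ j).continuous.comp (by fun_prop)

theorem piecewise_mem_Icc {a b x y : Fin q → ℝ} (v : Finset (Fin q)) (hx : x ∈ Set.Icc a b)
    (hy : y ∈ Set.Icc a b) : v.piecewise x y ∈ Set.Icc a b := by
  refine ⟨fun j => ?_, fun j => ?_⟩ <;> by_cases hj : j ∈ v <;> simp [hj]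
  exacts [hx.1 j, hy.1 j, hx.2 j, hy.2 j]

theorem norm_le_one_of_mem_cube {x : Fin q → ℝ} (hx : x ∈ Set.Icc (0 : Fin q → ℝ) 1) :
    ‖x‖ ≤ 1 := by
  refine (pi_norm_le_iff_of_nonneg zero_le_one).2 fun j => ?_
  rw [Real.norm_eq_abs, abs_of_nonneg (hx.1 j)]
  exact hx.2 j

/-- The compact set of parameters of norm at most `R`. -/
def paramBall (q : ℕ) (R : ℝ) : Set ((Fin q → ℝ) × (Fin q → ℝ) × (Fin q → ℝ)) :=
  Metric.closedBall 0 R ×ˢ Metric.closedBall 0 R ×ˢ Metric.closedBall 0 R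

theorem isCompact_paramBall (R : ℝ) : IsCompact (paramBall q R) :=
  (isCompact_closedBall _ _).prod ((isCompact_closedBall _ _).prod (isCompact_closedBall _ _))

theorem mem_paramBall {R : ℝ} {T r x : Fin q → ℝ} (hT : ‖T‖ ≤ R) (hr : ‖r‖ ≤ R) (hx : ‖x‖ ≤ R) :
    (T, r, x) ∈ paramBall q R := by
  simp [paramBall, hT, hr, hx]

/-- The cutoff is not continuous, but slopes and values are, jointly in all parameters, so
compactness bounds both. The normalisation `1 ≤ M` lets powers of `M` increase with the exponent. -/
theorem exists_bound_mixedFactor {φ : Fin q → ℝ → ℝ} (hφ : ∀ j, ContDiff ℝ 1 (φ j)) (R : ℝ) :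
    ∃ M : ℝ, 1 ≤ M ∧ ∀ T r b : Fin q → ℝ, ‖T‖ ≤ R → ‖r‖ ≤ R → ‖b‖ ≤ R →
      ∀ x : Fin q → ℝ, ‖x‖ ≤ R → ∀ v j, |mixedFactor φ T r b v x j| ≤ M := by
  obtain ⟨M₁, h₁⟩ := (isCompact_paramBall (q := q) R).exists_bound_of_continuousOn
    (continuous_slopeFactor hφ).continuousOn
  obtain ⟨M₂, h₂⟩ := (isCompact_paramBall (q := q) R).exists_bound_of_continuousOn
    (continuous_valueFactor hφ).continuousOn
  refine ⟨max 1 (max M₁ M₂), le_max_left _ _, fun T r b hT hr hb x hx v j => ?_⟩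
  have k₁ := (norm_le_pi_norm _ j).trans (h₁ _ (mem_paramBall hT hr hx))
  have k₂ := (norm_le_pi_norm _ j).trans (h₂ _ (mem_paramBall hT hr hb))
  rw [Real.norm_eq_abs] at k₁ k₂
  unfold mixedFactor
  split_ifs
  · exact k₁.trans ((le_max_left _ _).trans (le_max_right _ _))
  · simp
  · exact k₂.trans ((le_max_right _ _).trans (le_max_right _ _))

/-- Only the scaling varies, so both cutoffs are the same and their jumps do not matter; uniform
continuity of slopes and values on a compact set suffices. -/
theorem exists_close_mixedFactor {φ : Fin q → ℝ → ℝ} (hφ : ∀ j, ContDiff ℝ 1 (φ j)) (R : ℝ)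
    {e : ℝ} (he : 0 < e) :
    ∃ η > 0, ∀ T T' r b : Fin q → ℝ, ‖T‖ ≤ R → ‖T'‖ ≤ R → ‖r‖ ≤ R → ‖b‖ ≤ R → dist T T' < η →
      ∀ x : Fin q → ℝ, ‖x‖ ≤ R → ∀ v j,
        |mixedFactor φ T r b v x j - mixedFactor φ T' r b v x j| ≤ e := by
  obtain ⟨η₁, hη₁, h₁⟩ := Metric.uniformContinuousOn_iff.1
    ((isCompact_paramBall (q := q) R).uniformContinuousOn_of_continuous
    (continuous_slopeFactor hφ).continuousOn) e he
  obtain ⟨η₂, hη₂, h₂⟩ := Metric.uniformContinuousOn_iff.1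
    ((isCompact_paramBall (q := q) R).uniformContinuousOn_of_continuous
    (continuous_valueFactor hφ).continuousOn) e he
  refine ⟨min η₁ η₂, lt_min hη₁ hη₂, fun T T' r b hT hT' hr hb hd x hx v j => ?_⟩
  have hdist : ∀ y : Fin q → ℝ, dist (T, r, y) (T', r, y) = dist T T' := by
    intro y; simp [Prod.dist_eq]
  have k₁ := h₁ _ (mem_paramBall hT hr hx) _ (mem_paramBall hT' hr hx)
    (by rw [hdist]; exact hd.trans_le (min_le_left _ _))
  have k₂ := h₂ _ (mem_paramBall hT hr hb) _ (mem_paramBall hT' hr hb)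
    (by rw [hdist]; exact hd.trans_le (min_le_right _ _))
  have k₁' := (dist_le_pi_dist _ _ j).trans k₁.le
  have k₂' := (dist_le_pi_dist _ _ j).trans k₂.le
  rw [Real.dist_eq] at k₁' k₂'
  unfold mixedFactor
  split_ifs
  · exact k₁'
  · simpa using he.le
  · exact k₂'

theorem abs_prod_le_pow {ι : Type*} (s : Finset ι) {a : ι → ℝ} {M : ℝ} (ha : ∀ i, |a i| ≤ M) :
    |∏ i ∈ s, a i| ≤ M ^ s.card := by
  rw [Finset.abs_prod]
  exact (Finset.prod_le_prod (fun i _ => abs_nonneg _) fun i _ => ha i).trans_eq (by simp)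

theorem abs_prod_sub_prod_le {ι : Type*} (s : Finset ι) {a b : ι → ℝ} {M e : ℝ}
    (hM : 1 ≤ M) (ha : ∀ i, |a i| ≤ M) (hb : ∀ i, |b i| ≤ M) (hab : ∀ i, |a i - b i| ≤ e) :
    |∏ i ∈ s, a i - ∏ i ∈ s, b i| ≤ s.card * M ^ s.card * e := by
  classical
  induction s using Finset.induction_on with
  | empty => simp
  | insert i s hi ih =>
    rw [Finset.prod_insert hi, Finset.prod_insert hi, Finset.card_insert_of_notMem hi]
    have he : 0 ≤ e := (abs_nonneg _).trans (hab i)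
    have h1 : a i * ∏ j ∈ s, a j - b i * ∏ j ∈ s, b j =
        a i * (∏ j ∈ s, a j - ∏ j ∈ s, b j) + (a i - b i) * ∏ j ∈ s, b j := by ring
    have h2 : |a i| * |∏ j ∈ s, a j - ∏ j ∈ s, b j| ≤ M * (s.card * M ^ s.card * e) :=
      mul_le_mul (ha i) ih (abs_nonneg _) (by linarith)
    have h3 : |a i - b i| * |∏ j ∈ s, b j| ≤ e * M ^ s.card :=
      mul_le_mul (hab i) (abs_prod_le_pow s hb) (abs_nonneg _) he
    have h4 : M ^ s.card ≤ M ^ (s.card + 1) := pow_le_pow_right₀ hM (Nat.le_succ _)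
    rw [h1]
    refine (abs_add_le _ _).trans ?_
    rw [abs_mul, abs_mul]
    have h5 : e * M ^ s.card ≤ e * M ^ (s.card + 1) := mul_le_mul_of_nonneg_left h4 he
    push_cast
    calc _ ≤ M * (s.card * M ^ s.card * e) + e * M ^ (s.card + 1) := by linarith
      _ = _ := by ring

theorem measurable_mixedFactor {φ : Fin q → ℝ → ℝ} (hφ : ∀ j, ContDiff ℝ 1 (φ j))
    (T r b : Fin q → ℝ) (v : Finset (Fin q)) (j : Fin q) :
    Measurable fun x => mixedFactor φ T r b v x j := by
  unfold mixedFactor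
  refine Measurable.ite (MeasurableSet.const _) (Measurable.ite ?_ ?_ measurable_const)
    measurable_const
  · exact measurableSet_le (measurable_pi_apply j) measurable_const
  · exact ((continuous_pi_iff.1 (continuous_slopeFactor hφ) j).comp
      (by fun_prop : Continuous fun x : Fin q → ℝ => (T, r, x))).measurable

theorem measurable_piecewise_cube (v : Finset (Fin q)) (b : Fin q → ℝ) :
    Measurable fun x : Fin q → ℝ => v.piecewise x b := by
  refine measurable_pi_lambda _ fun j => ?_
  by_cases hj : j ∈ v <;> simp [hj, measurable_pi_apply]

theorem continuous_piecewise_cube (v : Finset (Fin q)) :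
    Continuous fun p : (Fin q → ℝ) × (Fin q → ℝ) => v.piecewise p.1 p.2 := by
  refine continuous_pi fun j => ?_
  by_cases hj : j ∈ v <;> simp only [hj, Finset.piecewise_eq_of_mem,
    Finset.piecewise_eq_of_notMem, not_false_eq_true] <;> fun_prop

theorem integrable_stieltjesByParts {φ : Fin q → ℝ → ℝ} (hφ : ∀ j, ContDiff ℝ 1 (φ j))
    {h : (Fin q → ℝ) → ℝ} (hm : Measurable h) {H : ℝ}
    (hH : ∀ x ∈ Set.Icc (0 : Fin q → ℝ) 1, |h x| ≤ H) (T r : Fin q → ℝ) {b : Fin q → ℝ}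
    (hb : b ∈ Set.Icc (0 : Fin q → ℝ) 1) (v : Finset (Fin q)) :
    Integrable (fun x => h (v.piecewise x b) * ∏ j, mixedFactor φ T r b v x j)
      (cubeMeasure q) := by
  obtain ⟨M, hM, hMb⟩ := exists_bound_mixedFactor hφ (max 1 (max ‖T‖ ‖r‖))
  have hmeas : Measurable fun x => h (v.piecewise x b) * ∏ j, mixedFactor φ T r b v x j :=
    (hm.comp (measurable_piecewise_cube v b)).mul
      (Finset.measurable_prod _ fun j _ => measurable_mixedFactor hφ T r b v j)
  refine Integrable.of_bound hmeas.aestronglyMeasurable (H * M ^ (Finset.univ (α := Fin q)).card) ?_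
  filter_upwards [ae_cubeMeasure_mem q] with x hx
  rw [Real.norm_eq_abs, abs_mul]
  have h1 := hH _ (piecewise_mem_Icc v hx hb)
  refine mul_le_mul h1 (abs_prod_le_pow _ fun j => hMb T r b ?_ ?_ ?_ x ?_ v j)
    (abs_nonneg _) ((abs_nonneg _).trans h1)
  · exact (le_max_left _ _).trans (le_max_right _ _)
  · exact (le_max_right _ _).trans (le_max_right _ _)
  · exact (norm_le_one_of_mem_cube hb).trans (le_max_left _ _)
  · exact (norm_le_one_of_mem_cube hx).trans (le_max_left _ _)

/-- Joint stability of `stieltjesByParts` in the integrator and the scaling. -/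
theorem abs_stieltjesByParts_sub_le {φ : Fin q → ℝ → ℝ} (hφ : ∀ j, ContDiff ℝ 1 (φ j))
    {h z : (Fin q → ℝ) → ℝ} (hm : Measurable h) (zm : Measurable z) {H η M e : ℝ}
    (hH : ∀ x ∈ Set.Icc (0 : Fin q → ℝ) 1, |h x| ≤ H)
    (hη : ∀ x ∈ Set.Icc (0 : Fin q → ℝ) 1, |z x - h x| ≤ η) (hM : 1 ≤ M)
    {T T' r b : Fin q → ℝ} (hb : b ∈ Set.Icc (0 : Fin q → ℝ) 1)
    (hMT : ∀ x : Fin q → ℝ, ‖x‖ ≤ 1 → ∀ v j, |mixedFactor φ T r b v x j| ≤ M)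
    (hMT' : ∀ x : Fin q → ℝ, ‖x‖ ≤ 1 → ∀ v j, |mixedFactor φ T' r b v x j| ≤ M)
    (he : ∀ x : Fin q → ℝ, ‖x‖ ≤ 1 → ∀ v j,
      |mixedFactor φ T r b v x j - mixedFactor φ T' r b v x j| ≤ e) :
    |stieltjesByParts φ z T r b - stieltjesByParts φ h T' r b| ≤
      2 ^ q * (η * M ^ q + H * (q * M ^ q * e)) := by
  unfold stieltjesByParts
  rw [← Finset.sum_sub_distrib]
  refine (Finset.abs_sum_le_sum_abs _ _).trans ?_
  -- A bound for `z` is inherited from `h`; it serves only to make the integrals linear.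
  have hzb : ∀ x ∈ Set.Icc (0 : Fin q → ℝ) 1, |z x| ≤ H + η := by
    intro x hx
    have := abs_add_le (h x) (z x - h x)
    rw [add_sub_cancel] at this
    linarith [hH x hx, hη x hx]
  have key : ∀ v : Finset (Fin q),
      |∫ x, z (v.piecewise x b) * ∏ j, mixedFactor φ T r b v x j ∂cubeMeasure q -
        ∫ x, h (v.piecewise x b) * ∏ j, mixedFactor φ T' r b v x j ∂cubeMeasure q| ≤
        η * M ^ q + H * (q * M ^ q * e) := by
    intro v
    rw [← integral_sub (integrable_stieltjesByParts hφ zm hzb T r hb v)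
      (integrable_stieltjesByParts hφ hm hH T' r hb v), ← Real.norm_eq_abs]
    refine (norm_integral_le_of_norm_le_const (C := η * M ^ q + H * (q * M ^ q * e)) ?_).trans
      (by simp)
    filter_upwards [ae_cubeMeasure_mem q] with x hx
    have hx1 := norm_le_one_of_mem_cube hx
    have hp := piecewise_mem_Icc v hx hb
    have k1 := hη _ hp
    have k2 := hH _ hp
    have k3 : |∏ j, mixedFactor φ T r b v x j| ≤ M ^ q := by
      simpa using abs_prod_le_pow Finset.univ (hMT x hx1 v)
    have k4 : |∏ j, mixedFactor φ T r b v x j - ∏ j, mixedFactor φ T' r b v x j| ≤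
        q * M ^ q * e := by
      simpa using abs_prod_sub_prod_le Finset.univ hM (hMT x hx1 v) (hMT' x hx1 v) (he x hx1 v)
    rw [Real.norm_eq_abs]
    set A := ∏ j, mixedFactor φ T r b v x j
    set A' := ∏ j, mixedFactor φ T' r b v x j
    have : z (v.piecewise x b) * A - h (v.piecewise x b) * A' =
      (z (v.piecewise x b) - h (v.piecewise x b)) * A + h (v.piecewise x b) * (A - A') := by ring
    rw [this]
    refine (abs_add_le _ _).trans ?_
    rw [abs_mul, abs_mul]
    exact add_le_add (mul_le_mul k1 k3 (abs_nonneg _) ((abs_nonneg _).trans k1))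
      (mul_le_mul k2 k4 (abs_nonneg _) ((abs_nonneg _).trans k2))
  refine (Finset.sum_le_sum fun v _ => key v).trans_eq ?_
  simp
  ring

/-- Dominated convergence: for fixed `x` the integrand is continuous in the parameters except where
`b j = x j` for some `j`, and at any given `b` this concerns a null set of `x`. -/
theorem continuous_stieltjesByParts {φ : Fin q → ℝ → ℝ} (hφ : ∀ j, ContDiff ℝ 1 (φ j))
    {h : (Fin q → ℝ) → ℝ} (hc : Continuous h) {H : ℝ} (hH : ∀ x, |h x| ≤ H) (T : Fin q → ℝ) :
    Continuous fun p : (Fin q → ℝ) × (Fin q → ℝ) => stieltjesByParts φ h T p.1 p.2 := by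
  unfold stieltjesByParts
  refine continuous_finsetSum _ fun v _ => continuous_iff_continuousAt.2 fun p₀ => ?_
  obtain ⟨M, hM, hMb⟩ := exists_bound_mixedFactor hφ (max ‖T‖ (‖p₀‖ + 1))
  have hH0 : 0 ≤ H := (abs_nonneg _).trans (hH 0)
  refine continuousAt_of_dominated (bound := fun _ => H * M ^ q) ?_ ?_ (integrable_const _) ?_
  · refine Eventually.of_forall fun p => Measurable.aestronglyMeasurable ?_
    exact (hc.measurable.comp (measurable_piecewise_cube v p.2)).mul
      (Finset.measurable_prod _ fun j _ => measurable_mixedFactor hφ T p.1 p.2 v j)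
  · filter_upwards [Metric.ball_mem_nhds p₀ one_pos] with p hp
    have hp' : ‖p‖ ≤ ‖p₀‖ + 1 := by
      have := norm_le_norm_add_norm_sub p₀ p
      rw [Metric.mem_ball, dist_eq_norm, ← norm_neg, neg_sub] at hp
      linarith
    filter_upwards [ae_cubeMeasure_mem q] with x hx
    rw [Real.norm_eq_abs, abs_mul]
    refine mul_le_mul (hH _) ?_ (abs_nonneg _) hH0
    simpa using abs_prod_le_pow Finset.univ fun j => hMb T p.1 p.2 (le_max_left _ _)
      (((norm_fst_le p).trans hp').trans (le_max_right _ _))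
      (((norm_snd_le p).trans hp').trans (le_max_right _ _)) x
      ((norm_le_one_of_mem_cube hx).trans ((by linarith [norm_nonneg p₀] : (1 : ℝ) ≤ ‖p₀‖ + 1).trans
        (le_max_right _ _))) v j
  · filter_upwards [ae_cubeMeasure_ne p₀.2] with x hx
    refine ContinuousAt.mul ?_ ?_
    · exact (hc.comp ((continuous_piecewise_cube v).comp
        (by fun_prop : Continuous fun p : (Fin q → ℝ) × (Fin q → ℝ) => (x, p.2)))).continuousAt
    · refine tendsto_finsetProd _ fun j _ => ?_
      have hval : ContinuousAt (fun p : (Fin q → ℝ) × (Fin q → ℝ) =>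
          valueFactor φ T p.1 p.2 j) p₀ :=
        ((continuous_pi_iff.1 (continuous_valueFactor hφ) j).comp
          (by fun_prop : Continuous fun p : (Fin q → ℝ) × (Fin q → ℝ) =>
            (T, p.1, p.2))).continuousAt
      have hslope : ContinuousAt (fun p : (Fin q → ℝ) × (Fin q → ℝ) =>
          slopeFactor φ T p.1 x j) p₀ :=
        ((continuous_pi_iff.1 (continuous_slopeFactor hφ) j).comp
          (by fun_prop : Continuous fun p : (Fin q → ℝ) × (Fin q → ℝ) =>
            (T, p.1, x))).continuousAt
      have hb : ContinuousAt (fun p : (Fin q → ℝ) × (Fin q → ℝ) => p.2 j) p₀ := by fun_prop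
      unfold mixedFactor
      by_cases hj : j ∈ v
      · simp only [hj, if_true]
        rcases lt_or_gt_of_ne (hx j) with hlt | hgt
        · refine ContinuousAt.congr hslope ?_
          filter_upwards [hb.eventually (lt_mem_nhds hlt)] with p hp
          simp [hp.le]
        · refine ContinuousAt.congr (continuousAt_const (y := (0 : ℝ))) ?_
          filter_upwards [hb.eventually (gt_mem_nhds hgt)] with p hp
          simp [not_le.2 hp]
      · simp only [hj, if_false]
        exact hval

end productKernel

/-! ### Weighted sums as integrals of partial sums -/

section partialSums

variable {q : ℕ}

theorem setIntegral_ite_slope {φ : ℝ → ℝ} (hφ : ContDiff ℝ 1 φ) (T r : ℝ) {c b : ℝ} (hc : 0 ≤ c)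
    (hcb : c ≤ b) (hb : b ≤ 1) :
    ∫ t in Set.Icc (0 : ℝ) 1,
      (if c ≤ t then (if t ≤ b then T * deriv φ (r - T * t) else 0) else 0) =
      φ (r - T * c) - φ (r - T * b) := by
  have h1 : (fun t => if c ≤ t then (if t ≤ b then T * deriv φ (r - T * t) else 0) else 0) =
      (Set.Icc c b).indicator fun t => T * deriv φ (r - T * t) := by
    funext t
    by_cases h1 : c ≤ t <;> by_cases h2 : t ≤ b <;> simp [Set.indicator, h1, h2]
  have hd : ∀ t, HasDerivAt (fun t => -φ (r - T * t)) (T * deriv φ (r - T * t)) t := by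
    intro t
    have h2 : HasDerivAt (fun t : ℝ => r - T * t) (-T) t := by
      simpa using ((hasDerivAt_id t).const_mul T).const_sub r
    have h3 := (hφ.differentiable one_ne_zero (r - T * t)).hasDerivAt.comp t h2
    have h4 : T * deriv φ (r - T * t) = -(deriv φ (r - T * t) * -T) := by ring
    rw [h4]
    exact h3.neg
  have hcont : Continuous fun t : ℝ => T * deriv φ (r - T * t) :=
    continuous_const.mul ((hφ.continuous_deriv le_rfl).comp (by fun_prop))
  rw [h1, setIntegral_indicator measurableSet_Icc,
    Set.inter_eq_right.2 (Set.Icc_subset_Icc hc hb), integral_Icc_eq_integral_Ioc,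
    ← intervalIntegral.integral_of_le hcb,
    intervalIntegral.integral_eq_sub_of_hasDerivAt (fun t _ => hd t)
      (hcont.intervalIntegrable _ _)]
  ring

/-- The multivariate form of `φ(c) = φ(b) + ∫_c^b` of the slope. Expanding the product of these
sums, `v` is the set of coordinates in which the integral is chosen, and Fubini's theorem
reassembles each term into one integral over the cube. -/
theorem prod_valueFactor_eq_sum {φ : Fin q → ℝ → ℝ} (hφ : ∀ j, ContDiff ℝ 1 (φ j))
    (T r : Fin q → ℝ) {c b : Fin q → ℝ} (hc : 0 ≤ c) (hcb : c ≤ b) (hb : b ≤ 1) :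
    ∏ j, valueFactor φ T r c j = ∑ v : Finset (Fin q), ∫ x,
      (if ∀ j ∈ v, c j ≤ x j then (1 : ℝ) else 0) * ∏ j, mixedFactor φ T r b v x j
        ∂cubeMeasure q := by
  have h1 : ∀ j, valueFactor φ T r c j =
      (∫ t in Set.Icc (0 : ℝ) 1, (if c j ≤ t then
        (if t ≤ b j then T j * deriv (φ j) (r j - T j * t) else 0) else 0)) +
      valueFactor φ T r b j := by
    intro j
    rw [setIntegral_ite_slope (hφ j) (T j) (r j) (hc j) (hcb j) (hb j)]
    simp [valueFactor]
  simp_rw [h1]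
  rw [Fintype.prod_add]
  refine Finset.sum_congr rfl fun v _ => ?_
  have h2 : ∀ x : Fin q → ℝ,
      (if ∀ j ∈ v, c j ≤ x j then (1 : ℝ) else 0) * ∏ j, mixedFactor φ T r b v x j =
      ∏ j, (fun (j : Fin q) (t : ℝ) => if j ∈ v then (if c j ≤ t then
        (if t ≤ b j then T j * deriv (φ j) (r j - T j * t) else 0) else 0)
        else valueFactor φ T r b j) j (x j) := by
    intro x
    by_cases hx : ∀ j ∈ v, c j ≤ x j
    · rw [if_pos hx, one_mul]
      refine Finset.prod_congr rfl fun j _ => ?_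
      by_cases hj : j ∈ v
      · simp [mixedFactor, slopeFactor, hj, hx j hj]
      · simp [mixedFactor, hj]
    · rw [if_neg hx, zero_mul]
      push Not at hx
      obtain ⟨j, hj, hlt⟩ := hx
      exact (Finset.prod_eq_zero (Finset.mem_univ j) (by simp [hj, not_le.2 hlt])).symm
  simp_rw [h2]
  rw [integral_cubeMeasure_prod (fun (j : Fin q) (t : ℝ) => if j ∈ v then (if c j ≤ t then
        (if t ≤ b j then T j * deriv (φ j) (r j - T j * t) else 0) else 0)
        else valueFactor φ T r b j), ← Finset.prod_mul_prod_compl v]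
  congr 1
  · exact Finset.prod_congr rfl fun j hj => by simp [hj]
  · refine Finset.prod_congr rfl fun j hj => ?_
    rw [Finset.mem_compl] at hj
    simp [hj]

theorem measurable_sum_Icc_floor (e : (Fin q → ℕ) → ℝ) (n : Fin q → ℕ) :
    Measurable fun v : Fin q → ℝ =>
      ∑ i ∈ Finset.Icc (1 : Fin q → ℕ) (fun j => ⌊(n j : ℝ) * v j⌋₊), e i := by
  have h1 : Measurable fun v : Fin q → ℝ => (fun j => ⌊(n j : ℝ) * v j⌋₊ : Fin q → ℕ) :=
    measurable_pi_lambda _ fun j => ((measurable_pi_apply j).const_mul _).nat_floor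
  exact (measurable_of_countable
    (fun N : Fin q → ℕ => ∑ i ∈ Finset.Icc (1 : Fin q → ℕ) N, e i)).comp h1

/-- A weighted sum with product weights is the Stieltjes integral against the partial sums. -/
theorem sum_mul_prod_valueFactor {φ : Fin q → ℝ → ℝ} (hφ : ∀ j, ContDiff ℝ 1 (φ j))
    (e : (Fin q → ℕ) → ℝ) {n : Fin q → ℕ} (hn : 1 ≤ n) (T r : Fin q → ℝ) {b : Fin q → ℝ}
    (hb : b ∈ Set.Icc (0 : Fin q → ℝ) 1) :
    ∑ i ∈ Finset.Icc (1 : Fin q → ℕ) (fun j => ⌊(n j : ℝ) * b j⌋₊),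
      e i * ∏ j, valueFactor φ T r (fun j => (i j : ℝ) / n j) j =
    stieltjesByParts φ (fun v => ∑ i ∈ Finset.Icc (1 : Fin q → ℕ)
      (fun j => ⌊(n j : ℝ) * v j⌋₊), e i) T r b := by
  have hn0 : ∀ j, (0 : ℝ) < n j := fun j => Nat.cast_pos.2 (hn j)
  have hle : ∀ i : Fin q → ℕ, ∀ j, ∀ t : ℝ, 0 ≤ t → (i j ≤ ⌊(n j : ℝ) * t⌋₊ ↔
      (i j : ℝ) / n j ≤ t) := by
    intro i j t ht
    rw [Nat.le_floor_iff (mul_nonneg (hn0 j).le ht), div_le_iff₀ (hn0 j), mul_comm]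
  have h1 : ∀ i ∈ Finset.Icc (1 : Fin q → ℕ) (fun j => ⌊(n j : ℝ) * b j⌋₊),
      e i * ∏ j, valueFactor φ T r (fun j => (i j : ℝ) / n j) j =
      ∑ v : Finset (Fin q), ∫ x, e i * ((if ∀ j ∈ v, (i j : ℝ) / n j ≤ x j then (1 : ℝ) else 0) *
        ∏ j, mixedFactor φ T r b v x j) ∂cubeMeasure q := by
    intro i hi
    rw [prod_valueFactor_eq_sum hφ T r (c := fun j => (i j : ℝ) / n j) (b := b)
      (fun j => by positivity)
      (fun j => (hle i j _ (hb.1 j)).1 ((Finset.mem_Icc.1 hi).2 j)) hb.2, Finset.mul_sum]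
    simp_rw [integral_const_mul]
  rw [Finset.sum_congr rfl h1, Finset.sum_comm]
  unfold stieltjesByParts
  refine Finset.sum_congr rfl fun v _ => ?_
  have hint : ∀ i ∈ Finset.Icc (1 : Fin q → ℕ) (fun j => ⌊(n j : ℝ) * b j⌋₊),
      Integrable (fun x => e i * ((if ∀ j ∈ v, (i j : ℝ) / n j ≤ x j then (1 : ℝ) else 0) *
        ∏ j, mixedFactor φ T r b v x j)) (cubeMeasure q) := by
    intro i _
    have hm : Measurable fun y : Fin q → ℝ =>
        if ∀ j ∈ v, (i j : ℝ) / n j ≤ y j then (1 : ℝ) else 0 := by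
      refine Measurable.ite ?_ measurable_const measurable_const
      have : {y : Fin q → ℝ | ∀ j ∈ v, (i j : ℝ) / n j ≤ y j} =
          ⋂ j ∈ v, {y : Fin q → ℝ | (i j : ℝ) / n j ≤ y j} := by ext; simp
      rw [this]
      exact Finset.measurableSet_biInter _ fun j _ =>
        measurableSet_le measurable_const (measurable_pi_apply j)
    have := integrable_stieltjesByParts hφ hm (H := 1)
      (fun x _ => by split_ifs <;> simp) T r hb v
    refine Integrable.const_mul (this.congr (Eventually.of_forall fun x => ?_)) _
    have hiff : (∀ j ∈ v, (i j : ℝ) / n j ≤ v.piecewise x b j) ↔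
        ∀ j ∈ v, (i j : ℝ) / n j ≤ x j :=
      forall₂_congr fun j hj => by simp [hj]
    simp only [hiff]
  rw [← integral_finsetSum _ hint]
  refine integral_congr_ae ?_
  filter_upwards [ae_cubeMeasure_mem q] with x hx
  -- If `x ≤ b` on `v`, the indices whose indicator is one are exactly those up to the floor of `n`
  -- times `v.piecewise x b`. Otherwise the cutoff in `mixedFactor` makes both sides zero.
  by_cases hxb : ∀ j ∈ v, x j ≤ b j
  · simp_rw [← mul_assoc]
    rw [← Finset.sum_mul]
    congr 1
    simp_rw [mul_ite, mul_one, mul_zero]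
    rw [← Finset.sum_filter]
    refine Finset.sum_congr ?_ fun _ _ => rfl
    ext i
    simp only [Finset.mem_filter, Finset.mem_Icc, Pi.le_def]
    constructor
    · rintro ⟨⟨hi1, hi2⟩, hi3⟩
      refine ⟨hi1, fun j => ?_⟩
      by_cases hj : j ∈ v
      · simpa [hj] using (hle i j _ (hx.1 j)).2 (hi3 j hj)
      · simpa [hj] using hi2 j
    · rintro ⟨hi1, hi2⟩
      refine ⟨⟨hi1, fun j => ?_⟩, fun j hj => (hle i j _ (hx.1 j)).1 (by simpa [hj] using hi2 j)⟩
      have := hi2 j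
      by_cases hj : j ∈ v
      · simp only [hj, Finset.piecewise_eq_of_mem] at this
        exact this.trans (Nat.floor_mono (mul_le_mul_of_nonneg_left (hxb j hj) (hn0 j).le))
      · simpa [hj] using this
  · push Not at hxb
    obtain ⟨j, hj, hlt⟩ := hxb
    have : ∏ j, mixedFactor φ T r b v x j = 0 :=
      Finset.prod_eq_zero (Finset.mem_univ j) (by simp [mixedFactor, hj, not_le.2 hlt])
    simp [this]

end partialSums

/-! ### Riemann-Stieltjes integrals against product kernels -/

section riemannStieltjes

variable {q : ℕ}

/-- Expanding a product of differences over `v` produces the signed sum over subsets; coordinates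
outside `v` always stay at the upper corner. -/
theorem altSum_prod (v : Finset (Fin q)) (g : Fin q → ℝ → ℝ) (lo up : Fin q → ℝ) :
    altSum v (fun z => ∏ j, g j (z j)) lo up =
      (∏ j ∈ v, (g j (up j) - g j (lo j))) * ∏ j ∈ vᶜ, g j (up j) := by
  unfold altSum
  rw [Finset.prod_sub, Finset.sum_mul]
  refine Finset.sum_congr rfl fun w hw => ?_
  have hw' := Finset.mem_powerset.1 hw
  dsimp only
  rw [← Finset.prod_mul_prod_compl v, ← Finset.prod_sdiff hw']
  have h1 : ∏ j ∈ v \ w, g j (w.piecewise lo up j) = ∏ j ∈ v \ w, g j (up j) :=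
    Finset.prod_congr rfl fun j hj => by simp [(Finset.mem_sdiff.1 hj).2]
  have h2 : ∏ j ∈ w, g j (w.piecewise lo up j) = ∏ j ∈ w, g j (lo j) :=
    Finset.prod_congr rfl fun j hj => by simp [hj]
  have h3 : ∏ j ∈ vᶜ, g j (w.piecewise lo up j) = ∏ j ∈ vᶜ, g j (up j) :=
    Finset.prod_congr rfl fun j hj => by
      have : j ∉ w := fun h => Finset.mem_compl.1 hj (hw' h)
      simp [this]
  rw [h1, h2, h3]
  ring

/-- Consecutive half-open cells tile `(p 0, p N]`, so each point of it is counted exactly once. -/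
theorem sum_range_ite_Ioc {p : ℕ → ℝ} (hp : Monotone p) (N : ℕ) (t s : ℝ) :
    ∑ m ∈ Finset.range N, (if p m < t ∧ t ≤ p (m + 1) then s else 0) =
      if p 0 < t ∧ t ≤ p N then s else 0 := by
  induction N with
  | zero =>
    have : ¬ (p 0 < t ∧ t ≤ p 0) := fun h => absurd h.1 (not_lt.2 h.2)
    simp [this]
  | succ N ih =>
    rw [Finset.sum_range_succ, ih]
    have h0 : p 0 ≤ p N := hp (Nat.zero_le _)
    have h1 : p N ≤ p (N + 1) := hp (Nat.le_succ _)
    by_cases h2 : t ≤ p N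
    · simp [h2, h2.trans h1]
    · have h3 := not_le.1 h2
      simp [h2, h3, h0.trans_lt h3]

theorem Grid.pt_mem {a b : Fin q → ℝ} (G : Grid a b) {j : Fin q} {i : ℕ} (hi : i ≤ G.size j) :
    G.pt j i ∈ Set.Icc (a j) (b j) :=
  ⟨(G.pt_zero j).symm.le.trans (G.mono j (Nat.zero_le _)), (G.mono j hi).trans (G.pt_size j).le⟩

theorem Grid.lt_size {a b : Fin q → ℝ} (G : Grid a b) {v : Finset (Fin q)} {k : Fin q → ℕ}
    (hk : k ∈ G.cells v) {j : Fin q} (hj : j ∈ v) : k j < G.size j := by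
  have := Fintype.mem_piFinset.1 hk j
  simpa [hj] using this

theorem Grid.tag_mem {a b a' b' c : Fin q → ℝ} (G : Grid a b) (ha : a' ≤ a) (hb : b ≤ b')
    {v : Finset (Fin q)} (hc : ∀ j ∉ v, c j ∈ Set.Icc (a' j) (b' j)) {t : Fin q → ℝ} {k : Fin q → ℕ}
    (hk : k ∈ G.cells v)
    (ht : ∀ j ∈ v, t j ∈ Set.Icc (G.pt j (k j)) (G.pt j (k j + 1))) :
    v.piecewise t c ∈ Set.Icc a' b' := by
  have : ∀ j, v.piecewise t c j ∈ Set.Icc (a' j) (b' j) := by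
    intro j
    by_cases hj : j ∈ v
    · have h1 := G.pt_mem (G.lt_size hk hj).le
      have h2 := G.pt_mem (Nat.succ_le_of_lt (G.lt_size hk hj))
      simp only [hj, Finset.piecewise_eq_of_mem]
      exact ⟨(ha j).trans (h1.1.trans (ht j hj).1), (ht j hj).2.trans (h2.2.trans (hb j))⟩
    · simpa [hj] using hc j hj
  exact ⟨fun j => (this j).1, fun j => (this j).2⟩

/-- Tags lie in their cells, so only values of `h` on a box matter. The larger box `[a', b']` leaves
room for the frozen coordinates `c`. -/
theorem HasRSIntegral.congr {v : Finset (Fin q)} {a b a' b' c : Fin q → ℝ}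
    {h h' f : (Fin q → ℝ) → ℝ} {I : ℝ} (ha : a' ≤ a) (hb : b ≤ b')
    (hc : ∀ j ∉ v, c j ∈ Set.Icc (a' j) (b' j)) (hh : Set.EqOn h h' (Set.Icc a' b'))
    (H : HasRSIntegral v c h f a b I) : HasRSIntegral v c h' f a b I := by
  intro ε hε
  obtain ⟨η, hη, hH⟩ := H ε hε
  refine ⟨η, hη, fun G tag hG htag => ?_⟩
  rw [← Finset.sum_congr rfl fun k hk => ?_]
  · exact hH G tag hG htag
  · rw [hh (G.tag_mem ha hb hc hk (htag k hk))]

/-! ### Uniqueness, existence and value of the Riemann-Stieltjes integrals -/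

/-- The uniform grid with `N + 1` cells in each direction. -/
def uniformGrid {a b : Fin q → ℝ} (hab : a ≤ b) (N : ℕ) : Grid a b where
  size _ := N + 1
  pt j i := a j + (min i (N + 1) : ℕ) / ((N : ℝ) + 1) * (b j - a j)
  mono j i i' hi := by
    have : 0 ≤ b j - a j := sub_nonneg.2 (hab j)
    dsimp only
    gcongr
  pt_zero j := by simp
  pt_size j := by
    have : (N : ℝ) + 1 ≠ 0 := by positivity
    simp [this]

theorem uniformGrid_mesh {a b : Fin q → ℝ} (hab : a ≤ b) (N : ℕ) (j : Fin q) (i : ℕ) :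
    (uniformGrid hab N).pt j (i + 1) - (uniformGrid hab N).pt j i ≤ (b j - a j) / (N + 1) := by
  have h0 : 0 ≤ b j - a j := sub_nonneg.2 (hab j)
  have hN : (0 : ℝ) < (N : ℝ) + 1 := by positivity
  have h1 : ((min (i + 1) (N + 1) : ℕ) : ℝ) - (min i (N + 1) : ℕ) ≤ 1 := by
    have : min (i + 1) (N + 1) ≤ min i (N + 1) + 1 := by omega
    have : ((min (i + 1) (N + 1) : ℕ) : ℝ) ≤ (min i (N + 1) : ℕ) + 1 := by exact_mod_cast this
    linarith
  have h2 : (uniformGrid hab N).pt j (i + 1) - (uniformGrid hab N).pt j i =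
      (((min (i + 1) (N + 1) : ℕ) : ℝ) - (min i (N + 1) : ℕ)) * ((b j - a j) / (N + 1)) := by
    simp only [uniformGrid]
    ring
  rw [h2]
  exact mul_le_of_le_one_left (by positivity) h1

/-- There are grids of arbitrarily small mesh, so both values are approximated by one and the same
sum. -/
theorem HasRSIntegral.unique {v : Finset (Fin q)} {a b c : Fin q → ℝ} (hab : a ≤ b)
    {h f : (Fin q → ℝ) → ℝ} {I I' : ℝ} (H : HasRSIntegral v c h f a b I)
    (H' : HasRSIntegral v c h f a b I') : I = I' := by
  refine eq_of_forall_dist_le fun ε hε => ?_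
  obtain ⟨η, hη, h1⟩ := H (ε / 2) (half_pos hε)
  obtain ⟨η', hη', h2⟩ := H' (ε / 2) (half_pos hε)
  have hlim : ∀ᶠ N : ℕ in atTop, ∀ j, (b j - a j) / ((N : ℝ) + 1) < min η η' := by
    refine eventually_all.2 fun j => ?_
    have : Tendsto (fun N : ℕ => (b j - a j) / ((N : ℝ) + 1)) atTop (𝓝 0) :=
      tendsto_const_nhds.div_atTop (tendsto_atTop_add_const_right _ _ tendsto_natCast_atTop_atTop)
    exact this.eventually (gt_mem_nhds (lt_min hη hη'))
  obtain ⟨N, hN⟩ := hlim.exists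
  set G := uniformGrid hab N
  set tag : (Fin q → ℕ) → Fin q → ℝ := fun k j => G.pt j (k j)
  have htag : ∀ k ∈ G.cells v, ∀ j ∈ v, tag k j ∈ Set.Icc (G.pt j (k j)) (G.pt j (k j + 1)) :=
    fun k _ j _ => ⟨le_rfl, G.mono j (Nat.le_succ _)⟩
  have k1 := h1 G tag (fun j _ i _ => (uniformGrid_mesh hab N j i).trans_lt
    ((hN j).trans_le (min_le_left _ _))) htag
  have k2 := h2 G tag (fun j _ i _ => (uniformGrid_mesh hab N j i).trans_lt
    ((hN j).trans_le (min_le_right _ _))) htag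
  rw [← Real.dist_eq] at k1 k2
  rw [dist_comm] at k1
  linarith [dist_triangle I (∑ k ∈ G.cells v,
    h (v.piecewise (tag k) c) * altSum v f (G.lower v c k) (G.upper v c k)) I']

theorem rsIntegral_eq {v : Finset (Fin q)} {a b c : Fin q → ℝ} (hab : a ≤ b)
    {h f : (Fin q → ℝ) → ℝ} {I : ℝ} (H : HasRSIntegral v c h f a b I) :
    rsIntegral v c h f a b = I := by
  have hex : ∃ I, HasRSIntegral v c h f a b I := ⟨I, H⟩
  unfold rsIntegral
  rw [dif_pos hex]
  exact hex.choose_spec.unique hab H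

theorem setIntegral_ite_slope_Ioc {φ : ℝ → ℝ} (hφ : ContDiff ℝ 1 φ) (T r : ℝ) {c b : ℝ}
    (hc : 0 ≤ c) (hcb : c ≤ b) (hb : b ≤ 1) :
    ∫ t in Set.Icc (0 : ℝ) 1, (if c < t ∧ t ≤ b then T * deriv φ (r - T * t) else 0) =
      φ (r - T * c) - φ (r - T * b) := by
  rw [← setIntegral_ite_slope hφ T r hc hcb hb]
  refine integral_congr_ae (ae_restrict_of_ae ?_)
  have : ∀ᵐ t : ℝ, t ≠ c := by simp [ae_iff]
  filter_upwards [this] with t ht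
  by_cases h1 : c ≤ t
  · simp [h1, lt_of_le_of_ne h1 (Ne.symm ht)]
  · simp [h1, mt le_of_lt h1]

/-- A cell increment of the product kernel is, up to the sign `(-1) ^ v.card`, the integral of the
mixed density over the cell, since `slopeFactor` differentiates minus the kernel factor. The
Riemann-Stieltjes sum thus differs from the integral by at most the oscillation of `h` on cells
times the total mass `M ^ q` of the density. -/
theorem hasRSIntegral_of_continuous {φ : Fin q → ℝ → ℝ} (hφ : ∀ j, ContDiff ℝ 1 (φ j))
    {h : (Fin q → ℝ) → ℝ} (hc : Continuous h) (T r : Fin q → ℝ) {b : Fin q → ℝ}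
    (hb : b ∈ Set.Icc (0 : Fin q → ℝ) 1) (v : Finset (Fin q)) :
    HasRSIntegral v b h (fun z => ∏ j, φ j (r j - T j * z j)) 0 b
      ((-1) ^ v.card * ∫ x, h (v.piecewise x b) * ∏ j, mixedFactor φ T r b v x j
        ∂cubeMeasure q) := by
  obtain ⟨M, hM, hMb⟩ := exists_bound_mixedFactor hφ (max 1 (max ‖T‖ ‖r‖))
  have hMx : ∀ x ∈ Set.Icc (0 : Fin q → ℝ) 1, ∀ j, |mixedFactor φ T r b v x j| ≤ M := by
    intro x hx j
    exact hMb T r b ((le_max_left _ _).trans (le_max_right _ _))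
      ((le_max_right _ _).trans (le_max_right _ _))
      ((norm_le_one_of_mem_cube hb).trans (le_max_left _ _)) x
      ((norm_le_one_of_mem_cube hx).trans (le_max_left _ _)) v j
  have hMpos : 0 < M ^ q := by positivity
  obtain ⟨H, hH⟩ := (isCompact_Icc (a := (0 : Fin q → ℝ)) (b := 1)).exists_bound_of_continuousOn
    hc.continuousOn
  intro ε hε
  set e : ℝ := ε / (2 * M ^ q) with he
  have hepos : 0 < e := by positivity
  obtain ⟨η, hη, huc⟩ := Metric.uniformContinuousOn_iff.1
    ((isCompact_Icc (a := (0 : Fin q → ℝ)) (b := 1)).uniformContinuousOn_of_continuous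
      hc.continuousOn) e hepos
  refine ⟨η, hη, fun G tag hG htag => ?_⟩
  -- The density cut down to the `m`-th half-open cell in the directions of `v`, and the boundary
  -- value in the others.
  set F : Fin q → ℕ → ℝ → ℝ := fun j m t => if j ∈ v then
    (if G.pt j m < t ∧ t ≤ G.pt j (m + 1) then T j * deriv (φ j) (r j - T j * t) else 0)
    else valueFactor φ T r b j with hF
  have hterm : ∀ k ∈ G.cells v,
      altSum v (fun z => ∏ j, φ j (r j - T j * z j)) (G.lower v b k) (G.upper v b k) =
      (-1) ^ v.card * ∫ x, ∏ j, F j (k j) (x j) ∂cubeMeasure q := by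
    intro k hk
    rw [altSum_prod v (fun j z => φ j (r j - T j * z)),
      integral_cubeMeasure_prod (fun j => F j (k j)), ← Finset.prod_mul_prod_compl v (fun j =>
        ∫ t in Set.Icc (0 : ℝ) 1, F j (k j) t), ← mul_assoc]
    congr 1
    · rw [← Finset.prod_const, ← Finset.prod_mul_distrib]
      refine Finset.prod_congr rfl fun j hj => ?_
      have h1 := G.pt_mem (G.lt_size hk hj).le
      have h2 := G.pt_mem (Nat.succ_le_of_lt (G.lt_size hk hj))
      simp only [hF, hj, if_true, Grid.upper, Grid.lower, Finset.piecewise_eq_of_mem]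
      rw [setIntegral_ite_slope_Ioc (hφ j) (T j) (r j) h1.1 (G.mono j (Nat.le_succ _))
        (h2.2.trans (hb.2 j))]
      ring
    · refine Finset.prod_congr rfl fun j hj => ?_
      rw [Finset.mem_compl] at hj
      simp [hF, hj, Grid.upper, valueFactor]
  have hFm : ∀ j m, Measurable (F j m) := by
    intro j m
    have hs : Continuous fun t : ℝ => T j * deriv (φ j) (r j - T j * t) :=
      continuous_const.mul (((hφ j).continuous_deriv le_rfl).comp (by fun_prop))
    refine Measurable.ite (MeasurableSet.const _) (Measurable.ite ?_ hs.measurable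
      measurable_const) measurable_const
    exact measurableSet_Ioc
  have hFint : ∀ k : Fin q → ℕ, Integrable (fun x => ∏ j, F j (k j) (x j)) (cubeMeasure q) := by
    intro k
    refine Integrable.fintype_prod (f := fun j => F j (k j)) fun j => ?_
    have hs : Continuous fun t : ℝ => T j * deriv (φ j) (r j - T j * t) :=
      continuous_const.mul (((hφ j).continuous_deriv le_rfl).comp (by fun_prop))
    obtain ⟨C, hC⟩ := (isCompact_Icc (a := (0 : ℝ)) (b := 1)).exists_bound_of_continuousOn
      hs.continuousOn
    refine Integrable.of_bound (hFm j (k j)).aestronglyMeasurable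
      (max C |valueFactor φ T r b j|) ?_
    filter_upwards [ae_restrict_mem measurableSet_Icc] with t ht
    have hCt := hC t ht
    rw [Real.norm_eq_abs] at hCt ⊢
    simp only [hF]
    split_ifs
    · exact hCt.trans (le_max_left _ _)
    · simp
    · exact le_max_right _ _
  -- A sum over cells of products is a product of one-dimensional sums, each with at most one
  -- nonzero term in the directions of `v`. With `g = id` this recovers the density, with `g = abs`
  -- its absolute value. Positivity of `x` is needed because the half-open cells miss `0`.
  have hsumF : ∀ (x : Fin q → ℝ), (∀ j, 0 < x j) → ∀ g : ℝ → ℝ, g 0 = 0 →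
      ∑ k ∈ G.cells v, ∏ j, g (F j (k j) (x j)) = ∏ j, g (mixedFactor φ T r b v x j) := by
    intro x hx g hg
    unfold Grid.cells
    rw [← Finset.prod_univ_sum (fun j => if j ∈ v then Finset.range (G.size j) else {0})
      (fun j m => g (F j m (x j)))]
    refine Finset.prod_congr rfl fun j _ => ?_
    by_cases hj : j ∈ v
    · simp only [hF, hj, if_true, mixedFactor, slopeFactor]
      simp_rw [apply_ite g, hg]
      rw [sum_range_ite_Ioc (G.mono j), G.pt_zero, G.pt_size]
      simp [hx j]
    · simp [hF, hj, mixedFactor]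
  have hLHS : ∑ k ∈ G.cells v, h (v.piecewise (tag k) b) *
      altSum v (fun z => ∏ j, φ j (r j - T j * z j)) (G.lower v b k) (G.upper v b k) =
      (-1) ^ v.card * ∫ x, ∑ k ∈ G.cells v, h (v.piecewise (tag k) b) * ∏ j, F j (k j) (x j)
        ∂cubeMeasure q := by
    rw [integral_finsetSum _ fun k _ => (hFint k).const_mul _, Finset.mul_sum]
    refine Finset.sum_congr rfl fun k hk => ?_
    rw [hterm k hk, integral_const_mul]
    ring
  rw [hLHS, ← mul_sub, ← integral_sub
    (integrable_finsetSum _ fun k _ => (hFint k).const_mul _)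
    (integrable_stieltjesByParts hφ hc.measurable (fun x hx => hH x hx) T r hb v), abs_mul,
    abs_pow, abs_neg, abs_one, one_pow, one_mul, ← Real.norm_eq_abs]
  refine (norm_integral_le_of_norm_le_const (C := e * M ^ q) ?_).trans_lt ?_
  · filter_upwards [ae_cubeMeasure_mem q, ae_cubeMeasure_ne (0 : Fin q → ℝ)] with x hx hx0
    have hxpos : ∀ j, 0 < x j := fun j => lt_of_le_of_ne (hx.1 j) (Ne.symm (hx0 j))
    have h1 := hsumF x hxpos id rfl
    simp only [id] at h1
    have h2 := hsumF x hxpos abs abs_zero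
    rw [← h1, Finset.mul_sum, ← Finset.sum_sub_distrib, Real.norm_eq_abs]
    refine (Finset.abs_sum_le_sum_abs _ _).trans ?_
    calc ∑ k ∈ G.cells v, |h (v.piecewise (tag k) b) * ∏ j, F j (k j) (x j) -
          h (v.piecewise x b) * ∏ j, F j (k j) (x j)|
        ≤ ∑ k ∈ G.cells v, e * ∏ j, |F j (k j) (x j)| := by
          refine Finset.sum_le_sum fun k hk => ?_
          rw [← sub_mul, abs_mul, Finset.abs_prod]
          -- Either `x` lies in the cell and the tag is closer to it than the mesh bound, or the
          -- product of the cut-down densities vanishes at `x`.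
          by_cases hcell : ∀ j ∈ v, G.pt j (k j) < x j ∧ x j ≤ G.pt j (k j + 1)
          · refine mul_le_mul_of_nonneg_right ?_ (Finset.prod_nonneg fun j _ => abs_nonneg _)
            rw [← Real.dist_eq]
            refine (huc _ (G.tag_mem le_rfl hb.2 (fun j _ => ⟨hb.1 j, hb.2 j⟩) hk (htag k hk)) _
              (piecewise_mem_Icc v hx hb) ?_).le
            refine (dist_pi_lt_iff hη).2 fun j => ?_
            by_cases hj : j ∈ v
            · simp only [hj, Finset.piecewise_eq_of_mem]
              have hm := hG j hj (k j) (G.lt_size hk hj)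
              have ht := htag k hk j hj
              rw [Real.dist_eq, abs_lt]
              constructor <;> linarith [ht.1, ht.2, (hcell j hj).1, (hcell j hj).2]
            · simpa [hj] using hη
          · push Not at hcell
            obtain ⟨j, hj, hlt⟩ := hcell
            have h0 : ∏ j, |F j (k j) (x j)| = 0 := by
              refine Finset.prod_eq_zero (Finset.mem_univ j) ?_
              have : ¬ (G.pt j (k j) < x j ∧ x j ≤ G.pt j (k j + 1)) :=
                fun h => absurd h.2 (not_le.2 (hlt h.1))
              simp [hF, hj, this]
            rw [h0, mul_zero, mul_zero]
      _ = e * ∏ j, |mixedFactor φ T r b v x j| := by rw [← Finset.mul_sum, h2]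
      _ ≤ e * M ^ q := by
          refine mul_le_mul_of_nonneg_left ?_ hepos.le
          rw [← Finset.abs_prod]
          simpa using abs_prod_le_pow Finset.univ (hMx x hx)
  · have : e * M ^ q = ε / 2 := by rw [he]; field_simp
    simp [this, hε]

/-- The retraction of `ℝ^q` onto the unit cube. -/
def clampCube (x : Fin q → ℝ) : Fin q → ℝ := fun j => max 0 (min 1 (x j))

theorem continuous_clampCube : Continuous (clampCube (q := q)) := by
  unfold clampCube; fun_prop

theorem clampCube_mem (x : Fin q → ℝ) : clampCube x ∈ Set.Icc (0 : Fin q → ℝ) 1 :=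
  ⟨fun _ => le_max_left _ _, fun _ => max_le zero_le_one (min_le_left _ _)⟩

theorem clampCube_of_mem {x : Fin q → ℝ} (hx : x ∈ Set.Icc (0 : Fin q → ℝ) 1) :
    clampCube x = x := by
  funext j
  have h1 := hx.1 j
  have h2 := hx.2 j
  simp only [Pi.zero_apply, Pi.one_apply] at h1 h2
  simp [clampCube, h1, h2]

theorem stieltjesByParts_congr {φ : Fin q → ℝ → ℝ} {h h' : (Fin q → ℝ) → ℝ}
    (hh : Set.EqOn h h' (Set.Icc 0 1)) (T r : Fin q → ℝ) {b : Fin q → ℝ}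
    (hb : b ∈ Set.Icc (0 : Fin q → ℝ) 1) :
    stieltjesByParts φ h T r b = stieltjesByParts φ h' T r b := by
  refine Finset.sum_congr rfl fun v _ => integral_congr_ae ?_
  filter_upwards [ae_cubeMeasure_mem q] with x hx
  rw [hh (piecewise_mem_Icc v hx hb)]

/-- If `w` is nonempty, `h` is only evaluated at points with a zero coordinate, so every sum is
zero. If `w` is empty, composing with `clampCube` reduces to globally continuous `h` without
changing it on the cube. -/
theorem hasRSIntegral_of_continuousOn {φ : Fin q → ℝ → ℝ} (hφ : ∀ j, ContDiff ℝ 1 (φ j))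
    {h : (Fin q → ℝ) → ℝ} (hc : ContinuousOn h (Set.Icc 0 1))
    (h0 : ∀ x ∈ Set.Icc (0 : Fin q → ℝ) 1, (∃ j, x j = 0) → h x = 0)
    (T r : Fin q → ℝ) {b : Fin q → ℝ} (hb : b ∈ Set.Icc (0 : Fin q → ℝ) 1)
    {v w : Finset (Fin q)} (hw : w ⊆ vᶜ) :
    HasRSIntegral v (w.piecewise 0 b) h (fun z => ∏ j, φ j (r j - T j * z j)) 0 b
      (if w = ∅ then (-1) ^ v.card * ∫ x, h (v.piecewise x b) *
        ∏ j, mixedFactor φ T r b v x j ∂cubeMeasure q else 0) := by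
  have hb' : ∀ j ∉ v, b j ∈ Set.Icc ((0 : Fin q → ℝ) j) ((1 : Fin q → ℝ) j) :=
    fun j _ => ⟨hb.1 j, hb.2 j⟩
  by_cases hw0 : w = ∅
  · subst hw0
    simp only [if_true, Finset.piecewise_empty]
    have key := hasRSIntegral_of_continuous hφ
      (hc.comp_continuous continuous_clampCube clampCube_mem) T r hb v
    have heq : Set.EqOn (h ∘ clampCube) h (Set.Icc 0 1) :=
      fun x hx => by simp only [Function.comp, clampCube_of_mem hx]
    have H := key.congr le_rfl hb.2 hb' heq
    have hI : ∫ x, (h ∘ clampCube) (v.piecewise x b) * ∏ j, mixedFactor φ T r b v x j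
        ∂cubeMeasure q = ∫ x, h (v.piecewise x b) * ∏ j, mixedFactor φ T r b v x j
        ∂cubeMeasure q := by
      refine integral_congr_ae ?_
      filter_upwards [ae_cubeMeasure_mem q] with x hx
      rw [Function.comp, clampCube_of_mem (piecewise_mem_Icc v hx hb)]
    rwa [hI] at H
  · rw [if_neg hw0]
    obtain ⟨j, hj⟩ := Finset.nonempty_iff_ne_empty.2 hw0
    have hjv : j ∉ v := Finset.mem_compl.1 (hw hj)
    intro ε hε
    refine ⟨1, one_pos, fun G tag _ htag => ?_⟩
    have hzero : ∀ k ∈ G.cells v, h (v.piecewise (tag k) (w.piecewise 0 b)) = 0 := by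
      intro k hk
      refine h0 _ (G.tag_mem le_rfl hb.2 (fun i _ => ?_) hk (htag k hk)) ⟨j, by simp [hjv, hj]⟩
      have := piecewise_mem_Icc w ⟨le_rfl, zero_le_one⟩ hb
      exact ⟨this.1 i, this.2 i⟩
    rw [Finset.sum_eq_zero fun k hk => by rw [hzero k hk, zero_mul]]
    simpa using hε

theorem byPartsExists_of_continuousOn {φ : Fin q → ℝ → ℝ} (hφ : ∀ j, ContDiff ℝ 1 (φ j))
    {h : (Fin q → ℝ) → ℝ} (hc : ContinuousOn h (Set.Icc 0 1))
    (h0 : ∀ x ∈ Set.Icc (0 : Fin q → ℝ) 1, (∃ j, x j = 0) → h x = 0)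
    (T r : Fin q → ℝ) {b : Fin q → ℝ} (hb : b ∈ Set.Icc (0 : Fin q → ℝ) 1) :
    ByPartsExists (fun z => ∏ j, φ j (r j - T j * z j)) h 0 b :=
  fun _ _ hw => ⟨_, hasRSIntegral_of_continuousOn hφ hc h0 T r hb hw⟩

/-- Only `w = ∅` survives, and the sign of the integration by parts formula cancels the sign
produced by differentiating minus the kernel factors in the coordinates of `v`. -/
theorem byPartsIntegral_eq {φ : Fin q → ℝ → ℝ} (hφ : ∀ j, ContDiff ℝ 1 (φ j))
    {h : (Fin q → ℝ) → ℝ} (hc : ContinuousOn h (Set.Icc 0 1))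
    (h0 : ∀ x ∈ Set.Icc (0 : Fin q → ℝ) 1, (∃ j, x j = 0) → h x = 0)
    (T r : Fin q → ℝ) {b : Fin q → ℝ} (hb : b ∈ Set.Icc (0 : Fin q → ℝ) 1) :
    byPartsIntegral (fun z => ∏ j, φ j (r j - T j * z j)) h 0 b =
      stieltjesByParts φ h T r b := by
  unfold byPartsIntegral stieltjesByParts
  refine Finset.sum_congr rfl fun v _ => ?_
  rw [Finset.sum_congr rfl fun w hw => by
    rw [rsIntegral_eq hb.1 (hasRSIntegral_of_continuousOn hφ hc h0 T r hb
      (Finset.mem_powerset.1 hw))]]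
  simp only [mul_ite, mul_zero]
  rw [Finset.sum_ite_eq' vᶜ.powerset ∅, if_pos (Finset.empty_mem_powerset _), Finset.card_empty,
    pow_zero, one_mul, ← mul_assoc, ← mul_pow]
  simp

end riemannStieltjes

/-! ### Alternating sums -/

section altSum

variable {q : ℕ}

theorem piecewise_eq_update_self {v : Finset (Fin q)} {j : Fin q} (hj : j ∉ v)
    (x y : Fin q → ℝ) : v.piecewise x y = Function.update (v.piecewise x y) j (y j) := by
  rw [eq_comm, Function.update_eq_self_iff]
  simp [hj]

/-- Peeling off one coordinate: subsets of `insert j u` split according to whether they contain `j`.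
This is the induction step for the facts on alternating sums that follow. -/
theorem altSum_insert {u : Finset (Fin q)} {j : Fin q} (hj : j ∉ u) (f : (Fin q → ℝ) → ℝ)
    (x y : Fin q → ℝ) :
    altSum (insert j u) f x y = altSum u (fun z => f (Function.update z j (y j))) x y -
      altSum u (fun z => f (Function.update z j (x j))) x y := by
  unfold altSum
  rw [Finset.sum_powerset_insert hj, sub_eq_add_neg, ← Finset.sum_neg_distrib]
  congr 1
  · refine Finset.sum_congr rfl fun v hv => ?_
    have hjv : j ∉ v := fun h => hj (Finset.mem_powerset.1 hv h)
    dsimp only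
    rw [← piecewise_eq_update_self hjv]
  · refine Finset.sum_congr rfl fun v hv => ?_
    have hjv : j ∉ v := fun h => hj (Finset.mem_powerset.1 hv h)
    rw [Finset.card_insert_of_notMem hjv, pow_succ, Finset.piecewise_insert]
    ring

theorem altSum_update_congr {u : Finset (Fin q)} {j : Fin q} (f : (Fin q → ℝ) → ℝ) (t : ℝ)
    {x y x' y' : Fin q → ℝ} (hx : ∀ i, i ≠ j → x i = x' i) (hy : ∀ i, i ≠ j → y i = y' i) :
    altSum u (fun z => f (Function.update z j t)) x y =
      altSum u (fun z => f (Function.update z j t)) x' y' := by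
  unfold altSum
  refine Finset.sum_congr rfl fun v _ => ?_
  have : Function.update (v.piecewise x y) j t = Function.update (v.piecewise x' y') j t := by
    funext i
    by_cases hi : i = j
    · subst hi; simp
    · by_cases hv : i ∈ v <;> simp [hi, hv, hx i hi, hy i hi]
  simp only [this]

theorem sum_piFinset_insert {u : Finset (Fin q)} {j : Fin q} (hj : j ∉ u)
    (S : Fin q → Finset ℕ) (F : (Fin q → ℕ) → ℝ) :
    ∑ k ∈ Fintype.piFinset (fun i => if i ∈ insert j u then S i else {0}), F k =
      ∑ k ∈ Fintype.piFinset (fun i => if i ∈ u then S i else {0}),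
        ∑ m ∈ S j, F (Function.update k j m) := by
  rw [← Finset.sum_product']
  refine Finset.sum_nbij' (fun k => (Function.update k j 0, k j))
    (fun p => Function.update p.1 j p.2) ?_ ?_ ?_ ?_ ?_
  · intro k hk
    rw [Fintype.mem_piFinset] at hk
    rw [Finset.mem_product, Fintype.mem_piFinset]
    refine ⟨fun i => ?_, by simpa using hk j⟩
    have := hk i
    by_cases hi : i = j
    · subst hi; simp [hj]
    · simpa [hi] using this
  · intro p hp
    rw [Finset.mem_product, Fintype.mem_piFinset] at hp
    rw [Fintype.mem_piFinset]
    intro i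
    have := hp.1 i
    by_cases hi : i = j
    · subst hi; simpa using hp.2
    · simpa [hi] using this
  · intro k _; simp
  · intro p hp
    rw [Finset.mem_product, Fintype.mem_piFinset] at hp
    have := hp.1 j
    simp only [hj, if_false, Finset.mem_singleton] at this
    refine Prod.ext ?_ (by simp)
    simp only [Function.update_idem]
    rw [← this, Function.update_eq_self]
  · intro k _; simp

/-- Additivity of box increments: in each coordinate the sum over cells telescopes, and the
coordinates are treated one at a time. -/
theorem altSum_eq_sum_cells (u : Finset (Fin q)) (f : (Fin q → ℝ) → ℝ) (p : Fin q → ℕ → ℝ)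
    (c : Fin q → ℝ) {l m : Fin q → ℕ} (hlm : ∀ j, l j ≤ m j) :
    altSum u f (u.piecewise (fun j => p j (l j)) c) (u.piecewise (fun j => p j (m j)) c) =
      ∑ k ∈ Fintype.piFinset (fun j => if j ∈ u then Finset.Ico (l j) (m j) else {0}),
        altSum u f (u.piecewise (fun j => p j (k j)) c)
          (u.piecewise (fun j => p j (k j + 1)) c) := by
  induction u using Finset.induction_on generalizing f with
  | empty =>
    have : Fintype.piFinset (fun _ : Fin q => ({0} : Finset ℕ)) = {0} := by
      ext k; simp [funext_iff]
    simp [this]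
  | insert j u hj ih =>
    have hne : ∀ (A : Fin q → ℝ) (i : Fin q), i ≠ j →
        (insert j u).piecewise A c i = u.piecewise A c i := by
      intro A i hi
      by_cases hu : i ∈ u <;> simp [hu, hi]
    have hcell : ∀ k : Fin q → ℕ, ∀ n : ℕ,
        altSum (insert j u) f
          ((insert j u).piecewise (fun i => p i (Function.update k j n i)) c)
          ((insert j u).piecewise (fun i => p i (Function.update k j n i + 1)) c) =
        altSum u (fun z => f (Function.update z j (p j (n + 1))))
          (u.piecewise (fun i => p i (k i)) c) (u.piecewise (fun i => p i (k i + 1)) c) -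
        altSum u (fun z => f (Function.update z j (p j n)))
          (u.piecewise (fun i => p i (k i)) c) (u.piecewise (fun i => p i (k i + 1)) c) := by
      intro k n
      have h1 : ∀ i, i ≠ j →
          (insert j u).piecewise (fun i => p i (Function.update k j n i)) c i =
          u.piecewise (fun i => p i (k i)) c i := by
        intro i hi; rw [hne _ i hi]; by_cases hu : i ∈ u <;> simp [hu, hi]
      have h2 : ∀ i, i ≠ j →
          (insert j u).piecewise (fun i => p i (Function.update k j n i + 1)) c i =
          u.piecewise (fun i => p i (k i + 1)) c i := by
        intro i hi; rw [hne _ i hi]; by_cases hu : i ∈ u <;> simp [hu, hi]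
      rw [altSum_insert hj, altSum_update_congr f _ h1 h2, altSum_update_congr f _ h1 h2]
      simp
    rw [sum_piFinset_insert hj (fun j => Finset.Ico (l j) (m j)), altSum_insert hj,
      altSum_update_congr f _ (hne _) (hne _), altSum_update_congr f _ (hne _) (hne _), ih, ih,
      ← Finset.sum_sub_distrib]
    refine Finset.sum_congr rfl fun k _ => ?_
    rw [Finset.sum_congr rfl fun n _ => hcell k n]
    simp only [Finset.mem_insert, true_or, Finset.piecewise_eq_of_mem]
    exact (Finset.sum_Ico_sub (fun n => altSum u (fun z => f (Function.update z j (p j n)))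
      (u.piecewise (fun i => p i (k i)) c) (u.piecewise (fun i => p i (k i + 1)) c))
      (hlm j)).symm

/-- Inclusion-exclusion anchored at `b`: substituting `x i` for `b i` is the identity minus the
increment in coordinate `i`, and the product of these operators over `U` is expanded. -/
theorem sum_powerset_altSum (U : Finset (Fin q)) (g : (Fin q → ℝ) → ℝ) (x b : Fin q → ℝ) :
    ∑ u ∈ U.powerset, (-1) ^ u.card * altSum u g x b = g (U.piecewise x b) := by
  induction U using Finset.induction_on generalizing g with
  | empty => simp [altSum]
  | insert i U hi ih =>
    rw [Finset.sum_powerset_insert hi]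
    have h1 : ∀ u ∈ U.powerset, (-1) ^ (insert i u).card * altSum (insert i u) g x b =
        (-1) ^ u.card * altSum u (fun z => g (Function.update z i (x i))) x b -
        (-1) ^ u.card * altSum u (fun z => g (Function.update z i (b i))) x b := by
      intro u hu
      have hiu : i ∉ u := fun h => hi (Finset.mem_powerset.1 hu h)
      rw [altSum_insert hiu, Finset.card_insert_of_notMem hiu, pow_succ]
      ring
    rw [Finset.sum_congr rfl h1, Finset.sum_sub_distrib, ih, ih, ih,
      ← piecewise_eq_update_self hi, Finset.piecewise_insert]
    ring

/-- A one-coordinate increment is bounded by alternating sums over the boxes up to `b`. -/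
theorem abs_sub_update_le_sum_altSum (f : (Fin q → ℝ) → ℝ) (j : Fin q) (x b : Fin q → ℝ)
    (s t : ℝ) :
    |f (Function.update x j t) - f (Function.update x j s)| ≤
      ∑ u ∈ Finset.univ.filter (fun u : Finset (Fin q) => j ∈ u),
        |altSum u f (u.piecewise (Function.update x j s) b)
          (u.piecewise (Function.update b j t) b)| := by
  have hU : j ∉ (Finset.univ.erase j : Finset (Fin q)) := Finset.notMem_erase _ _
  -- All coordinates except `j` are expanded around `b`. Subtracting the expansions at `t` and `s`
  -- turns each term into an increment that also involves `j`.
  have h1 : ∀ r : ℝ, f (Function.update x j r) = ∑ u ∈ (Finset.univ.erase j).powerset,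
      (-1) ^ u.card * altSum u (fun z => f (Function.update z j r)) x b := by
    intro r
    rw [sum_powerset_altSum]
    congr 1
    funext i
    by_cases hi : i = j
    · subst hi; simp
    · simp [hi]
  rw [h1 t, h1 s, ← Finset.sum_sub_distrib]
  refine (Finset.abs_sum_le_sum_abs _ _).trans ?_
  have h2 : Finset.univ.filter (fun u : Finset (Fin q) => j ∈ u) =
      (Finset.univ.erase j).powerset.image (insert j) := by
    ext u
    simp only [Finset.mem_filter, Finset.mem_univ, true_and, Finset.mem_image,
      Finset.mem_powerset]
    constructor
    · intro h
      exact ⟨u.erase j, Finset.erase_subset_erase _ (Finset.subset_univ _), Finset.insert_erase h⟩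
    · rintro ⟨v, _, rfl⟩
      exact Finset.mem_insert_self _ _
  rw [h2, Finset.sum_image]
  · refine Finset.sum_le_sum fun u hu => le_of_eq ?_
    have hju : j ∉ u := fun h => hU (Finset.mem_powerset.1 hu h)
    have h3 : ∀ i, i ≠ j → (insert j u).piecewise (Function.update x j s) b i =
        u.piecewise x b i := by
      intro i hi; by_cases hu : i ∈ u <;> simp [hu, hi]
    have h4 : ∀ i, i ≠ j → (insert j u).piecewise (Function.update b j t) b i = b i := by
      intro i hi; by_cases hu : i ∈ u <;> simp [hu, hi]
    have h5 : ∀ r : ℝ, altSum u (fun z => f (Function.update z j r)) (u.piecewise x b) b =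
        altSum u (fun z => f (Function.update z j r)) x b := by
      intro r
      unfold altSum
      refine Finset.sum_congr rfl fun v hv => ?_
      have : v.piecewise (u.piecewise x b) b = v.piecewise x b := by
        funext i
        by_cases hi : i ∈ v
        · simp [hi, Finset.mem_powerset.1 hv hi]
        · simp [hi]
      rw [this]
    rw [← mul_sub, abs_mul, abs_pow, abs_neg, abs_one, one_pow, one_mul, altSum_insert hju,
      altSum_update_congr f _ h3 h4, altSum_update_congr f _ h3 h4, h5, h5]
    simp
  · intro u hu v hv huv
    have hju : j ∉ u := fun h => hU (Finset.mem_powerset.1 hu h)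
    have hjv : j ∉ v := fun h => hU (Finset.mem_powerset.1 hv h)
    rw [← Finset.erase_insert hju, ← Finset.erase_insert hjv, huv]

end altSum

/-! ### Functions of bounded Hardy-Krause variation -/

section hardyKrause

variable {q : ℕ}

/-- A grid through given finite sets of points in each coordinate, with the index functions. -/
theorem exists_grid_through {a b : Fin q → ℝ} (S : Fin q → Finset ℝ)
    (ha : ∀ i, a i ∈ S i) (hb : ∀ i, b i ∈ S i) (hS : ∀ i, ∀ s ∈ S i, s ∈ Set.Icc (a i) (b i)) :
    ∃ (G : Grid a b) (idx : Fin q → ℝ → ℕ),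
      (∀ i, ∀ s ∈ S i, ∀ t ∈ S i, s ≤ t → idx i s ≤ idx i t) ∧
      (∀ i, ∀ s ∈ S i, G.pt i (idx i s) = s) ∧ ∀ i, ∀ s ∈ S i, idx i s ≤ G.size i := by
  have hpos : ∀ i, 0 < (S i).card := fun i => Finset.card_pos.2 ⟨a i, ha i⟩
  have hlt : ∀ i n, min n ((S i).card - 1) < (S i).card := fun i n => by
    have := hpos i; omega
  -- The points of `S i` in increasing order form the grid. The `min` freezes the index after the
  -- last point, and the default index `0` concerns only points outside `S i`.
  refine ⟨⟨fun i => (S i).card - 1, fun i n => (S i).orderEmbOfFin rfl ⟨_, hlt i n⟩, ?_, ?_, ?_⟩,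
    fun i s => if h : s ∈ S i then (((S i).orderIsoOfFin rfl).symm ⟨s, h⟩ : Fin _) else 0,
    ?_, ?_, ?_⟩
  · intro i n n' hn
    refine ((S i).orderEmbOfFin rfl).monotone ?_
    rw [Fin.mk_le_mk]
    omega
  · intro i
    have h1 := Finset.orderEmbOfFin_zero (s := S i) rfl (hpos i)
    simp only [Nat.zero_min]
    rw [h1]
    exact le_antisymm (Finset.min'_le _ _ (ha i)) (hS i _ (Finset.min'_mem _ _)).1
  · intro i
    have h1 := Finset.orderEmbOfFin_last (s := S i) rfl (hpos i)
    simp only [min_self]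
    rw [h1]
    exact le_antisymm (hS i _ (Finset.max'_mem _ _)).2 (Finset.le_max' _ _ (hb i))
  · intro i s hs t ht hst
    simp only [hs, ht, dif_pos, Fin.val_fin_le, OrderIso.le_iff_le]
    exact hst
  · intro i s hs
    simp only [hs, dif_pos]
    have h2 : ∀ n : Fin (S i).card, min (n : ℕ) ((S i).card - 1) = n := fun n => by
      have := n.2; omega
    simp only [h2, Fin.eta, ← Finset.coe_orderIsoOfFin_apply, OrderIso.apply_symm_apply]
  · intro i s hs
    simp only [hs, dif_pos]
    exact Nat.le_sub_one_of_lt (Fin.is_lt _)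

/-- Boxes that are separated in the single coordinate `j` have no cell in common, however they
overlap elsewhere. Refining each box into its grid cells therefore uses every cell at most once. -/
theorem Grid.sum_boxes_le_vitaliVariation {a b : Fin q → ℝ} (G : Grid a b) (f : (Fin q → ℝ) → ℝ)
    (u : Finset (Fin q)) {j : Fin q} (hj : j ∈ u) (m : ℕ) (lo up : ℕ → Fin q → ℕ)
    (hle : ∀ k < m, ∀ i, lo k i ≤ up k i) (hup : ∀ k < m, ∀ i, up k i ≤ G.size i)
    (hdisj : ∀ k < m, ∀ k' < m, k < k' → up k j ≤ lo k' j) :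
    ∑ k ∈ Finset.range m, ENNReal.ofReal
      |altSum u f (u.piecewise (fun i => G.pt i (lo k i)) b)
        (u.piecewise (fun i => G.pt i (up k i)) b)| ≤ vitaliVariation u b f a b := by
  set C : ℕ → Finset (Fin q → ℕ) := fun k =>
    Fintype.piFinset (fun i => if i ∈ u then Finset.Ico (lo k i) (up k i) else {0}) with hC
  have hmem : ∀ k, ∀ c ∈ C k, ∀ i ∈ u, lo k i ≤ c i ∧ c i < up k i := by
    intro k c hc i hi
    have := Fintype.mem_piFinset.1 hc i
    simpa [hi] using this
  have hpd : Set.PairwiseDisjoint (Finset.range m : Set ℕ) C := by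
    have aux : ∀ k < m, ∀ k' < m, k < k' → Disjoint (C k) (C k') := by
      intro k hk k' hk' hlt
      rw [Finset.disjoint_left]
      intro c hc hc'
      have h1 := (hmem k c hc j hj).2
      have h2 := (hmem k' c hc' j hj).1
      have h3 := hdisj k hk k' hk' hlt
      omega
    intro k hk k' hk' hne
    have hk1 := Finset.mem_range.1 (Finset.mem_coe.1 hk)
    have hk2 := Finset.mem_range.1 (Finset.mem_coe.1 hk')
    rcases lt_or_gt_of_ne hne with h | h
    · exact aux k hk1 k' hk2 h
    · exact (aux k' hk2 k hk1 h).symm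
  calc _ ≤ ∑ k ∈ Finset.range m, ∑ c ∈ C k, ENNReal.ofReal
        |altSum u f (G.lower u b c) (G.upper u b c)| := by
        refine Finset.sum_le_sum fun k hk => ?_
        rw [altSum_eq_sum_cells u f G.pt b (hle k (Finset.mem_range.1 hk)),
          ← ENNReal.ofReal_sum_of_nonneg fun _ _ => abs_nonneg _]
        exact ENNReal.ofReal_le_ofReal (Finset.abs_sum_le_sum_abs _ _)
    _ = ∑ c ∈ (Finset.range m).biUnion C, ENNReal.ofReal
        |altSum u f (G.lower u b c) (G.upper u b c)| := (Finset.sum_biUnion hpd).symm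
    _ ≤ ∑ c ∈ G.cells u, ENNReal.ofReal |altSum u f (G.lower u b c) (G.upper u b c)| := by
        refine Finset.sum_le_sum_of_subset ?_
        intro c hc
        obtain ⟨k, hk, hck⟩ := Finset.mem_biUnion.1 hc
        refine Fintype.mem_piFinset.2 fun i => ?_
        by_cases hi : i ∈ u
        · have h1 := (hmem k c hck i hi).2
          have h2 := hup k (Finset.mem_range.1 hk) i
          simp only [hi, if_true, Finset.mem_range]
          omega
        · simpa [hi] using Fintype.mem_piFinset.1 hck i
    _ ≤ _ := le_iSup (fun G : Grid a b => ∑ k ∈ G.cells u,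
        ENNReal.ofReal |altSum u f (G.lower u b k) (G.upper u b k)|) G

/-- The total increment along one coordinate, with the other coordinates chosen freely for each
increment, is at most the Hardy-Krause variation. -/
theorem sum_increments_le_hardyKrauseVariation {a b : Fin q → ℝ} (f : (Fin q → ℝ) → ℝ)
    (j : Fin q) (t : ℕ → ℝ) (ht : Monotone t) (htm : ∀ k, t k ∈ Set.Icc (a j) (b j))
    (x : ℕ → Fin q → ℝ) (hx : ∀ k, x k ∈ Set.Icc a b) (m : ℕ) :
    ∑ k ∈ Finset.range m, ENNReal.ofReal
      |f (Function.update (x k) j (t (k + 1))) - f (Function.update (x k) j (t k))| ≤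
      hardyKrauseVariation f a b := by
  classical
  have hab : ∀ i, a i ≤ b i := fun i => ((hx 0).1 i).trans ((hx 0).2 i)
  -- One grid through all the corners: the free coordinates of every `x k`, all the `t k`, and the
  -- endpoints. The boxes `[x k, b]` may overlap, but in coordinate `j` they occupy the successive
  -- intervals `[t k, t (k + 1)]`.
  set S : Fin q → Finset ℝ := fun i => {a i, b i} ∪ (Finset.range (m + 1)).image
    (fun k => Function.update (x k) j (t k) i) with hS
  have hxm : ∀ k, Function.update (x k) j (t k) ∈ Set.Icc a b := by
    intro k
    refine ⟨fun i => ?_, fun i => ?_⟩ <;> by_cases hi : i = j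
    · subst hi; simpa using (htm k).1
    · simpa [hi] using (hx k).1 i
    · subst hi; simpa using (htm k).2
    · simpa [hi] using (hx k).2 i
  have hlow : ∀ k < m + 1, ∀ i, Function.update (x k) j (t k) i ∈ S i := fun k hk i =>
    Finset.mem_union_right _ (Finset.mem_image.2 ⟨k, Finset.mem_range.2 hk, rfl⟩)
  have hupp : ∀ k < m, ∀ i, Function.update b j (t (k + 1)) i ∈ S i := by
    intro k hk i
    by_cases hi : i = j
    · subst hi
      simpa using hlow (k + 1) (by omega) i
    · simp [hS, hi]
  obtain ⟨G, idx, hidx, hpt, hsz⟩ := exists_grid_through (a := a) (b := b) S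
    (fun i => by simp [hS]) (fun i => by simp [hS]) (by
      intro i s hs
      simp only [hS, Finset.mem_union, Finset.mem_insert, Finset.mem_singleton,
        Finset.mem_image] at hs
      rcases hs with (rfl | rfl) | ⟨k, _, rfl⟩
      · exact ⟨le_rfl, hab i⟩
      · exact ⟨hab i, le_rfl⟩
      · exact ⟨(hxm k).1 i, (hxm k).2 i⟩)
  set lo : ℕ → Fin q → ℕ := fun k i => idx i (Function.update (x k) j (t k) i) with hlo
  set up : ℕ → Fin q → ℕ := fun k i => idx i (Function.update b j (t (k + 1)) i) with hup
  have hbound : ∀ u : Finset (Fin q), j ∈ u → ∑ k ∈ Finset.range m, ENNReal.ofReal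
      |altSum u f (u.piecewise (Function.update (x k) j (t k)) b)
        (u.piecewise (Function.update b j (t (k + 1))) b)| ≤ vitaliVariation u b f a b := by
    intro u hu
    refine le_of_eq_of_le (Finset.sum_congr rfl fun k hk => ?_)
      (G.sum_boxes_le_vitaliVariation f u hu m lo up ?_ ?_ ?_)
    · have hk' := Finset.mem_range.1 hk
      have h1 : (fun i => G.pt i (lo k i)) = Function.update (x k) j (t k) :=
        funext fun i => hpt i _ (hlow k (by omega) i)
      have h2 : (fun i => G.pt i (up k i)) = Function.update b j (t (k + 1)) :=
        funext fun i => hpt i _ (hupp k hk' i)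
      rw [h1, h2]
    · intro k hk i
      refine hidx i _ (hlow k (by omega) i) _ (hupp k hk i) ?_
      by_cases hi : i = j
      · subst hi; simpa using ht (Nat.le_succ k)
      · simpa [hi] using (hx k).2 i
    · intro k hk i
      exact hsz i _ (hupp k hk i)
    · intro k hk k' hk' hlt
      refine hidx j _ (hupp k hk j) _ (hlow k' (by omega) j) ?_
      simpa using ht (Nat.succ_le_of_lt hlt)
  calc _ ≤ ∑ k ∈ Finset.range m, ∑ u ∈ Finset.univ.filter (fun u : Finset (Fin q) => j ∈ u),
        ENNReal.ofReal |altSum u f (u.piecewise (Function.update (x k) j (t k)) b)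
        (u.piecewise (Function.update b j (t (k + 1))) b)| := by
        refine Finset.sum_le_sum fun k _ => ?_
        rw [← ENNReal.ofReal_sum_of_nonneg fun _ _ => abs_nonneg _]
        exact ENNReal.ofReal_le_ofReal (abs_sub_update_le_sum_altSum f j (x k) b _ _)
    _ = ∑ u ∈ Finset.univ.filter (fun u : Finset (Fin q) => j ∈ u), ∑ k ∈ Finset.range m,
        ENNReal.ofReal |altSum u f (u.piecewise (Function.update (x k) j (t k)) b)
        (u.piecewise (Function.update b j (t (k + 1))) b)| := Finset.sum_comm
    _ ≤ ∑ u ∈ Finset.univ.filter (fun u : Finset (Fin q) => j ∈ u), vitaliVariation u b f a b :=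
        Finset.sum_le_sum fun u hu => hbound u (Finset.mem_filter.1 hu).2
    _ ≤ _ := by
        refine Finset.sum_le_sum_of_subset ?_
        intro u hu
        refine Finset.mem_erase.2 ⟨?_, Finset.mem_univ _⟩
        rintro rfl
        simp at hu

/-- The choices for different `k` are independent, so the suprema can be taken one after another;
`c` collects the terms already chosen during the induction. -/
theorem add_sum_iSup_le {X : Type*} [Nonempty X] (φ : ℕ → X → ℝ≥0∞) (V : ℝ≥0∞) (m : ℕ) (c : ℝ≥0∞)
    (h : ∀ x : ℕ → X, c + ∑ k ∈ Finset.range m, φ k (x k) ≤ V) :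
    c + ∑ k ∈ Finset.range m, ⨆ x, φ k x ≤ V := by
  induction m generalizing c with
  | zero => simpa using h
  | succ m ih =>
    rw [Finset.sum_range_succ, ← add_assoc, ENNReal.add_iSup]
    refine iSup_le fun y => ?_
    rw [add_right_comm]
    refine ih _ fun x => ?_
    have := h (fun k => if k < m then x k else y)
    rw [Finset.sum_range_succ] at this
    refine le_of_eq_of_le ?_ this
    have hsum : ∑ k ∈ Finset.range m, φ k (if k < m then x k else y) =
        ∑ k ∈ Finset.range m, φ k (x k) :=
      Finset.sum_congr rfl fun k hk => by rw [if_pos (Finset.mem_range.1 hk)]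
    rw [hsum, if_neg (lt_irrefl m)]
    ring

/-- A function of bounded Hardy-Krause variation is controlled by monotone functions of the
coordinates. -/
theorem exists_monotone_majorant {a b : Fin q → ℝ} (hab : a ≤ b) {f : (Fin q → ℝ) → ℝ}
    (hf : hardyKrauseVariation f a b < ⊤) :
    ∃ Φ : Fin q → ℝ → ℝ, (∀ j, MonotoneOn (Φ j) (Set.Icc (a j) (b j))) ∧
      ∀ x ∈ Set.Icc a b, ∀ y ∈ Set.Icc a b, |f x - f y| ≤ ∑ j, |Φ j (x j) - Φ j (y j)| := by
  have : Nonempty (Set.Icc a b) := ⟨⟨a, le_rfl, hab⟩⟩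
  -- The slices of `f` at height `t` in coordinate `j` form a curve in the space of functions with
  -- the uniform distance. Its variation is a sum of suprema of increments, and the majorant is its
  -- variation function.
  set F : (j : Fin q) → ℝ → UniformFun (Set.Icc a b) ℝ := fun j t =>
    UniformFun.ofFun fun x => f (Function.update x.1 j t) with hF
  have hV : ∀ j, eVariationOn (F j) (Set.Icc (a j) (b j)) ≤ hardyKrauseVariation f a b := by
    intro j
    refine iSup_le fun p => ?_
    have := add_sum_iSup_le (fun k (x : Set.Icc a b) => ENNReal.ofReal
      |f (Function.update x.1 j (p.2.1 (k + 1))) - f (Function.update x.1 j (p.2.1 k))|)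
      (hardyKrauseVariation f a b) p.1 0 (fun x => by
        rw [zero_add]
        exact sum_increments_le_hardyKrauseVariation f j p.2.1 p.2.2.1 p.2.2.2
          (fun k => (x k).1) (fun k => (x k).2) p.1)
    rw [zero_add] at this
    refine le_of_eq_of_le (Finset.sum_congr rfl fun k _ => ?_) this
    rw [UniformFun.edist_def]
    simp only [edist_dist, Real.dist_eq, hF, UniformFun.toFun_ofFun]
  have hfin : ∀ j, ∀ s : Set ℝ, s ⊆ Set.Icc (a j) (b j) → eVariationOn (F j) s ≠ ⊤ := fun j s hs =>
    ((eVariationOn.mono (F j) hs).trans_lt ((hV j).trans_lt hf)).ne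
  refine ⟨fun j t => (eVariationOn (F j) (Set.Icc (a j) t)).toReal, ?_, ?_⟩
  · intro j s hs t ht hst
    exact ENNReal.toReal_mono (hfin j _ (Set.Icc_subset_Icc_right ht.2))
      (eVariationOn.mono _ (Set.Icc_subset_Icc_right hst))
  · have hinc : ∀ j, ∀ s ∈ Set.Icc (a j) (b j), ∀ t ∈ Set.Icc (a j) (b j), s ≤ t →
        ∀ x ∈ Set.Icc a b, |f (Function.update x j t) - f (Function.update x j s)| ≤
        (eVariationOn (F j) (Set.Icc (a j) t)).toReal -
          (eVariationOn (F j) (Set.Icc (a j) s)).toReal := by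
      intro j s hs t ht hst x hx
      have h1 := eVariationOn.Icc_add_Icc (F j) (s := Set.univ) hs.1 hst (Set.mem_univ s)
      simp only [Set.univ_inter] at h1
      have h2 : edist (F j t) (F j s) ≤ eVariationOn (F j) (Set.Icc s t) :=
        eVariationOn.edist_le _ ⟨hst, le_rfl⟩ ⟨le_rfl, hst⟩
      have h3 : ENNReal.ofReal |f (Function.update x j t) - f (Function.update x j s)| ≤
          edist (F j t) (F j s) := by
        rw [UniformFun.edist_def]
        refine le_of_eq_of_le ?_ (le_iSup (fun x : Set.Icc a b =>
          edist (UniformFun.toFun (F j t) x) (UniformFun.toFun (F j s) x)) ⟨x, hx⟩)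
        simp only [edist_dist, Real.dist_eq, hF, UniformFun.toFun_ofFun]
      have hf1 := hfin j (Set.Icc (a j) s) (Set.Icc_subset_Icc_right hs.2)
      have hf2 := hfin j (Set.Icc s t) (Set.Icc_subset_Icc hs.1 ht.2)
      rw [← h1, ENNReal.toReal_add hf1 hf2, add_sub_cancel_left]
      exact (ENNReal.ofReal_le_iff_le_toReal hf2).1 (h3.trans h2)
    have hinc' : ∀ j, ∀ s ∈ Set.Icc (a j) (b j), ∀ t ∈ Set.Icc (a j) (b j),
        ∀ x ∈ Set.Icc a b, |f (Function.update x j t) - f (Function.update x j s)| ≤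
        |(eVariationOn (F j) (Set.Icc (a j) t)).toReal -
          (eVariationOn (F j) (Set.Icc (a j) s)).toReal| := by
      intro j s hs t ht x hx
      rcases le_total s t with hst | hst
      · exact (hinc j s hs t ht hst x hx).trans (le_abs_self _)
      · rw [abs_sub_comm, abs_sub_comm (ENNReal.toReal _)]
        exact (hinc j t ht s hs hst x hx).trans (le_abs_self _)
    intro x hx y hy
    -- The passage from `y` to `x` changes one coordinate at a time.
    have key : ∀ U : Finset (Fin q), |f (U.piecewise x y) - f y| ≤
        ∑ j ∈ U, |(eVariationOn (F j) (Set.Icc (a j) (x j))).toReal -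
          (eVariationOn (F j) (Set.Icc (a j) (y j))).toReal| := by
      intro U
      induction U using Finset.induction_on with
      | empty => simp
      | insert j U hj ih =>
        rw [Finset.sum_insert hj]
        have h1 := hinc' j (y j) ⟨hy.1 j, hy.2 j⟩ (x j) ⟨hx.1 j, hx.2 j⟩ (U.piecewise x y)
          (piecewise_mem_Icc U hx hy)
        rw [← piecewise_eq_update_self hj, ← Finset.piecewise_insert] at h1
        refine (abs_sub_le _ (f (U.piecewise x y)) _).trans (add_le_add h1 ih)
    simpa using key Finset.univ

end hardyKrause

/-! ### Riemann sums on the unit cube -/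

section riemannSums

variable {q : ℕ}

/-- The index of the cell of the grid of mesh `1 / n` that contains `x`. -/
def cellIndex (n : Fin q → ℕ) (x : Fin q → ℝ) : Fin q → ℕ := fun j => ⌈(n j : ℝ) * x j⌉₊

theorem measurable_cellIndex (n : Fin q → ℕ) : Measurable (cellIndex n) :=
  measurable_pi_lambda _ fun j => ((measurable_pi_apply j).const_mul _).nat_ceil

theorem ae_cubeMeasure_pos (q : ℕ) :
    ∀ᵐ x ∂cubeMeasure q, ∀ j, 0 < x j ∧ x j ≤ 1 := by
  filter_upwards [ae_cubeMeasure_mem q, ae_cubeMeasure_ne (0 : Fin q → ℝ)] with x hx hx0 j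
  exact ⟨lt_of_le_of_ne (hx.1 j) (Ne.symm (hx0 j)), hx.2 j⟩

theorem cellIndex_mem {n : Fin q → ℕ} (hn : 1 ≤ n) {x : Fin q → ℝ}
    (hx : ∀ j, 0 < x j ∧ x j ≤ 1) : cellIndex n x ∈ Finset.Icc (1 : Fin q → ℕ) n := by
  rw [Finset.mem_Icc]
  have hn0 : ∀ j, (0 : ℝ) < n j := fun j => Nat.cast_pos.2 (hn j)
  refine ⟨fun j => Nat.one_le_ceil_iff.2 (mul_pos (hn0 j) (hx j).1), fun j => ?_⟩
  exact Nat.ceil_le.2 (mul_le_of_le_one_right (hn0 j).le (hx j).2)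

theorem setIntegral_ite_ceil {n i : ℕ} (hi : 1 ≤ i) (hin : i ≤ n) :
    ∫ t in Set.Icc (0 : ℝ) 1, (if ⌈(n : ℝ) * t⌉₊ = i then (1 : ℝ) else 0) = (n : ℝ)⁻¹ := by
  have hn : (0 : ℝ) < n := Nat.cast_pos.2 (hi.trans hin)
  have h1 : (fun t : ℝ => if ⌈(n : ℝ) * t⌉₊ = i then (1 : ℝ) else 0) =
      (Set.Ioc (((i : ℝ) - 1) / n) (i / n)).indicator fun _ => 1 := by
    funext t
    have : ⌈(n : ℝ) * t⌉₊ = i ↔ t ∈ Set.Ioc (((i : ℝ) - 1) / n) (i / n) := by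
      rw [Nat.ceil_eq_iff (by omega), Nat.cast_sub hi, Nat.cast_one, Set.mem_Ioc, div_lt_iff₀ hn,
        le_div_iff₀ hn, mul_comm]
    by_cases h : ⌈(n : ℝ) * t⌉₊ = i
    · rw [if_pos h, Set.indicator_of_mem (this.1 h)]
    · rw [if_neg h, Set.indicator_of_notMem (fun hm => h (this.2 hm))]
  have hi' : (1 : ℝ) ≤ i := by exact_mod_cast hi
  have hin' : (i : ℝ) ≤ n := by exact_mod_cast hin
  have hsub : Set.Ioc (((i : ℝ) - 1) / n) (i / n) ⊆ Set.Icc 0 1 := fun t ht =>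
    ⟨(div_nonneg (by linarith) hn.le).trans ht.1.le, ht.2.trans ((div_le_one hn).2 hin')⟩
  rw [h1, setIntegral_indicator measurableSet_Ioc, Set.inter_eq_right.2 hsub,
    setIntegral_const, smul_eq_mul, mul_one, Real.volume_real_Ioc_of_le (by gcongr; linarith)]
  field_simp
  ring

/-- The cells have equal mass, so an average over sites is the integral of a step function. This
lets sums over sites be handled by dominated convergence. -/
theorem integral_cellIndex {n : Fin q → ℕ} (hn : 1 ≤ n) (F : (Fin q → ℕ) → ℝ) :
    ∫ x, F (cellIndex n x) ∂cubeMeasure q =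
      (∏ j, (n j : ℝ))⁻¹ * ∑ i ∈ Finset.Icc (1 : Fin q → ℕ) n, F i := by
  have h1 : (fun x => F (cellIndex n x)) =ᵐ[cubeMeasure q] fun x =>
      ∑ i ∈ Finset.Icc (1 : Fin q → ℕ) n,
        F i * ∏ j, (if ⌈(n j : ℝ) * x j⌉₊ = i j then (1 : ℝ) else 0) := by
    filter_upwards [ae_cubeMeasure_pos q] with x hx
    have h2 : ∀ i : Fin q → ℕ, ∏ j, (if ⌈(n j : ℝ) * x j⌉₊ = i j then (1 : ℝ) else 0) =
        if cellIndex n x = i then 1 else 0 := by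
      intro i
      by_cases h : cellIndex n x = i
      · subst h; simp [cellIndex]
      · rw [if_neg h]
        obtain ⟨j, hj⟩ := Function.ne_iff.1 h
        exact Finset.prod_eq_zero (Finset.mem_univ j) (if_neg hj)
    simp_rw [h2, mul_ite, mul_one, mul_zero]
    rw [Finset.sum_ite_eq, if_pos (cellIndex_mem hn hx)]
  rw [integral_congr_ae h1, integral_finsetSum, Finset.mul_sum]
  · refine Finset.sum_congr rfl fun i hi => ?_
    rw [integral_const_mul, integral_cubeMeasure_prod
      (fun j t => if ⌈(n j : ℝ) * t⌉₊ = i j then (1 : ℝ) else 0), mul_comm, ← Finset.prod_inv_distrib]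
    congr 1
    exact Finset.prod_congr rfl fun j _ =>
      setIntegral_ite_ceil ((Finset.mem_Icc.1 hi).1 j) ((Finset.mem_Icc.1 hi).2 j)
  · intro i _
    refine Integrable.const_mul (Integrable.fintype_prod
      (f := fun j t => if ⌈(n j : ℝ) * t⌉₊ = i j then (1 : ℝ) else 0) fun j => ?_) _
    refine Integrable.of_bound (C := 1) (Measurable.aestronglyMeasurable ?_)
      (Eventually.of_forall fun t => by split_ifs <;> simp)
    exact Measurable.ite (((measurable_id.const_mul _).nat_ceil) (measurableSet_singleton _))
      measurable_const measurable_const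

/-! ### Scaling the unit cube -/

/-- The coordinatewise scaling by `c`. -/
def scaleEquiv (c : Fin q → ℝ) (hc : ∀ j, c j ≠ 0) : (Fin q → ℝ) ≃ᵐ (Fin q → ℝ) :=
  MeasurableEquiv.piCongrRight fun j => MeasurableEquiv.mulLeft₀ (c j) (hc j)

theorem scaleEquiv_apply (c : Fin q → ℝ) (hc : ∀ j, c j ≠ 0) (x : Fin q → ℝ) :
    scaleEquiv c hc x = fun j => c j * x j := rfl

/-- Change of variables for a diagonal matrix, whose determinant is the product of the scales. -/
theorem restrict_Icc_eq_map_cubeMeasure {c : Fin q → ℝ} (hc : ∀ j, 0 < c j) :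
    volume.restrict (Set.Icc 0 c) = ENNReal.ofReal (∏ j, c j) •
      (cubeMeasure q).map (scaleEquiv c fun j => (hc j).ne') := by
  have h1 := Real.smul_map_diagonal_volume_pi (ι := Fin q) (D := c)
    (by rw [Matrix.det_diagonal]; exact Finset.prod_ne_zero_iff.2 fun j _ => (hc j).ne')
  have h2 : (Matrix.toLin' (Matrix.diagonal c) : (Fin q → ℝ) → Fin q → ℝ) =
      scaleEquiv c fun j => (hc j).ne' := by
    funext x j
    rw [scaleEquiv_apply, Matrix.toLin'_apply, Matrix.mulVec_diagonal]
  rw [h2, Matrix.det_diagonal, abs_of_pos (Finset.prod_pos fun j _ => hc j)] at h1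
  have h3 : (scaleEquiv c fun j => (hc j).ne') ⁻¹' Set.Icc 0 c = Set.Icc 0 1 := by
    ext x
    simp only [Set.mem_preimage, scaleEquiv_apply, Set.mem_Icc, Pi.le_def, Pi.zero_apply,
      Pi.one_apply]
    refine and_congr (forall_congr' fun j => ?_) (forall_congr' fun j => ?_)
    · exact mul_nonneg_iff_of_pos_left (hc j)
    · exact mul_le_iff_le_one_right (hc j)
  rw [← h1, Measure.restrict_smul, (scaleEquiv c _).measurableEmbedding.restrict_map, h3,
    cubeMeasure_eq_restrict]

theorem setIntegral_eq_cubeMeasure {c B : Fin q → ℝ} (hc : ∀ j, 0 < c j) (hB : B ≤ c)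
    (g : (Fin q → ℝ) → ℝ) :
    ∫ z in Set.Icc 0 B, g z = (∏ j, c j) *
      ∫ x, (Set.Icc 0 B).indicator g (fun j => c j * x j) ∂cubeMeasure q := by
  have h1 : ∫ z in Set.Icc 0 B, g z = ∫ z in Set.Icc 0 c, (Set.Icc 0 B).indicator g z := by
    rw [setIntegral_indicator measurableSet_Icc,
      Set.inter_eq_right.2 (Set.Icc_subset_Icc_right hB)]
  rw [h1, restrict_Icc_eq_map_cubeMeasure hc, integral_smul_measure,
    (scaleEquiv c _).measurableEmbedding.integral_map,
    ENNReal.toReal_ofReal (Finset.prod_nonneg fun j _ => (hc j).le)]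
  rfl

theorem aestronglyMeasurable_of_comp_scale {c : Fin q → ℝ} (hc : ∀ j, 0 < c j)
    {g : (Fin q → ℝ) → ℝ}
    (hg : AEStronglyMeasurable (fun x => g (fun j => c j * x j)) (cubeMeasure q)) :
    AEStronglyMeasurable g (volume.restrict (Set.Icc 0 c)) := by
  rw [restrict_Icc_eq_map_cubeMeasure hc]
  refine AEStronglyMeasurable.smul_measure ?_ _
  rw [(scaleEquiv c _).measurableEmbedding.aestronglyMeasurable_map_iff]
  exact hg

end riemannSums

/-! ### Convergence of the drift -/

theorem abs_kernel_le (w x : Fin 3 → ℝ) : |kernel w x| ≤ ∏ j, |w j / Real.pi| := by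
  unfold kernel
  rw [Finset.abs_prod]
  refine Finset.prod_le_prod (fun _ _ => abs_nonneg _) fun j _ => ?_
  rw [abs_mul]
  exact mul_le_of_le_one_right (abs_nonneg _) (Real.abs_sinc_le_one _)

theorem continuous_kernel (w : Fin 3 → ℝ) : Continuous (kernel w) := by
  unfold kernel
  refine continuous_finsetProd _ fun j _ => ?_
  exact continuous_const.mul (Real.continuous_sinc.comp (by fun_prop))

theorem tendsto_eval_atTop {ι : Type*} (j : ι) :
    Tendsto (fun n : ι → ℕ => n j) atTop atTop :=
  tendsto_atTop.2 fun b => (eventually_ge_atTop fun _ => b).mono fun _ h => h j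

/-- What the convergence of the drift requires of the disturbance and the sampling periods. -/
structure AdmissibleDrift (τbar : Fin 3 → ℝ) (τ : Fin 3 → ℕ → ℝ) (δ : (Fin 3 → ℝ) → ℝ) : Prop where
  horizon : ∀ j, Tendsto (fun n : ℕ => (n : ℝ) * τ j n) atTop (𝓝 (τbar j))
  continuous_ae : ∀ᵐ x ∂cubeMeasure 3,
    ContinuousWithinAt δ (samplingDomain τbar τ) (fun j => τbar j * x j)
  bounded : ∃ K, (∀ x ∈ Set.Icc 0 τbar, |δ x| ≤ K) ∧
    ∀ᶠ n : Fin 3 → ℕ in atTop, ∀ i, 1 ≤ i → i ≤ n → |δ (site τ n i)| ≤ K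

section driftConvergence

variable {w τbar : Fin 3 → ℝ} {τ : Fin 3 → ℕ → ℝ} {δ : (Fin 3 → ℝ) → ℝ}

/-- A bound for the distance of `τbar x` to the sampling site of the cell of `x`. -/
def siteError (τbar : Fin 3 → ℝ) (τ : Fin 3 → ℕ → ℝ) (n : Fin 3 → ℕ) : ℝ :=
  ∑ j, (|τ j (n j)| + |(n j : ℝ) * τ j (n j) - τbar j|)

theorem tendsto_siteError
    (h : ∀ j, Tendsto (fun n : ℕ => (n : ℝ) * τ j n) atTop (𝓝 (τbar j))) :
    Tendsto (siteError τbar τ) atTop (𝓝 0) := by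
  have h0 : ∀ j, Tendsto (fun n : ℕ => τ j n) atTop (𝓝 0) := by
    intro j
    have h1 := (h j).mul (tendsto_inv_atTop_zero.comp (tendsto_natCast_atTop_atTop (R := ℝ)))
    rw [mul_zero] at h1
    refine h1.congr' ?_
    filter_upwards [eventually_ge_atTop 1] with n hn
    have : (n : ℝ) ≠ 0 := Nat.cast_ne_zero.2 (by omega)
    simp only [Function.comp]
    field_simp
  have : Tendsto (siteError τbar τ) atTop (𝓝 (∑ j : Fin 3, (|(0 : ℝ)| + |τbar j - τbar j|))) := by
    refine tendsto_finsetSum _ fun j _ => ?_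
    exact (((h0 j).comp (tendsto_eval_atTop j)).abs).add
      (((h j).comp (tendsto_eval_atTop j)).sub_const _).abs
  simpa using this

theorem dist_site_cellIndex_le (n : Fin 3 → ℕ) {x : Fin 3 → ℝ} (hx : ∀ j, 0 < x j ∧ x j ≤ 1) :
    dist (site τ n (cellIndex n x)) (fun j => τbar j * x j) ≤ siteError τbar τ n := by
  have hnn : ∀ j, 0 ≤ |τ j (n j)| + |(n j : ℝ) * τ j (n j) - τbar j| := fun j => by positivity
  refine (dist_pi_le_iff (Finset.sum_nonneg fun j _ => hnn j)).2 fun j => ?_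
  refine le_trans ?_ (Finset.single_le_sum (fun j _ => hnn j) (Finset.mem_univ j))
  have h0 : 0 ≤ (n j : ℝ) * x j := mul_nonneg (Nat.cast_nonneg _) (hx j).1.le
  have h1 : ((⌈(n j : ℝ) * x j⌉₊ : ℝ) - n j * x j) ≤ 1 := by
    linarith [(Nat.ceil_lt_add_one h0).le]
  have h2 : 0 ≤ ((⌈(n j : ℝ) * x j⌉₊ : ℝ) - n j * x j) := by linarith [Nat.le_ceil ((n j : ℝ) * x j)]
  -- The first error comes from rounding up to a cell corner, the second from `n τ` not yet being
  -- equal to its limit.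
  have h3 : site τ n (cellIndex n x) j - τbar j * x j =
      ((⌈(n j : ℝ) * x j⌉₊ : ℝ) - n j * x j) * τ j (n j) +
        (n j * τ j (n j) - τbar j) * x j := by
    simp only [site, cellIndex]; ring
  rw [Real.dist_eq, h3]
  refine (abs_add_le _ _).trans (add_le_add ?_ ?_)
  · rw [abs_mul, abs_of_nonneg h2]
    exact mul_le_of_le_one_left (abs_nonneg _) h1
  · rw [abs_mul, abs_of_nonneg (hx j).1.le]
    exact mul_le_of_le_one_right (abs_nonneg _) (hx j).2

/-- The sites tend to `τbar x` within the sampling domain but possibly from outside the box, so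
continuity relative to this domain is what is needed. -/
theorem AdmissibleDrift.tendsto_ae (h : AdmissibleDrift τbar τ δ) :
    ∀ᵐ x ∂cubeMeasure 3, Tendsto (fun n : Fin 3 → ℕ => δ (site τ n (cellIndex n x))) atTop
      (𝓝 (δ fun j => τbar j * x j)) := by
  filter_upwards [h.continuous_ae, ae_cubeMeasure_pos 3] with x hc hx
  refine hc.tendsto.comp (tendsto_nhdsWithin_iff.2 ⟨?_, ?_⟩)
  · exact tendsto_iff_dist_tendsto_zero.2 (squeeze_zero (fun _ => dist_nonneg)
      (fun n => dist_site_cellIndex_le n hx) (tendsto_siteError h.horizon))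
  · filter_upwards [eventually_ge_atTop 1] with n hn
    have := Finset.mem_Icc.1 (cellIndex_mem hn hx)
    exact Or.inr ⟨n, cellIndex n x, this.1, this.2, rfl⟩

theorem measurable_comp_cellIndex (n : Fin 3 → ℕ) (F : (Fin 3 → ℕ) → ℝ) :
    Measurable fun x : Fin 3 → ℝ => F (cellIndex n x) :=
  (measurable_of_countable F).comp (measurable_cellIndex n)

/-- Measurability of the disturbance comes for free: it is an almost everywhere limit of step
functions. -/
theorem AdmissibleDrift.aestronglyMeasurable (h : AdmissibleDrift τbar τ δ) :
    AEStronglyMeasurable (fun x => δ fun j => τbar j * x j) (cubeMeasure 3) :=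
  aestronglyMeasurable_of_tendsto_ae (u := (atTop : Filter (Fin 3 → ℕ)))
    (f := fun n x => δ (site τ n (cellIndex n x))) (fun n =>
    (measurable_comp_cellIndex n fun i => δ (site τ n i)).aestronglyMeasurable) h.tendsto_ae

theorem scale_mem (hτbar : ∀ j, 0 < τbar j) {x : Fin 3 → ℝ} (hx : x ∈ Set.Icc (0 : Fin 3 → ℝ) 1) :
    (fun j => τbar j * x j) ∈ Set.Icc 0 τbar :=
  ⟨fun j => mul_nonneg (hτbar j).le (hx.1 j), fun j => mul_le_of_le_one_right (hτbar j).le (hx.2 j)⟩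

theorem AdmissibleDrift.tendsto_integral_abs_sub (hτbar : ∀ j, 0 < τbar j)
    (h : AdmissibleDrift τbar τ δ) :
    Tendsto (fun n : Fin 3 → ℕ => ∫ x, |δ (site τ n (cellIndex n x)) - δ fun j => τbar j * x j|
      ∂cubeMeasure 3) atTop (𝓝 0) := by
  obtain ⟨K, hK, hKn⟩ := h.bounded
  have := tendsto_integral_filter_of_dominated_convergence (μ := cubeMeasure 3)
    (l := (atTop : Filter (Fin 3 → ℕ)))
    (F := fun n x => |δ (site τ n (cellIndex n x)) - δ fun j => τbar j * x j|) (f := fun _ => 0)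
    (fun _ => K + K) ?_ ?_ (integrable_const _) ?_
  · simpa using this
  · exact Eventually.of_forall fun n => ((measurable_comp_cellIndex n fun i =>
      δ (site τ n i)).aestronglyMeasurable.sub h.aestronglyMeasurable).norm
  · filter_upwards [hKn, eventually_ge_atTop 1] with n hn hn1
    filter_upwards [ae_cubeMeasure_pos 3, ae_cubeMeasure_mem 3] with x hx hx'
    have hm := Finset.mem_Icc.1 (cellIndex_mem hn1 hx)
    rw [Real.norm_eq_abs, abs_abs]
    exact (abs_sub _ _).trans (add_le_add (hn _ hm.1 hm.2) (hK _ (scale_mem hτbar hx')))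
  · filter_upwards [h.tendsto_ae] with x hx
    have := (hx.sub_const (δ fun j => τbar j * x j)).abs
    simpa using this

/-- The normalised Riemann sum approximating the drift integral. -/
def driftSum (w : Fin 3 → ℝ) (τ : Fin 3 → ℕ → ℝ) (δ : (Fin 3 → ℝ) → ℝ) (n : Fin 3 → ℕ) (s : ℝ)
    (r : Fin 3 → ℝ) : ℝ :=
  ∫ x, (if cellIndex n x 0 ≤ ⌊(n 0 : ℝ) * s⌋₊ then kernel w (r - site τ n (cellIndex n x)) *
    δ (site τ n (cellIndex n x)) else 0) ∂cubeMeasure 3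

/-- The drift integral on the unit cube. -/
def driftIntegral (w τbar : Fin 3 → ℝ) (δ : (Fin 3 → ℝ) → ℝ) (s : ℝ) (r : Fin 3 → ℝ) : ℝ :=
  ∫ x, (if x 0 ≤ s then kernel w (r - fun j => τbar j * x j) * δ (fun j => τbar j * x j) else 0)
    ∂cubeMeasure 3

theorem integral_cube_ite_Ioc_le {a b : ℝ} (hab : a ≤ b) :
    ∫ x, (if a < x 0 ∧ x 0 ≤ b then (1 : ℝ) else 0) ∂cubeMeasure 3 ≤ b - a := by
  have h1 : ∀ x : Fin 3 → ℝ, (if a < x 0 ∧ x 0 ≤ b then (1 : ℝ) else 0) =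
      ∏ j, (fun (j : Fin 3) (t : ℝ) => if j = 0 then (Set.Ioc a b).indicator (fun _ => 1) t else 1)
        j (x j) := by
    intro x
    rw [Fin.prod_univ_three]
    by_cases h : a < x 0 ∧ x 0 ≤ b <;> simp [Set.indicator, h]
  rw [integral_congr_ae (Eventually.of_forall h1), integral_cubeMeasure_prod
    (fun (j : Fin 3) (t : ℝ) => if j = 0 then (Set.Ioc a b).indicator (fun _ => 1) t else 1),
    Fin.prod_univ_three]
  simp only [if_true, Fin.reduceEq, if_false]
  rw [setIntegral_indicator measurableSet_Ioc]
  simp only [setIntegral_const, smul_eq_mul, mul_one, Real.volume_real_Icc, sub_zero, max_eq_left,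
    zero_le_one]
  refine (measureReal_mono Set.inter_subset_right (by simp)).trans ?_
  rw [Real.volume_real_Ioc_of_le hab]

theorem exists_kernel_close (w τbar : Fin 3 → ℝ) {ε : ℝ} (hε : 0 < ε) :
    ∃ η > 0, ∀ r ∈ Set.Icc 0 τbar, ∀ y ∈ Set.Icc 0 τbar, ∀ z, dist z y < η →
      |kernel w (r - z) - kernel w (r - y)| < ε := by
  obtain ⟨η, hη, h⟩ := Metric.uniformContinuousOn_iff.1
    ((isCompact_closedBall (0 : Fin 3 → ℝ) (‖τbar‖ + (‖τbar‖ + 1))).uniformContinuousOn_of_continuous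
      (continuous_kernel w).continuousOn) ε hε
  have hbd : ∀ y ∈ Set.Icc 0 τbar, ‖y‖ ≤ ‖τbar‖ := fun y hy =>
    (pi_norm_le_iff_of_nonneg (norm_nonneg _)).2 fun j => by
      rw [Real.norm_eq_abs, abs_of_nonneg (hy.1 j)]
      exact (hy.2 j).trans ((le_abs_self _).trans (norm_le_pi_norm τbar j))
  -- Sites can leave the box; the cap `1` keeps them in the compact ball chosen above.
  refine ⟨min η 1, lt_min hη one_pos, fun r hr y hy z hzy => ?_⟩
  have hz : ‖z‖ ≤ ‖τbar‖ + 1 := by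
    have h1 := norm_le_norm_add_norm_sub y z
    rw [← dist_eq_norm, dist_comm] at h1
    linarith [hbd y hy, hzy.trans_le (min_le_right η 1)]
  rw [← Real.dist_eq]
  refine h _ ?_ _ ?_ ?_
  · rw [mem_closedBall_zero_iff]
    exact (norm_sub_le _ _).trans (add_le_add (hbd r hr) hz)
  · rw [mem_closedBall_zero_iff]
    exact (norm_sub_le _ _).trans (add_le_add (hbd r hr) (by linarith [hbd y hy]))
  · rw [dist_sub_left]
    exact hzy.trans_le (min_le_left _ _)

theorem AdmissibleDrift.integrable_driftIntegral (hτbar : ∀ j, 0 < τbar j)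
    (h : AdmissibleDrift τbar τ δ) (s : ℝ) (r : Fin 3 → ℝ) :
    Integrable (fun x => if x 0 ≤ s then kernel w (r - fun j => τbar j * x j) *
      δ (fun j => τbar j * x j) else 0) (cubeMeasure 3) := by
  obtain ⟨K, hK, -⟩ := h.bounded
  have hs : MeasurableSet {x : Fin 3 → ℝ | x 0 ≤ s} :=
    measurableSet_le (measurable_pi_apply 0) measurable_const
  have hm : AEStronglyMeasurable (fun x => kernel w (r - fun j => τbar j * x j) *
      δ (fun j => τbar j * x j)) (cubeMeasure 3) :=
    ((continuous_kernel w).comp (by fun_prop)).aestronglyMeasurable.mul h.aestronglyMeasurable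
  refine Integrable.of_bound ((hm.indicator hs).congr (Eventually.of_forall fun x => ?_))
    ((∏ j, |w j / Real.pi|) * K) ?_
  · simp [Set.indicator]
  · filter_upwards [ae_cubeMeasure_mem 3] with x hx
    have hd := hK _ (scale_mem hτbar hx)
    have hb : |kernel w (r - fun j => τbar j * x j) * δ (fun j => τbar j * x j)| ≤
        (∏ j, |w j / Real.pi|) * K := by
      rw [abs_mul]
      exact mul_le_mul (abs_kernel_le _ _) hd (abs_nonneg _)
        (Finset.prod_nonneg fun _ _ => abs_nonneg _)
    split_ifs
    · exact hb
    · rw [norm_zero]; exact (abs_nonneg _).trans hb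

theorem AdmissibleDrift.abs_driftIntegral_le (hτbar : ∀ j, 0 < τbar j)
    {K : ℝ} (hK : ∀ x ∈ Set.Icc 0 τbar, |δ x| ≤ K) (s : ℝ) (r : Fin 3 → ℝ) :
    |driftIntegral w τbar δ s r| ≤ (∏ j, |w j / Real.pi|) * K := by
  unfold driftIntegral
  rw [← Real.norm_eq_abs]
  refine (norm_integral_le_of_norm_le_const (C := (∏ j, |w j / Real.pi|) * K) ?_).trans (by simp)
  filter_upwards [ae_cubeMeasure_mem 3] with x hx
  have hd := hK _ (scale_mem hτbar hx)
  have hb : |kernel w (r - fun j => τbar j * x j) * δ (fun j => τbar j * x j)| ≤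
      (∏ j, |w j / Real.pi|) * K := by
    rw [abs_mul]
    exact mul_le_mul (abs_kernel_le _ _) hd (abs_nonneg _)
      (Finset.prod_nonneg fun _ _ => abs_nonneg _)
  split_ifs
  · exact hb
  · rw [norm_zero]; exact (abs_nonneg _).trans hb

/-- The integrands differ for three reasons: the kernel is evaluated at the site, the disturbance is
evaluated at the site, and the time cutoff is rounded. Uniform continuity of the kernel, `L¹`
convergence of the disturbance and the thinness of a slab control these, each independently of `s`
and `r`. -/
theorem AdmissibleDrift.driftSum_close (hτbar : ∀ j, 0 < τbar j) (h : AdmissibleDrift τbar τ δ)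
    {ε : ℝ} (hε : 0 < ε) :
    ∀ᶠ n : Fin 3 → ℕ in atTop, ∀ s ∈ Set.Icc (0 : ℝ) 1, ∀ r ∈ Set.Icc 0 τbar,
      |driftSum w τ δ n s r - driftIntegral w τbar δ s r| ≤ ε := by
  obtain ⟨K, hK, hKn⟩ := h.bounded
  have hK0 : 0 ≤ K := (abs_nonneg _).trans (hK 0 ⟨le_rfl, fun j => (hτbar j).le⟩)
  set M : ℝ := ∏ j, |w j / Real.pi| with hMdef
  have hM0 : 0 ≤ M := Finset.prod_nonneg fun _ _ => abs_nonneg _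
  have hMk : ∀ x, |kernel w x| ≤ M := abs_kernel_le w
  obtain ⟨η, hη, hclose⟩ := exists_kernel_close w τbar (ε := ε / (3 * (K + 1))) (by positivity)
  have e1 : ∀ᶠ n : Fin 3 → ℕ in atTop, siteError τbar τ n < η :=
    (tendsto_siteError h.horizon).eventually (gt_mem_nhds hη)
  have e2 : ∀ᶠ n : Fin 3 → ℕ in atTop, M * K * ((n 0 : ℝ))⁻¹ < ε / 3 := by
    have : Tendsto (fun n : Fin 3 → ℕ => M * K * ((n 0 : ℝ))⁻¹) atTop (𝓝 (M * K * 0)) :=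
      (tendsto_inv_atTop_zero.comp ((tendsto_natCast_atTop_atTop (R := ℝ)).comp
        (tendsto_eval_atTop 0))).const_mul _
    rw [mul_zero] at this
    exact this.eventually (gt_mem_nhds (by positivity))
  have e3 : ∀ᶠ n : Fin 3 → ℕ in atTop, M * ∫ x, |δ (site τ n (cellIndex n x)) -
      δ fun j => τbar j * x j| ∂cubeMeasure 3 < ε / 3 := by
    have := (h.tendsto_integral_abs_sub hτbar).const_mul M
    rw [mul_zero] at this
    exact this.eventually (gt_mem_nhds (by positivity))
  filter_upwards [hKn, e1, e2, e3, eventually_ge_atTop 1] with n hn he1 he2 he3 hn1 s hs r hr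
  have hn0 : (0 : ℝ) < n 0 := Nat.cast_pos.2 (hn1 0)
  set An : (Fin 3 → ℝ) → ℝ := fun x => δ (site τ n (cellIndex n x)) with hAn
  set A : (Fin 3 → ℝ) → ℝ := fun x => δ fun j => τbar j * x j with hA
  have hAnm : Measurable An := measurable_comp_cellIndex n fun i => δ (site τ n i)
  have hAnb : ∀ᵐ x ∂cubeMeasure 3, |An x| ≤ K := by
    filter_upwards [ae_cubeMeasure_pos 3] with x hx
    have hm := Finset.mem_Icc.1 (cellIndex_mem hn1 hx)
    exact hn _ hm.1 hm.2
  have hAb : ∀ᵐ x ∂cubeMeasure 3, |A x| ≤ K := by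
    filter_upwards [ae_cubeMeasure_mem 3] with x hx
    exact hK _ (scale_mem hτbar hx)
  have hint1 : Integrable (fun x => if cellIndex n x 0 ≤ ⌊(n 0 : ℝ) * s⌋₊ then
      kernel w (r - site τ n (cellIndex n x)) * δ (site τ n (cellIndex n x)) else 0)
      (cubeMeasure 3) := by
    refine Integrable.of_bound (measurable_comp_cellIndex n fun i => if i 0 ≤ ⌊(n 0 : ℝ) * s⌋₊ then
      kernel w (r - site τ n i) * δ (site τ n i) else 0).aestronglyMeasurable (M * K) ?_
    filter_upwards [hAnb] with x hx
    split_ifs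
    · rw [Real.norm_eq_abs, abs_mul]
      exact mul_le_mul (hMk _) hx (abs_nonneg _) hM0
    · rw [norm_zero]; positivity
  have hintA : Integrable (fun x => |An x - A x|) (cubeMeasure 3) := by
    refine (Integrable.of_bound (hAnm.aestronglyMeasurable.sub h.aestronglyMeasurable) (K + K) ?_).abs
    filter_upwards [hAnb, hAb] with x h1 h2
    exact (abs_sub _ _).trans (add_le_add h1 h2)
  have hintI : Integrable (fun x : Fin 3 → ℝ =>
      if s - (n 0 : ℝ)⁻¹ < x 0 ∧ x 0 ≤ s then (1 : ℝ) else 0) (cubeMeasure 3) := by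
    refine Integrable.of_bound (C := 1) (Measurable.aestronglyMeasurable ?_)
      (Eventually.of_forall fun t => by split_ifs <;> simp)
    refine Measurable.ite ?_ measurable_const measurable_const
    exact (measurable_pi_apply (0 : Fin 3)) measurableSet_Ioc
  unfold driftSum driftIntegral
  rw [← integral_sub hint1 (h.integrable_driftIntegral hτbar s r), ← Real.norm_eq_abs]
  -- The dominating function lists the three errors: slab of width `1 / n 0`, kernel, disturbance.
  refine (norm_integral_le_of_norm_le (g := fun x => M * K *
    (if s - (n 0 : ℝ)⁻¹ < x 0 ∧ x 0 ≤ s then (1 : ℝ) else 0) + (ε / 3 + M * |An x - A x|))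
    ((hintI.const_mul _).add ((integrable_const _).add (hintA.const_mul _))) ?_).trans ?_
  · filter_upwards [ae_cubeMeasure_pos 3, ae_cubeMeasure_mem 3, hAnb, hAb] with x hx hx' h1 h2
    have hk := (hclose r hr _ (scale_mem hτbar hx') _
      ((dist_site_cellIndex_le (τ := τ) (τbar := τbar) n hx).trans_lt he1)).le
    set kn := kernel w (r - site τ n (cellIndex n x))
    set k := kernel w (r - fun j => τbar j * x j)
    have hkb : |k| ≤ M := hMk _
    have hite : (0 : ℝ) ≤ M * K *
        (if s - (n 0 : ℝ)⁻¹ < x 0 ∧ x 0 ≤ s then (1 : ℝ) else 0) := by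
      split_ifs <;> simp; positivity
    have hrest : 0 ≤ ε / 3 + M * |An x - A x| := by positivity
    rw [Real.norm_eq_abs]
    -- A cell lies below its index, so the rounded cutoff implies the exact one. The converse fails
    -- only for `x 0` in the slab `(s - 1 / n 0, s]`.
    by_cases hc : cellIndex n x 0 ≤ ⌊(n 0 : ℝ) * s⌋₊
    · have hxs : x 0 ≤ s := by
        have h3 : (n 0 : ℝ) * x 0 ≤ n 0 * s := by
          refine (Nat.le_ceil _).trans ?_
          exact (Nat.cast_le.2 hc).trans (Nat.floor_le (mul_nonneg hn0.le hs.1))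
        exact le_of_mul_le_mul_left h3 hn0
      rw [if_pos hc, if_pos hxs]
      have h3 : kn * An x - k * A x = (kn - k) * An x + k * (An x - A x) := by ring
      have h4 : |(kn - k) * An x + k * (An x - A x)| ≤ ε / (3 * (K + 1)) * K + M * |An x - A x| := by
        refine (abs_add_le _ _).trans ?_
        rw [abs_mul, abs_mul]
        exact add_le_add (mul_le_mul hk h1 (abs_nonneg _) (by positivity))
          (mul_le_mul_of_nonneg_right hkb (abs_nonneg _))
      have h5 : ε / (3 * (K + 1)) * K ≤ ε / 3 := by
        rw [div_mul_eq_mul_div, div_le_div_iff₀ (by positivity) (by positivity)]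
        nlinarith
      show |kn * An x - k * A x| ≤ _
      rw [h3]
      linarith
    · rw [if_neg hc, zero_sub, abs_neg]
      by_cases hxs : x 0 ≤ s
      · have h3 : s - (n 0 : ℝ)⁻¹ < x 0 := by
          have h4 : (n 0 : ℝ) * s < cellIndex n x 0 := (Nat.floor_lt (mul_nonneg hn0.le hs.1)).1
            (not_le.1 hc)
          have h5 : (cellIndex n x 0 : ℝ) < n 0 * x 0 + 1 :=
            Nat.ceil_lt_add_one (mul_nonneg hn0.le (hx 0).1.le)
          have h6 : (n 0 : ℝ) * (s - (n 0 : ℝ)⁻¹) < n 0 * x 0 := by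
            rw [mul_sub, mul_inv_cancel₀ hn0.ne']
            linarith
          exact lt_of_mul_lt_mul_left h6 hn0.le
        rw [if_pos hxs, if_pos ⟨h3, hxs⟩, mul_one, abs_mul]
        have := mul_le_mul hkb h2 (abs_nonneg _) hM0
        linarith
      · rw [if_neg hxs, abs_zero]
        linarith
  · have hsum : Integrable (fun x => ε / 3 + M * |An x - A x|) (cubeMeasure 3) :=
      (integrable_const _).add (hintA.const_mul _)
    rw [integral_add (hintI.const_mul _) hsum,
      integral_add (integrable_const _) (hintA.const_mul _), integral_const_mul, integral_const_mul]
    have h1 := integral_cube_ite_Ioc_le (a := s - (n 0 : ℝ)⁻¹) (b := s)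
      (sub_le_self _ (inv_nonneg.2 hn0.le))
    rw [sub_sub_cancel] at h1
    have h2 := mul_le_mul_of_nonneg_left h1 (mul_nonneg hM0 hK0)
    simp only [integral_const, probReal_univ, smul_eq_mul, one_mul]
    linarith

theorem AdmissibleDrift.continuous_driftIntegral (hτbar : ∀ j, 0 < τbar j)
    (h : AdmissibleDrift τbar τ δ) :
    Continuous fun p : ℝ × (Fin 3 → ℝ) => driftIntegral w τbar δ p.1 p.2 := by
  obtain ⟨K, hK, -⟩ := h.bounded
  have hK0 : 0 ≤ K := (abs_nonneg _).trans (hK 0 ⟨le_rfl, fun j => (hτbar j).le⟩)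
  have hM0 : 0 ≤ ∏ j, |w j / Real.pi| := Finset.prod_nonneg fun _ _ => abs_nonneg _
  refine continuous_iff_continuousAt.2 fun p₀ => ?_
  refine continuousAt_of_dominated (bound := fun _ => (∏ j, |w j / Real.pi|) * K) ?_ ?_
    (integrable_const _) ?_
  · exact Eventually.of_forall fun p =>
      (h.integrable_driftIntegral hτbar p.1 p.2).aestronglyMeasurable
  · refine Eventually.of_forall fun p => ?_
    filter_upwards [ae_cubeMeasure_mem 3] with x hx
    split_ifs
    · rw [Real.norm_eq_abs, abs_mul]
      exact mul_le_mul (abs_kernel_le _ _) (hK _ (scale_mem hτbar hx)) (abs_nonneg _) hM0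
    · rw [norm_zero]; positivity
  · filter_upwards [ae_cubeMeasure_ne (fun _ : Fin 3 => p₀.1)] with x hx
    rcases lt_or_gt_of_ne (hx 0) with hlt | hgt
    · have hc : ContinuousAt (fun p : ℝ × (Fin 3 → ℝ) =>
          kernel w (p.2 - fun j => τbar j * x j) * δ (fun j => τbar j * x j)) p₀ :=
        (((continuous_kernel w).comp (by fun_prop)).mul continuous_const).continuousAt
      refine hc.congr ?_
      filter_upwards [continuousAt_fst.eventually (lt_mem_nhds hlt)] with p hp
      rw [if_pos hp.le]
    · refine (continuousAt_const (y := (0 : ℝ))).congr ?_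
      filter_upwards [continuousAt_fst.eventually (gt_mem_nhds hgt)] with p hp
      rw [if_neg (not_le.2 hp)]

/-- The Jacobian of the scaling is `∏ j, τbar j`; together with the inverse square root it leaves
the square root, which is also the factor of the noise part. -/
theorem drift_eq (hτbar : ∀ j, 0 < τbar j) {s : ℝ} (hs : s ≤ 1) (r : Fin 3 → ℝ) :
    drift w τbar δ s r = √(∏ j, τbar j) * driftIntegral w τbar δ s r := by
  have hP : 0 < ∏ j, τbar j := Finset.prod_pos fun j _ => hτbar j
  have hB : Function.update τbar 0 (s * τbar 0) ≤ τbar := by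
    rw [update_le_iff]
    exact ⟨mul_le_of_le_one_left (hτbar 0).le hs, fun _ _ => le_rfl⟩
  unfold drift driftIntegral
  rw [setIntegral_eq_cubeMeasure hτbar hB, ← mul_assoc]
  congr 1
  · rw [inv_mul_eq_div, Real.div_sqrt]
  · refine integral_congr_ae ?_
    filter_upwards [ae_cubeMeasure_mem 3] with x hx
    have hiff : (fun j => τbar j * x j) ∈ Set.Icc 0 (Function.update τbar 0 (s * τbar 0)) ↔
        x 0 ≤ s := by
      constructor
      · intro hm
        have := hm.2 0
        simp only [Function.update_self] at this
        rw [mul_comm s] at this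
        exact le_of_mul_le_mul_left this (hτbar 0)
      · intro hxs
        refine ⟨(scale_mem hτbar hx).1, ?_⟩
        rw [le_update_iff]
        refine ⟨?_, fun j _ => (scale_mem hτbar hx).2 j⟩
        rw [mul_comm s]
        exact mul_le_mul_of_nonneg_left hxs (hτbar 0).le
    by_cases h : x 0 ≤ s
    · rw [if_pos h, Set.indicator_of_mem (hiff.2 h)]
    · rw [if_neg h, Set.indicator_of_notMem (fun hm => h (hiff.1 hm))]

theorem AdmissibleDrift.integrableOn (hτbar : ∀ j, 0 < τbar j) (h : AdmissibleDrift τbar τ δ)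
    {s : ℝ} (hs : s ≤ 1) (r : Fin 3 → ℝ) :
    IntegrableOn (fun z => kernel w (r - z) * δ z)
      (Set.Icc 0 (Function.update τbar 0 (s * τbar 0))) := by
  obtain ⟨K, hK, -⟩ := h.bounded
  have hB : Function.update τbar 0 (s * τbar 0) ≤ τbar := by
    rw [update_le_iff]
    exact ⟨mul_le_of_le_one_left (hτbar 0).le hs, fun _ _ => le_rfl⟩
  refine IntegrableOn.mono_set (t := Set.Icc 0 τbar) ?_ (Set.Icc_subset_Icc_right hB)
  have hm : AEStronglyMeasurable (fun z => kernel w (r - z) * δ z)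
      (volume.restrict (Set.Icc 0 τbar)) :=
    ((continuous_kernel w).comp (by fun_prop)).aestronglyMeasurable.mul
      (aestronglyMeasurable_of_comp_scale hτbar h.aestronglyMeasurable)
  refine IntegrableOn.of_bound (isCompact_Icc.measure_lt_top) hm ((∏ j, |w j / Real.pi|) * K) ?_
  filter_upwards [ae_restrict_mem measurableSet_Icc] with z hz
  rw [Real.norm_eq_abs, abs_mul]
  exact mul_le_mul (abs_kernel_le _ _) (hK z hz) (abs_nonneg _)
    (Finset.prod_nonneg fun _ _ => abs_nonneg _)

theorem Icc_update_floor (n : Fin 3 → ℕ) {s : ℝ} (hs : s ≤ 1) :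
    Finset.Icc (1 : Fin 3 → ℕ) (Function.update n 0 ⌊(n 0 : ℝ) * s⌋₊) =
      (Finset.Icc (1 : Fin 3 → ℕ) n).filter (fun i => i 0 ≤ ⌊(n 0 : ℝ) * s⌋₊) := by
  have hle : ⌊(n 0 : ℝ) * s⌋₊ ≤ n 0 :=
    Nat.floor_le_of_le (mul_le_of_le_one_right (Nat.cast_nonneg _) hs)
  ext i
  simp only [Finset.mem_filter, Finset.mem_Icc, le_update_iff]
  constructor
  · rintro ⟨h1, h2, h3⟩
    refine ⟨⟨h1, fun j => ?_⟩, h2⟩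
    by_cases hj : j = 0
    · subst hj; exact h2.trans hle
    · exact h3 j hj
  · rintro ⟨⟨h1, h2⟩, h3⟩
    exact ⟨h1, h3, fun j _ => h2 j⟩

/-- The rate `∏ j, n j ^ (1 / 2)` is what turns the sum into an average: `√(∏ τ) / √(∏ n)` equals
`√(∏ n τ) / ∏ n`. -/
theorem sum_drift_eq {n : Fin 3 → ℕ} (hn : 1 ≤ n) (hτ : ∀ j n, 1 ≤ n → 0 < τ j n) {s : ℝ}
    (hs : s ≤ 1) (r : Fin 3 → ℝ) :
    √(∏ j, τ j (n j)) * ∑ i ∈ Finset.Icc (1 : Fin 3 → ℕ) (Function.update n 0 ⌊(n 0 : ℝ) * s⌋₊),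
      δ (site τ n i) / (∏ j, (n j : ℝ) ^ (1 / 2 : ℝ)) * kernel w (r - site τ n i) =
    √(∏ j, (n j : ℝ) * τ j (n j)) * driftSum w τ δ n s r := by
  have hn0 : ∀ j, (0 : ℝ) < n j := fun j => Nat.cast_pos.2 (hn j)
  have hP : 0 < ∏ j, (n j : ℝ) := Finset.prod_pos fun j _ => hn0 j
  have hτP : 0 ≤ ∏ j, τ j (n j) := Finset.prod_nonneg fun j _ => (hτ j _ (hn j)).le
  have hroot : ∏ j, (n j : ℝ) ^ (1 / 2 : ℝ) = √(∏ j, (n j : ℝ)) := by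
    rw [Real.sqrt_eq_rpow, Real.finsetProd_rpow _ _ fun j _ => (hn0 j).le]
  unfold driftSum
  rw [integral_cellIndex hn (fun i => if i 0 ≤ ⌊(n 0 : ℝ) * s⌋₊ then
      kernel w (r - site τ n i) * δ (site τ n i) else 0), ← Finset.sum_filter,
    Finset.prod_mul_distrib, Real.sqrt_mul hP.le, hroot]
  rw [← Icc_update_floor n hs]
  have hsq : √(∏ j, (n j : ℝ)) * (∏ j, (n j : ℝ))⁻¹ = (√(∏ j, (n j : ℝ)))⁻¹ := by
    have h1 : √(∏ j, (n j : ℝ)) ≠ 0 := (Real.sqrt_pos.2 hP).ne'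
    rw [← div_eq_mul_inv, div_eq_iff hP.ne', eq_comm, inv_mul_eq_div, Real.div_sqrt]
  calc _ = √(∏ j, τ j (n j)) * ((√(∏ j, (n j : ℝ)))⁻¹ *
        ∑ i ∈ Finset.Icc (1 : Fin 3 → ℕ) (Function.update n 0 ⌊(n 0 : ℝ) * s⌋₊),
          kernel w (r - site τ n i) * δ (site τ n i)) := by
        congr 1
        rw [Finset.mul_sum]
        refine Finset.sum_congr rfl fun i _ => ?_
        ring
    _ = _ := by rw [← hsq]; ring

theorem AdmissibleDrift.tendsto_prod_horizon (h : AdmissibleDrift τbar τ δ) :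
    Tendsto (fun n : Fin 3 → ℕ => √(∏ j, (n j : ℝ) * τ j (n j))) atTop (𝓝 √(∏ j, τbar j)) :=
  (Real.continuous_sqrt.tendsto _).comp
    (tendsto_finsetProd _ fun j _ => (h.horizon j).comp (tendsto_eval_atTop j))

/-- The drift of the detection process converges uniformly. -/
theorem AdmissibleDrift.drift_close (hτbar : ∀ j, 0 < τbar j) (h : AdmissibleDrift τbar τ δ)
    {ε : ℝ} (hε : 0 < ε) :
    ∀ᶠ n : Fin 3 → ℕ in atTop, ∀ s ∈ Set.Icc (0 : ℝ) 1, ∀ r ∈ Set.Icc 0 τbar,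
      |√(∏ j, (n j : ℝ) * τ j (n j)) * driftSum w τ δ n s r -
        √(∏ j, τbar j) * driftIntegral w τbar δ s r| ≤ ε := by
  obtain ⟨K, hK, -⟩ := h.bounded
  set C : ℝ := (∏ j, |w j / Real.pi|) * K with hC
  have hC0 : 0 ≤ C := mul_nonneg (Finset.prod_nonneg fun _ _ => abs_nonneg _)
    ((abs_nonneg _).trans (hK 0 ⟨le_rfl, fun j => (hτbar j).le⟩))
  set L := √(∏ j, τbar j)
  have hL : 0 ≤ L := Real.sqrt_nonneg _
  have e1 : ∀ᶠ n : Fin 3 → ℕ in atTop,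
      dist (√(∏ j, (n j : ℝ) * τ j (n j))) L < min 1 (ε / (2 * (C + 1))) :=
    h.tendsto_prod_horizon.eventually (Metric.ball_mem_nhds _ (by positivity))
  filter_upwards [e1, h.driftSum_close (w := w) hτbar (ε := ε / (2 * (L + 1))) (by positivity)]
    with n hn hn' s hs r hr
  have h1 := hn' s hs r hr
  have h2 := AdmissibleDrift.abs_driftIntegral_le (w := w) hτbar hK s r
  set Ln := √(∏ j, (n j : ℝ) * τ j (n j))
  set D := driftSum w τ δ n s r
  set I := driftIntegral w τbar δ s r
  rw [Real.dist_eq] at hn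
  have h3 : Ln ≤ L + 1 := by linarith [le_abs_self (Ln - L), hn.trans_le (min_le_left _ _)]
  have h4 : |Ln - L| ≤ ε / (2 * (C + 1)) := (hn.trans_le (min_le_right _ _)).le
  have h5 : Ln * D - L * I = Ln * (D - I) + (Ln - L) * I := by ring
  rw [h5]
  refine (abs_add_le _ _).trans ?_
  rw [abs_mul, abs_mul, abs_of_nonneg (Real.sqrt_nonneg _)]
  have h6 : Ln * |D - I| ≤ (L + 1) * (ε / (2 * (L + 1))) :=
    mul_le_mul h3 h1 (abs_nonneg _) (by positivity)
  have h7 : |Ln - L| * |I| ≤ ε / (2 * (C + 1)) * (C + 1) :=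
    mul_le_mul h4 (by linarith) (abs_nonneg _) (by positivity)
  have h8 : (L + 1) * (ε / (2 * (L + 1))) = ε / 2 := by field_simp
  have h9 : ε / (2 * (C + 1)) * (C + 1) = ε / 2 := by field_simp
  linarith

end driftConvergence

/-! ### The two conditions on the disturbance -/

section conditions

variable {τbar : Fin 3 → ℝ} {τ : Fin 3 → ℕ → ℝ} {δ : (Fin 3 → ℝ) → ℝ}

/-- Compactness bounds the disturbance on the box only. For sites outside, relative continuity gives
the bound `K + 1` on a neighbourhood of the box, and all sites are eventually inside it since `n τ`
tends to `τbar`. -/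
theorem admissibleDrift_of_continuousOn (hτbar : ∀ j, 0 < τbar j) (hτ : ∀ j n, 1 ≤ n → 0 < τ j n)
    (hδ : ContinuousOn δ (samplingDomain τbar τ))
    (hT : ∀ j, Tendsto (fun n : ℕ => (n : ℝ) * τ j n) atTop (𝓝 (τbar j))) :
    AdmissibleDrift τbar τ δ := by
  have hsub : Set.Icc 0 τbar ⊆ samplingDomain τbar τ := Set.subset_union_left
  refine ⟨hT, ?_, ?_⟩
  · filter_upwards [ae_cubeMeasure_mem 3] with x hx
    exact hδ _ (hsub (scale_mem hτbar hx))
  · obtain ⟨K, hK⟩ := (isCompact_Icc (a := (0 : Fin 3 → ℝ)) (b := τbar)).exists_bound_of_continuousOn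
      (hδ.mono hsub)
    refine ⟨K + 1, fun x hx => (hK x hx).trans (by linarith), ?_⟩
    obtain ⟨U, hU, hUeq⟩ := continuousOn_iff'.1 hδ.norm (Set.Iio (K + 1)) isOpen_Iio
    have hIU : Set.Icc 0 τbar ⊆ U := by
      intro x hx
      have : x ∈ (fun x => ‖δ x‖) ⁻¹' Set.Iio (K + 1) ∩ samplingDomain τbar τ :=
        ⟨lt_of_le_of_lt (hK x hx) (by linarith), hsub hx⟩
      rw [hUeq] at this
      exact this.1
    obtain ⟨η, hη, hthick⟩ := isCompact_Icc.exists_thickening_subset_open hU hIU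
    have hev : ∀ᶠ n : Fin 3 → ℕ in atTop, ∀ j, |(n j : ℝ) * τ j (n j) - τbar j| < η := by
      refine eventually_all.2 fun j => ?_
      have := ((hT j).comp (tendsto_eval_atTop j)).eventually (Metric.ball_mem_nhds _ hη)
      simpa only [Function.comp, Metric.mem_ball, Real.dist_eq] using this
    filter_upwards [hev] with n hn i hi hin
    have hpos : ∀ j, 0 < τ j (n j) := fun j => hτ j _ ((hi j).trans (hin j))
    have hmem : site τ n i ∈ U := by
      -- The witness in the box is the site truncated at `τbar`; no coordinate overshoots by more
      -- than `|n τ - τbar|`.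
      refine hthick (Metric.mem_thickening_iff.2
        ⟨fun j => min (site τ n i j) (τbar j), ⟨fun j => ?_, fun j => min_le_right _ _⟩, ?_⟩)
      · exact le_min (mul_nonneg (Nat.cast_nonneg _) (hpos j).le) (hτbar j).le
      · refine (dist_pi_lt_iff hη).2 fun j => ?_
        rw [Real.dist_eq]
        rcases le_total (site τ n i j) (τbar j) with h | h
        · rw [min_eq_left h]; simpa using hη
        · rw [min_eq_right h, abs_of_nonneg (sub_nonneg.2 h)]
          have h1 : site τ n i j ≤ n j * τ j (n j) :=
            mul_le_mul_of_nonneg_right (Nat.cast_le.2 (hin j)) (hpos j).le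
          linarith [le_abs_self ((n j : ℝ) * τ j (n j) - τbar j), hn j]
    have : site τ n i ∈ U ∩ samplingDomain τbar τ := ⟨hmem, Or.inr ⟨n, i, hi, hin, rfl⟩⟩
    rw [← hUeq] at this
    exact le_of_lt this.1

theorem ae_mul_notMem_of_countable {c : ℝ} (hc : c ≠ 0) {C : Set ℝ} (hC : C.Countable) :
    ∀ᵐ t : ℝ, c * t ∉ C := by
  have h1 : ((fun t => c * t) ⁻¹' C).Countable := hC.preimage (mul_right_injective₀ hc)
  filter_upwards [h1.ae_notMem volume] with t ht using ht

/-- All sites lie in the box because `n τ = τbar`. Increments of the disturbance are dominated by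
those of monotone functions of single coordinates, so its discontinuities lie on countably many
hyperplanes, a null set, and it is bounded. -/
theorem admissibleDrift_of_hardyKrause (hτbar : ∀ j, 0 < τbar j)
    (hτ : ∀ j n, 1 ≤ n → 0 < τ j n) (hδ : hardyKrauseVariation δ 0 τbar < ⊤)
    (hT : ∀ j, ∀ n : ℕ, 1 ≤ n → (n : ℝ) * τ j n = τbar j) :
    AdmissibleDrift τbar τ δ := by
  have hdom : samplingDomain τbar τ ⊆ Set.Icc 0 τbar := by
    rintro x (hx | ⟨n, i, hi, hin, rfl⟩)
    · exact hx
    · have hn1 : ∀ j, 1 ≤ n j := fun j => (hi j).trans (hin j)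
      refine ⟨fun j => mul_nonneg (Nat.cast_nonneg _) (hτ j _ (hn1 j)).le, fun j => ?_⟩
      rw [← hT j (n j) (hn1 j)]
      exact mul_le_mul_of_nonneg_right (Nat.cast_le.2 (hin j)) (hτ j _ (hn1 j)).le
  obtain ⟨Φ, hΦ, hΦδ⟩ := exists_monotone_majorant (fun j => (hτbar j).le) hδ
  refine ⟨fun j => ?_, ?_, ?_⟩
  · refine tendsto_const_nhds.congr' ?_
    filter_upwards [eventually_ge_atTop 1] with n hn
    exact (hT j n hn).symm
  · have hC : ∀ j, ∀ᵐ x ∂cubeMeasure 3, τbar j * x j ∉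
        {t ∈ Set.Icc 0 (τbar j) | ¬ ContinuousWithinAt (Φ j) (Set.Icc 0 (τbar j)) t} := fun j =>
      ae_cubeMeasure_of_ae j (p := fun t => τbar j * t ∉
        {t ∈ Set.Icc 0 (τbar j) | ¬ ContinuousWithinAt (Φ j) (Set.Icc 0 (τbar j)) t})
        (ae_mul_notMem_of_countable (hτbar j).ne' (hΦ j).countable_not_continuousWithinAt)
    filter_upwards [ae_all_iff.2 hC, ae_cubeMeasure_mem 3] with x hx hx'
    have hxm := scale_mem hτbar hx'
    refine ContinuousWithinAt.mono ?_ hdom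
    rw [ContinuousWithinAt, tendsto_iff_dist_tendsto_zero]
    have hsum : Tendsto (fun y : Fin 3 → ℝ => ∑ j, |Φ j (y j) - Φ j (τbar j * x j)|)
        (𝓝[Set.Icc 0 τbar] fun j => τbar j * x j) (𝓝 0) := by
      have : Tendsto (fun y : Fin 3 → ℝ => ∑ j, |Φ j (y j) - Φ j (τbar j * x j)|)
          (𝓝[Set.Icc 0 τbar] fun j => τbar j * x j)
          (𝓝 (∑ j, |Φ j (τbar j * x j) - Φ j (τbar j * x j)|)) := by
        refine tendsto_finsetSum _ fun j _ => ?_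
        have hcj : ContinuousWithinAt (Φ j) (Set.Icc 0 (τbar j)) (τbar j * x j) := by
          by_contra hcon
          exact hx j ⟨⟨hxm.1 j, hxm.2 j⟩, hcon⟩
        have hy : Tendsto (fun y : Fin 3 → ℝ => y j) (𝓝[Set.Icc 0 τbar] fun j => τbar j * x j)
            (𝓝[Set.Icc 0 (τbar j)] (τbar j * x j)) := by
          refine tendsto_nhdsWithin_iff.2 ⟨?_, ?_⟩
          · exact ((continuous_apply j).tendsto (fun j => τbar j * x j)).mono_left
              nhdsWithin_le_nhds
          · filter_upwards [self_mem_nhdsWithin] with y hy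
            exact ⟨hy.1 j, hy.2 j⟩
        exact ((hcj.tendsto.comp hy).sub_const _).abs
      simpa using this
    refine squeeze_zero' (Eventually.of_forall fun _ => dist_nonneg) ?_ hsum
    filter_upwards [self_mem_nhdsWithin] with y hy
    rw [Real.dist_eq]
    exact hΦδ y hy _ hxm
  · have h0 : (0 : Fin 3 → ℝ) ∈ Set.Icc 0 τbar := ⟨le_rfl, fun j => (hτbar j).le⟩
    have hb : ∀ x ∈ Set.Icc 0 τbar, |δ x| ≤ |δ 0| + ∑ j, |Φ j (τbar j) - Φ j 0| := by
      intro x hx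
      have h1 : |δ x| ≤ |δ 0| + |δ x - δ 0| := by
        have := abs_add_le (δ 0) (δ x - δ 0)
        rwa [add_sub_cancel] at this
      refine h1.trans (add_le_add le_rfl ((hΦδ x hx 0 h0).trans (Finset.sum_le_sum fun j _ => ?_)))
      have hj0 : (0 : ℝ) ∈ Set.Icc ((0 : Fin 3 → ℝ) j) (τbar j) := ⟨le_rfl, (hτbar j).le⟩
      have hjx : x j ∈ Set.Icc ((0 : Fin 3 → ℝ) j) (τbar j) := ⟨hx.1 j, hx.2 j⟩
      have hjb : τbar j ∈ Set.Icc ((0 : Fin 3 → ℝ) j) (τbar j) := ⟨(hτbar j).le, le_rfl⟩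
      have m1 := hΦ j hj0 hjx hjx.1
      have m2 := hΦ j hjx hjb hjx.2
      rw [Pi.zero_apply, abs_of_nonneg (sub_nonneg.2 m1)]
      exact (sub_le_sub_right m2 _).trans (le_abs_self _)
    refine ⟨_, hb, Eventually.of_forall fun n i hi hin => hb _ (hdom (Or.inr ⟨n, i, hi, hin, rfl⟩))⟩

end conditions

/-! ### The detection process -/

theorem stieltjesByParts_const_mul {q : ℕ} (φ : Fin q → ℝ → ℝ) (c : ℝ) (h : (Fin q → ℝ) → ℝ)
    (T r b : Fin q → ℝ) :
    stieltjesByParts φ (fun x => c * h x) T r b = c * stieltjesByParts φ h T r b := by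
  unfold stieltjesByParts
  rw [Finset.mul_sum]
  refine Finset.sum_congr rfl fun v _ => ?_
  rw [← integral_const_mul]
  simp_rw [mul_assoc]

theorem update_one_mem_cube {s : ℝ} (hs : s ∈ Set.Icc (0 : ℝ) 1) :
    Function.update (1 : Fin 3 → ℝ) 0 s ∈ Set.Icc (0 : Fin 3 → ℝ) 1 := by
  refine ⟨le_update_iff.2 ⟨hs.1, fun _ _ => zero_le_one⟩, update_le_iff.2 ⟨hs.2, fun _ _ => le_rfl⟩⟩

/-- The noise part of the detection process is a Stieltjes integral against the partial sums. -/
theorem noise_part_eq {Ω : Type*} (w : Fin 3 → ℝ) {τ : Fin 3 → ℕ → ℝ} (ε : (Fin 3 → ℤ) → Ω → ℝ)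
    {n : Fin 3 → ℕ} (hn : 1 ≤ n) (ω : Ω) {s : ℝ} (hs : s ∈ Set.Icc (0 : ℝ) 1) (r : Fin 3 → ℝ) :
    √(∏ j, τ j (n j)) * ∑ i ∈ Finset.Icc (1 : Fin 3 → ℕ) (Function.update n 0 ⌊(n 0 : ℝ) * s⌋₊),
      ε (fun j => (i j : ℤ)) ω * kernel w (r - site τ n i) =
    √(∏ j, (n j : ℝ) * τ j (n j)) * stieltjesByParts (fun j => kernelFactor (w j))
      (partialSumProcess ε n ω) (fun j => (n j : ℝ) * τ j (n j)) r (Function.update 1 0 s) := by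
  have hn0 : ∀ j, (0 : ℝ) < n j := fun j => Nat.cast_pos.2 (hn j)
  have hP : 0 < ∏ j, (n j : ℝ) := Finset.prod_pos fun j _ => hn0 j
  have key := sum_mul_prod_valueFactor (φ := fun j => kernelFactor (w j))
    (fun j => contDiff_kernelFactor (w j)) (fun i => ε (fun j => (i j : ℤ)) ω) hn
    (fun j => (n j : ℝ) * τ j (n j)) r (update_one_mem_cube hs)
  have hfl : (fun j => ⌊(n j : ℝ) * Function.update (1 : Fin 3 → ℝ) 0 s j⌋₊) =
      Function.update n 0 ⌊(n 0 : ℝ) * s⌋₊ := by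
    funext j
    by_cases hj : j = 0
    · subst hj; simp
    · simp [hj]
  -- At the grid point `i / n`, the scaling `n τ` gives back the site `i τ`.
  have hker : ∀ i : Fin 3 → ℕ, ∏ j, valueFactor (fun j => kernelFactor (w j))
      (fun j => (n j : ℝ) * τ j (n j)) r (fun j => (i j : ℝ) / n j) j =
      kernel w (r - site τ n i) := by
    intro i
    rw [kernel_eq_prod]
    refine Finset.prod_congr rfl fun j _ => ?_
    have := (hn0 j).ne'
    have h1 : (n j : ℝ) * τ j (n j) * ((i j : ℝ) / n j) = i j * τ j (n j) := by field_simp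
    simp only [valueFactor, site, Pi.sub_apply, h1]
  rw [hfl] at key
  simp_rw [hker] at key
  have hpart : partialSumProcess ε n ω = fun v => (√(∏ j, (n j : ℝ)))⁻¹ *
      ∑ i ∈ Finset.Icc (1 : Fin 3 → ℕ) (fun j => ⌊(n j : ℝ) * v j⌋₊),
        ε (fun j => (i j : ℤ)) ω := rfl
  rw [hpart, stieltjesByParts_const_mul, ← key, Finset.prod_mul_distrib, Real.sqrt_mul hP.le]
  have := (Real.sqrt_pos.2 hP).ne'
  field_simp

theorem norm_le_of_mem_Icc {τbar r : Fin 3 → ℝ} (hr : r ∈ Set.Icc 0 τbar) : ‖r‖ ≤ ‖τbar‖ :=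
  (pi_norm_le_iff_of_nonneg (norm_nonneg _)).2 fun j => by
    rw [Real.norm_eq_abs, abs_of_nonneg (hr.1 j)]
    exact (hr.2 j).trans ((le_abs_self _).trans (norm_le_pi_norm τbar j))

/-- Uniform convergence of the noise part, given uniform convergence of the partial sums. -/
theorem stieltjesByParts_close {φ : Fin 3 → ℝ → ℝ} (hφ : ∀ j, ContDiff ℝ 1 (φ j))
    {τbar : Fin 3 → ℝ} {τ : Fin 3 → ℕ → ℝ}
    (hT : ∀ j, Tendsto (fun n : ℕ => (n : ℝ) * τ j n) atTop (𝓝 (τbar j)))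
    {h : (Fin 3 → ℝ) → ℝ} (hm : Measurable h) {H : ℝ} (hH : ∀ x, |h x| ≤ H)
    {ε : ℝ} (hε : 0 < ε) :
    ∃ θ > 0, ∀ᶠ n : Fin 3 → ℕ in atTop, ∀ z : (Fin 3 → ℝ) → ℝ, Measurable z →
      (∀ x ∈ Set.Icc (0 : Fin 3 → ℝ) 1, |z x - h x| ≤ θ) →
      ∀ s ∈ Set.Icc (0 : ℝ) 1, ∀ r ∈ Set.Icc 0 τbar,
      |√(∏ j, (n j : ℝ) * τ j (n j)) * stieltjesByParts φ z (fun j => (n j : ℝ) * τ j (n j)) r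
          (Function.update 1 0 s) -
        √(∏ j, τbar j) * stieltjesByParts φ h τbar r (Function.update 1 0 s)| ≤ ε := by
  obtain ⟨M, hM, hMb⟩ := exists_bound_mixedFactor hφ (‖τbar‖ + 1)
  have hH0 : 0 ≤ H := (abs_nonneg _).trans (hH 0)
  set L := √(∏ j, τbar j) with hL
  have hL0 : 0 ≤ L := Real.sqrt_nonneg _
  have hM0 : 0 < M := by linarith
  set C : ℝ := 2 ^ 3 * (M ^ 3 + H * ((3 : ℕ) * M ^ 3)) with hC
  have hCpos : 0 < C := by positivity
  -- A single tolerance serves for the path, the densities and the square-root factor. It is chosen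
  -- so that `(L + 1) * (C * θ) = ε / 2`, which also dominates `θ * C`.
  set θ : ℝ := ε / (2 * ((L + 1) * C)) with hθ
  have hθpos : 0 < θ := by positivity
  obtain ⟨η, hη, hclose⟩ := exists_close_mixedFactor hφ (‖τbar‖ + 1) hθpos
  refine ⟨θ, hθpos, ?_⟩
  have hTn : Tendsto (fun n : Fin 3 → ℕ => fun j => (n j : ℝ) * τ j (n j)) atTop (𝓝 τbar) :=
    tendsto_pi_nhds.2 fun j => (hT j).comp (tendsto_eval_atTop j)
  have hLn : Tendsto (fun n : Fin 3 → ℕ => √(∏ j, (n j : ℝ) * τ j (n j))) atTop (𝓝 L) :=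
    (Real.continuous_sqrt.tendsto _).comp
      (tendsto_finsetProd _ fun j _ => (hT j).comp (tendsto_eval_atTop j))
  filter_upwards [hTn.eventually (Metric.ball_mem_nhds τbar (lt_min hη one_pos)),
    hLn.eventually (Metric.ball_mem_nhds L (lt_min one_pos hθpos))] with n hn hn' z hz hzh s hs r hr
  set T : Fin 3 → ℝ := fun j => (n j : ℝ) * τ j (n j)
  set Ln := √(∏ j, (n j : ℝ) * τ j (n j))
  set b : Fin 3 → ℝ := Function.update 1 0 s
  have hb : b ∈ Set.Icc (0 : Fin 3 → ℝ) 1 := update_one_mem_cube hs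
  have hTnorm : ‖T‖ ≤ ‖τbar‖ + 1 := by
    have h1 := norm_le_norm_add_norm_sub τbar T
    rw [← dist_eq_norm, dist_comm] at h1
    linarith [hn.trans_le (min_le_right η 1)]
  have hrnorm : ‖r‖ ≤ ‖τbar‖ + 1 := (norm_le_of_mem_Icc hr).trans (by linarith)
  have hone : ∀ x : Fin 3 → ℝ, ‖x‖ ≤ 1 → ‖x‖ ≤ ‖τbar‖ + 1 := fun x hx => by
    linarith [norm_nonneg τbar]
  have hbnorm : ‖b‖ ≤ ‖τbar‖ + 1 := hone b (norm_le_one_of_mem_cube hb)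
  have hτn : ‖τbar‖ ≤ ‖τbar‖ + 1 := by linarith
  have k1 := abs_stieltjesByParts_sub_le hφ hm hz (fun x _ => hH x) hzh hM (T := T) (T' := τbar)
    (r := r) hb (fun x hx v j => hMb T r b hTnorm hrnorm hbnorm x (hone x hx) v j)
    (fun x hx v j => hMb τbar r b hτn hrnorm hbnorm x (hone x hx) v j)
    (fun x hx v j => hclose T τbar r b hTnorm hτn hrnorm hbnorm
      (hn.trans_le (min_le_left _ _)) x (hone x hx) v j)
  -- Comparison with the zero path turns the stability estimate into a bound for the functional
  -- itself.
  have k2 := abs_stieltjesByParts_sub_le hφ (h := fun _ => 0) (H := 0) (η := H) (e := 0)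
    measurable_const hm (fun x _ => by simp) (fun x _ => by simpa using hH x) hM (T := τbar)
    (T' := τbar) (r := r) hb (fun x hx v j => hMb τbar r b hτn hrnorm hbnorm x (hone x hx) v j)
    (fun x hx v j => hMb τbar r b hτn hrnorm hbnorm x (hone x hx) v j)
    (fun x hx v j => by simp)
  have hz0 : stieltjesByParts φ (fun _ => 0) τbar r b = 0 := by simp [stieltjesByParts]
  rw [hz0, sub_zero] at k2
  set S := stieltjesByParts φ z T r b
  set S' := stieltjesByParts φ h τbar r b
  have k1' : |S - S'| ≤ C * θ := k1.trans_eq (by rw [hC]; ring)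
  have k2' : |S'| ≤ C := by
    refine k2.trans ?_
    rw [hC]
    have : 0 ≤ M ^ 3 := by positivity
    have h2 : 0 ≤ H * M ^ 3 := by positivity
    push_cast
    nlinarith
  rw [Real.dist_eq] at hn'
  have k3 : Ln ≤ L + 1 := by linarith [le_abs_self (Ln - L), hn'.trans_le (min_le_left _ _)]
  have k4 : |Ln - L| ≤ θ := (hn'.trans_le (min_le_right _ _)).le
  have h5 : Ln * S - L * S' = Ln * (S - S') + (Ln - L) * S' := by ring
  rw [h5]
  refine (abs_add_le _ _).trans ?_
  rw [abs_mul, abs_mul, abs_of_nonneg (Real.sqrt_nonneg _)]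
  have h6 : Ln * |S - S'| ≤ (L + 1) * (C * θ) :=
    mul_le_mul k3 k1' (abs_nonneg _) (by positivity)
  have h7 : |Ln - L| * |S'| ≤ θ * C := mul_le_mul k4 k2' (abs_nonneg _) hθpos.le
  have h8 : (L + 1) * (C * θ) = ε / 2 := by rw [hθ]; field_simp
  have h9 : θ * C ≤ (L + 1) * (C * θ) := by nlinarith [mul_pos hθpos hCpos]
  linarith

/-! ### Detection process and limit as measurable maps into the Skorohod space -/

theorem IsBrownianSheet.aemeasurable_apply {q : ℕ} {Ω : Type*} [MeasurableSpace Ω] {P : Measure Ω}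
    {B : Ω → (Fin q → ℝ) → ℝ} (hB : IsBrownianSheet P B) {x : Fin q → ℝ}
    (hx : x ∈ Set.Icc (0 : Fin q → ℝ) 1) : AEMeasurable (fun ω => B ω x) P := by
  -- The value at `x` is almost surely the increment over `[0, x]`, all other corners lying on the
  -- axes; the laws of the increments supply the measurability.
  refine (hB.increments_normal 0 x le_rfl hx.1 hx.2).aemeasurable.congr ?_
  filter_upwards [hB.zero_on_axes] with ω hω
  unfold altSum
  rw [Finset.sum_eq_single ∅]
  · simp
  · intro v _ hv
    obtain ⟨j, hj⟩ := Finset.nonempty_iff_ne_empty.2 hv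
    rw [hω _ (piecewise_mem_Icc v ⟨le_rfl, zero_le_one⟩ hx) ⟨j, by simp [hj]⟩, mul_zero]
  · simp

/-- The extension of a continuous function on the unit cube to the whole space. -/
def cubeExtend {q : ℕ} (g : C(Set.Icc (0 : Fin q → ℝ) 1, ℝ)) (x : Fin q → ℝ) : ℝ :=
  g ⟨clampCube x, clampCube_mem x⟩

theorem continuous_cubeExtend {q : ℕ} (g : C(Set.Icc (0 : Fin q → ℝ) 1, ℝ)) :
    Continuous (cubeExtend g) :=
  g.continuous.comp (continuous_clampCube.subtype_mk _)

theorem cubeExtend_of_mem {q : ℕ} (g : C(Set.Icc (0 : Fin q → ℝ) 1, ℝ)) {x : Fin q → ℝ}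
    (hx : x ∈ Set.Icc (0 : Fin q → ℝ) 1) : cubeExtend g x = g ⟨x, hx⟩ := by
  unfold cubeExtend
  congr 1
  exact Subtype.ext (clampCube_of_mem hx)

theorem abs_cubeExtend_le {q : ℕ} (g : C(Set.Icc (0 : Fin q → ℝ) 1, ℝ)) (x : Fin q → ℝ) :
    |cubeExtend g x| ≤ ‖g‖ :=
  g.norm_coe_le_norm _

section box

variable {s₀ : ℝ} {τbar : Fin 3 → ℝ}

theorem box_time_mem (hs₀ : 0 < s₀) (x : Box (Fin.cons s₀ 0 : Fin 4 → ℝ) (Fin.cons 1 τbar)) :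
    (x 0 : ℝ) ∈ Set.Icc (0 : ℝ) 1 :=
  ⟨hs₀.le.trans (x 0).2.1, (x 0).2.2⟩

theorem box_tail_mem (x : Box (Fin.cons s₀ 0 : Fin 4 → ℝ) (Fin.cons 1 τbar)) :
    (Fin.tail fun p => (x p : ℝ)) ∈ Set.Icc 0 τbar :=
  ⟨fun j => (x j.succ).2.1, fun j => (x j.succ).2.2⟩

theorem continuous_box_tail :
    Continuous fun x : Box (Fin.cons s₀ 0 : Fin 4 → ℝ) (Fin.cons 1 τbar) =>
      (Fin.tail fun p => (x p : ℝ) : Fin 3 → ℝ) :=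
  continuous_pi fun j => continuous_subtype_val.comp (continuous_apply j.succ)

theorem continuous_box_time :
    Continuous fun x : Box (Fin.cons s₀ 0 : Fin 4 → ℝ) (Fin.cons 1 τbar) => (x 0 : ℝ) :=
  continuous_subtype_val.comp (continuous_apply 0)

end box

/-- The limit process for the path `g`, as an element of `D`. -/
def limitPath {s₀ : ℝ} {w τbar : Fin 3 → ℝ} {τ : Fin 3 → ℕ → ℝ} {δ : (Fin 3 → ℝ) → ℝ}
    (hτbar : ∀ j, 0 < τbar j) (hδ : AdmissibleDrift τbar τ δ)
    (g : C(Set.Icc (0 : Fin 3 → ℝ) 1, ℝ)) :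
    SkorohodSpace (Fin.cons s₀ 0 : Fin 4 → ℝ) (Fin.cons 1 τbar) :=
  ⟨fun x => √(∏ j, τbar j) * stieltjesByParts (fun j => kernelFactor (w j)) (cubeExtend g) τbar
      (Fin.tail fun p => (x p : ℝ)) (Function.update 1 0 (x 0 : ℝ)) +
    √(∏ j, τbar j) * driftIntegral w τbar δ (x 0) (Fin.tail fun p => (x p : ℝ)),
    Continuous.isSkorohodRegular <| by
      have h1 := continuous_stieltjesByParts (fun j => contDiff_kernelFactor (w j))
        (continuous_cubeExtend g) (abs_cubeExtend_le g) τbar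
      have h2 := hδ.continuous_driftIntegral (w := w) hτbar
      refine Continuous.add (continuous_const.mul (h1.comp (continuous_box_tail.prodMk ?_)))
        (continuous_const.mul (h2.comp (continuous_box_time.prodMk continuous_box_tail)))
      exact continuous_const.update 0 continuous_box_time⟩

/-- The functional is linear in the path and the drift cancels in differences, so the map is
Lipschitz for supremum norms. It transfers measurability from `C` to `D`. -/
theorem continuous_limitPath {s₀ : ℝ} (hs₀ : 0 < s₀) {w τbar : Fin 3 → ℝ} {τ : Fin 3 → ℕ → ℝ}
    {δ : (Fin 3 → ℝ) → ℝ} (hτbar : ∀ j, 0 < τbar j) (hδ : AdmissibleDrift τbar τ δ) :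
    Continuous (limitPath (s₀ := s₀) (w := w) hτbar hδ) := by
  obtain ⟨M, hM, hMb⟩ := exists_bound_mixedFactor
    (fun j => contDiff_kernelFactor (w j)) (‖τbar‖ + 1)
  set C : ℝ := √(∏ j, τbar j) * (2 ^ 3 * M ^ 3)
  refine LipschitzWith.continuous (K := Real.toNNReal C) fun g g' => ?_
  refine SkorohodSpace.edist_le_of_forall fun x => ?_
  rw [edist_dist, edist_dist, ← ENNReal.ofReal_coe_nnreal,
    ← ENNReal.ofReal_mul (NNReal.coe_nonneg _)]
  refine ENNReal.ofReal_le_ofReal ?_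
  refine le_trans ?_ (mul_le_mul_of_nonneg_right (Real.le_coe_toNNReal C) dist_nonneg)
  simp only [limitPath]
  rw [Real.dist_eq, add_sub_add_right_eq_sub, ← mul_sub, abs_mul,
    abs_of_nonneg (Real.sqrt_nonneg _), mul_assoc]
  refine mul_le_mul_of_nonneg_left ?_ (Real.sqrt_nonneg _)
  have hb := update_one_mem_cube (box_time_mem hs₀ x)
  have hone : ∀ y : Fin 3 → ℝ, ‖y‖ ≤ 1 → ‖y‖ ≤ ‖τbar‖ + 1 := fun y hy => by
    linarith [norm_nonneg τbar]
  have hr : ‖(Fin.tail fun p => (x p : ℝ) : Fin 3 → ℝ)‖ ≤ ‖τbar‖ + 1 :=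
    (norm_le_of_mem_Icc (box_tail_mem x)).trans (by linarith)
  have hMx : ∀ y : Fin 3 → ℝ, ‖y‖ ≤ 1 → ∀ v j, |mixedFactor (fun j => kernelFactor (w j)) τbar
      (Fin.tail fun p => (x p : ℝ)) (Function.update 1 0 (x 0 : ℝ)) v y j| ≤ M :=
    fun y hy v j => hMb τbar _ _ (by linarith) hr
      (hone _ (norm_le_one_of_mem_cube hb)) y (hone y hy) v j
  have key := abs_stieltjesByParts_sub_le (fun j => contDiff_kernelFactor (w j))
    (continuous_cubeExtend g').measurable (continuous_cubeExtend g).measurable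
    (H := ‖g'‖) (η := dist g g') (e := 0) (fun x _ => abs_cubeExtend_le g' x)
    (fun y _ => by rw [← Real.dist_eq]; exact ContinuousMap.dist_apply_le_dist _) hM hb
    hMx hMx (fun y _ v j => by simp)
  refine key.trans_eq ?_
  ring

/-- With indicators in place of a random-looking range of summation, the process is a fixed finite
combination of elements of `D`, from which regularity of the paths and measurability can be read
off. -/
theorem detectionProcess_eq_sum (w : Fin 3 → ℝ) (τ : Fin 3 → ℕ → ℝ) (f₀ : (Fin 3 → ℝ) → ℝ)
    (n : Fin 3 → ℕ) (y : (Fin 3 → ℕ) → ℝ) {s : ℝ} (hs : s ≤ 1) (r : Fin 3 → ℝ) :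
    detectionProcess w τ f₀ n y s r = ∑ i : Finset.Icc (1 : Fin 3 → ℕ) n,
      (y i - f₀ (site τ n i)) * (√(∏ j, τ j (n j)) *
        ((if ((i : Fin 3 → ℕ) 0 : ℝ) / n 0 ≤ s then 1 else 0) * kernel w (r - site τ n i))) := by
  rw [Finset.sum_coe_sort (Finset.Icc (1 : Fin 3 → ℕ) n) fun i =>
    (y i - f₀ (site τ n i)) * (√(∏ j, τ j (n j)) *
      ((if (i 0 : ℝ) / n 0 ≤ s then 1 else 0) * kernel w (r - site τ n i)))]
  unfold detectionProcess
  rw [Icc_update_floor n hs, Finset.sum_filter, Finset.mul_sum]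
  refine Finset.sum_congr rfl fun i hi => ?_
  have hi := Finset.mem_Icc.1 hi
  have hi0 : i 0 ≠ 0 := Nat.one_le_iff_ne_zero.1 (hi.1 0)
  have hn0 : (0 : ℝ) < n 0 := Nat.cast_pos.2 ((hi.1 0).trans (hi.2 0))
  have hiff : i 0 ≤ ⌊(n 0 : ℝ) * s⌋₊ ↔ (i 0 : ℝ) / n 0 ≤ s := by
    rw [Nat.le_floor_iff' hi0, div_le_iff₀' hn0]
  by_cases h : (i 0 : ℝ) / n 0 ≤ s
  · rw [if_pos (hiff.2 h), if_pos h]; ring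
  · rw [if_neg (mt hiff.1 h), if_neg h]; ring

/-- The path of the detection process, as an element of `D`. -/
def detectionPath {s₀ : ℝ} {τbar : Fin 3 → ℝ} (w : Fin 3 → ℝ) (τ : Fin 3 → ℕ → ℝ)
    (f₀ : (Fin 3 → ℝ) → ℝ) (n : Fin 3 → ℕ) (y : (Fin 3 → ℕ) → ℝ) :
    SkorohodSpace (Fin.cons s₀ 0 : Fin 4 → ℝ) (Fin.cons 1 τbar) :=
  ⟨fun x => detectionProcess w τ f₀ n y (x 0) (Fin.tail fun p => (x p : ℝ)), by
    have h : (fun x : Box (Fin.cons s₀ 0 : Fin 4 → ℝ) (Fin.cons 1 τbar) =>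
        detectionProcess w τ f₀ n y (x 0) (Fin.tail fun p => (x p : ℝ))) = _ :=
      funext fun x => detectionProcess_eq_sum w τ f₀ n y (x 0).2.2 _
    rw [h]
    exact IsSkorohodRegular.sum _ fun i _ => continuous_const.isSkorohodRegular.mul
      (continuous_const.isSkorohodRegular.mul ((isSkorohodRegular_ite_le 0 _).mul
        ((continuous_kernel w).comp
          (continuous_box_tail.sub continuous_const)).isSkorohodRegular))⟩

theorem aemeasurable_detectionPath {Ω : Type*} [MeasurableSpace Ω] {P : Measure Ω}
    {s₀ : ℝ} {τbar : Fin 3 → ℝ} (w : Fin 3 → ℝ) (τ : Fin 3 → ℕ → ℝ) (f₀ : (Fin 3 → ℝ) → ℝ)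
    (n : Fin 3 → ℕ) {y : (Fin 3 → ℕ) → Ω → ℝ}
    (hy : ∀ i, 1 ≤ i → i ≤ n → AEMeasurable (y i) P) :
    AEMeasurable (fun ω => detectionPath (s₀ := s₀) (τbar := τbar) w τ f₀ n fun i => y i ω) P := by
  refine aemeasurable_skorohod_sum
    (fun (i : Finset.Icc (1 : Fin 3 → ℕ) n) ω => y i ω - f₀ (site τ n i)) (fun i => ?_)
    (fun i x => √(∏ j, τ j (n j)) * ((if ((i : Fin 3 → ℕ) 0 : ℝ) / n 0 ≤ (x 0 : ℝ) then 1 else 0) *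
      kernel w ((Fin.tail fun p => (x p : ℝ)) - site τ n i)))
    (√(∏ j, τ j (n j)) * ∏ j, |w j / Real.pi|) (fun i x => ?_) _
    (fun ω x => detectionProcess_eq_sum w τ f₀ n _ (x 0).2.2 _) (fun i => ?_)
  · have hi := Finset.mem_Icc.1 i.2
    exact (hy i hi.1 hi.2).sub_const _
  · rw [abs_mul, abs_of_nonneg (Real.sqrt_nonneg _)]
    refine mul_le_mul_of_nonneg_left ?_ (Real.sqrt_nonneg _)
    have h0 : 0 ≤ ∏ j, |w j / Real.pi| := Finset.prod_nonneg fun _ _ => abs_nonneg _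
    split_ifs
    · rw [one_mul]; exact abs_kernel_le _ _
    · rwa [zero_mul, abs_zero]
  · exact continuous_const.isSkorohodRegular.mul ((isSkorohodRegular_ite_le 0 _).mul
      ((continuous_kernel w).comp
        (continuous_box_tail.sub continuous_const)).isSkorohodRegular)

theorem detectionProcess_eq_add {w : Fin 3 → ℝ} {τ : Fin 3 → ℕ → ℝ} (hτ : ∀ j n, 1 ≤ n → 0 < τ j n)
    {Ω : Type*} (ε : (Fin 3 → ℤ) → Ω → ℝ) (ω : Ω) {f₀ δ : (Fin 3 → ℝ) → ℝ} {n : Fin 3 → ℕ}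
    (hn : 1 ≤ n) {y : (Fin 3 → ℕ) → ℝ}
    (hy : ∀ i, 1 ≤ i → i ≤ n → y i - f₀ (site τ n i) =
      δ (site τ n i) / (∏ j, (n j : ℝ) ^ (1 / 2 : ℝ)) + ε (fun j => (i j : ℤ)) ω)
    {s : ℝ} (hs : s ∈ Set.Icc (0 : ℝ) 1) (r : Fin 3 → ℝ) :
    detectionProcess w τ f₀ n y s r =
      √(∏ j, (n j : ℝ) * τ j (n j)) * stieltjesByParts (fun j => kernelFactor (w j))
        (partialSumProcess ε n ω) (fun j => (n j : ℝ) * τ j (n j)) r (Function.update 1 0 s) +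
      √(∏ j, (n j : ℝ) * τ j (n j)) * driftSum w τ δ n s r := by
  rw [← noise_part_eq w ε hn ω hs r, ← sum_drift_eq hn hτ hs.2 r, ← mul_add,
    ← Finset.sum_add_distrib]
  unfold detectionProcess
  congr 1
  refine Finset.sum_congr rfl fun i hi => ?_
  rw [Icc_update_floor n hs.2, Finset.mem_filter, Finset.mem_Icc] at hi
  rw [hy i hi.1.1 hi.1.2]
  ring

open Classical in
/-- The restriction of `g` to the unit cube if it is continuous there. -/
def cubeRestrict {q : ℕ} (g : (Fin q → ℝ) → ℝ) : C(Set.Icc (0 : Fin q → ℝ) 1, ℝ) :=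
  if h : ContinuousOn g (Set.Icc 0 1) then ⟨(Set.Icc 0 1).domRestrict g, h.domRestrict⟩ else 0

theorem cubeRestrict_apply {q : ℕ} {g : (Fin q → ℝ) → ℝ} (h : ContinuousOn g (Set.Icc 0 1))
    (x : Set.Icc (0 : Fin q → ℝ) 1) : cubeRestrict g x = g x := by
  rw [cubeRestrict, dif_pos h]
  rfl

theorem cubeExtend_cubeRestrict {q : ℕ} {g : (Fin q → ℝ) → ℝ} (h : ContinuousOn g (Set.Icc 0 1)) :
    Set.EqOn (cubeExtend (cubeRestrict g)) g (Set.Icc 0 1) := fun x hx => by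
  rw [cubeExtend_of_mem _ hx, cubeRestrict_apply h]

/-- The path is first a random element of the separable space of continuous functions, where point
evaluations suffice, and is then mapped continuously into `D`. -/
theorem IsBrownianSheet.aemeasurable_limitPath {Ω : Type*} [MeasurableSpace Ω]
    {P : Measure Ω} {B : Ω → (Fin 3 → ℝ) → ℝ} (hB : IsBrownianSheet P B) (σ : ℝ)
    {s₀ : ℝ} (hs₀ : 0 < s₀) {w τbar : Fin 3 → ℝ} {τ : Fin 3 → ℕ → ℝ}
    {δ : (Fin 3 → ℝ) → ℝ} (hτbar : ∀ j, 0 < τbar j) (hδ : AdmissibleDrift τbar τ δ) :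
    AEMeasurable (fun ω => limitPath (s₀ := s₀) (w := w) hτbar hδ
      (cubeRestrict fun v => σ * B ω v)) P := by
  let _ : MeasurableSpace C(Set.Icc (0 : Fin 3 → ℝ) 1, ℝ) := borel _
  have _ : BorelSpace C(Set.Icc (0 : Fin 3 → ℝ) 1, ℝ) := ⟨rfl⟩
  refine (continuous_limitPath hs₀ hτbar hδ).measurable.comp_aemeasurable
    (aemeasurable_continuousMap _ fun x => ?_)
  refine ((hB.aemeasurable_apply x.2).const_mul σ).congr ?_
  filter_upwards [hB.continuous_paths] with ω hω
  exact (cubeRestrict_apply (continuousOn_const.mul hω) x).symm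

theorem limitPath_cubeRestrict {s₀ : ℝ} (hs₀ : 0 < s₀) {w τbar : Fin 3 → ℝ} {τ : Fin 3 → ℕ → ℝ}
    {δ : (Fin 3 → ℝ) → ℝ} (hτbar : ∀ j, 0 < τbar j) (hδ : AdmissibleDrift τbar τ δ)
    {σ : ℝ} {g : (Fin 3 → ℝ) → ℝ} (hc : ContinuousOn g (Set.Icc 0 1))
    (h0 : ∀ x ∈ Set.Icc (0 : Fin 3 → ℝ) 1, (∃ j, x j = 0) → g x = 0)
    (x : Box (Fin.cons s₀ 0 : Fin 4 → ℝ) (Fin.cons 1 τbar)) :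
    (limitPath (w := w) hτbar hδ (cubeRestrict fun v => σ * g v)).1 x =
      nullLimit w τbar σ g (x 0) (Fin.tail fun p => (x p : ℝ)) +
        drift w τbar δ (x 0) (Fin.tail fun p => (x p : ℝ)) := by
  have hb := update_one_mem_cube (box_time_mem hs₀ x)
  have hcσ : ContinuousOn (fun v => σ * g v) (Set.Icc 0 1) := continuousOn_const.mul hc
  have hker : scaledKernel w τbar (Fin.tail fun p => (x p : ℝ)) =
      fun z => ∏ j, kernelFactor (w j) ((Fin.tail fun p => (x p : ℝ) : Fin 3 → ℝ) j -
        τbar j * z j) := rfl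
  rw [drift_eq hτbar (x 0).2.2, nullLimit, hker,
    byPartsIntegral_eq (fun j => contDiff_kernelFactor (w j)) hc h0 τbar _ hb, mul_assoc,
    ← stieltjesByParts_const_mul]
  simp only [limitPath]
  rw [stieltjesByParts_congr (cubeExtend_cubeRestrict hcσ) _ _ hb]

theorem measurable_partialSumProcess {Ω : Type*} (ε : (Fin 3 → ℤ) → Ω → ℝ) (n : Fin 3 → ℕ)
    (ω : Ω) : Measurable (partialSumProcess ε n ω) :=
  (measurable_sum_Icc_floor (fun i => ε (fun j => (i j : ℤ)) ω) n).const_mul _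

/-- A Skorohod neighbourhood of a continuous function is contained in a uniform neighbourhood. -/
theorem exists_forall_abs_sub_le_of_edist_lt {q : ℕ} {g : (Fin q → ℝ) → ℝ}
    (hg : ContinuousOn g (Set.Icc 0 1)) {θ : ℝ} (hθ : 0 < θ) :
    ∃ η > 0, ∀ Z Z' : SkorohodSpace (0 : Fin q → ℝ) 1,
      (∀ x : Box (0 : Fin q → ℝ) 1, Z'.1 x = g fun p => (x p : ℝ)) → edist Z Z' < η →
      ∀ x : Box (0 : Fin q → ℝ) 1, |Z.1 x - g fun p => (x p : ℝ)| ≤ θ := by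
  obtain ⟨η, hη, h⟩ := Metric.uniformContinuousOn_iff.1
    ((isCompact_Icc (a := (0 : Fin q → ℝ)) (b := 1)).uniformContinuousOn_of_continuous hg)
    (θ / 2) (half_pos hθ)
  refine ⟨ENNReal.ofReal (min η (θ / 2)), ENNReal.ofReal_pos.2 (lt_min hη (half_pos hθ)),
    fun Z Z' hZ' hd x => ?_⟩
  obtain ⟨lam, hlam⟩ := SkorohodSpace.exists_timeChange hd
  have hmem : ∀ x : Box (0 : Fin q → ℝ) 1, (fun p => (x p : ℝ)) ∈ Set.Icc (0 : Fin q → ℝ) 1 :=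
    fun x => ⟨fun p => (x p).2.1, fun p => (x p).2.2⟩
  obtain ⟨h1, h2⟩ := hlam x
  rw [edist_dist, ENNReal.ofReal_lt_ofReal_iff (lt_min hη (half_pos hθ))] at h1 h2
  rw [hZ', Real.dist_eq] at h2
  -- The time change moves points by less than `η`, which costs `θ / 2` by uniform continuity of the
  -- limit; the other `θ / 2` is the distance after the time change.
  have h3 := h _ (hmem (lam.map x)) _ (hmem x) <| lt_of_le_of_lt
    ((dist_pi_le_iff dist_nonneg).2 fun p => dist_le_pi_dist (lam.map x) x p)
    (h1.trans_le (min_le_left _ _))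
  rw [Real.dist_eq] at h3
  exact (abs_sub_le _ _ _).trans (by linarith [h2.trans_le (min_le_right η (θ / 2))])

end

/-! ### Proof of the theorem -/

theorem mainTheorem2 {Ω Ω' : Type*} [MeasurableSpace Ω] [MeasurableSpace Ω']
    (P : Measure Ω) [IsProbabilityMeasure P] (P' : Measure Ω') [IsProbabilityMeasure P']
    -- bandwidths, limits of the sampling horizons, sampling periods, starting point of monitoring
    (w τbar : Fin 3 → ℝ) (τ : Fin 3 → ℕ → ℝ) (s₀ : ℝ)
    (hw : ∀ j, 0 < w j) (hτbar : ∀ j, 0 < τbar j) (hτ : ∀ j n, 1 ≤ n → 0 < τ j n)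
    (hs₀ : 0 < s₀) (hs₀' : s₀ ≤ 1)
    -- the noise and the Brownian motion
    (ε : (Fin 3 → ℤ) → Ω → ℝ) (σ : ℝ) (hσ : 0 < σ) (B : Ω' → (Fin 3 → ℝ) → ℝ)
    (hB : IsBrownianSheet P' B) (hε : NoiseAssumption P P' ε σ B)
    -- the signals, the local alternative and the data
    (f : (Fin 3 → ℕ) → (Fin 3 → ℝ) → ℝ) (f₀ δ : (Fin 3 → ℝ) → ℝ)
    (hf : ∀ n : Fin 3 → ℕ, 1 ≤ n → ∀ x ∈ samplingDomain τbar τ,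
      f n x - f₀ x = δ x / ∏ j, (n j : ℝ) ^ (1 / 2 : ℝ))
    (y : (Fin 3 → ℕ) → (Fin 3 → ℕ) → Ω → ℝ)
    (hy : ∀ n i : Fin 3 → ℕ, 1 ≤ i → i ≤ n → ∀ ω,
      y n i ω = f n (site τ n i) + ε (fun j => (i j : ℤ)) ω)
    -- the two alternative conditions on the disturbance and on the sampling periods
    (hδ : (ContinuousOn δ (samplingDomain τbar τ) ∧
        ∀ j, Tendsto (fun n : ℕ => (n : ℝ) * τ j n) atTop (𝓝 (τbar j))) ∨
      (hardyKrauseVariation δ 0 τbar < ⊤ ∧ ∀ j, ∀ n : ℕ, 1 ≤ n → (n : ℝ) * τ j n = τbar j)) :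
    -- the integrals in the limit process are well defined
    (∀ s ∈ Set.Icc s₀ 1, ∀ r ∈ Set.Icc 0 τbar,
      IntegrableOn (fun z => kernel w (r - z) * δ z)
        (Set.Icc 0 (Function.update τbar 0 (s * τbar 0)))) ∧
    (∀ᵐ ω ∂P', ∀ s ∈ Set.Icc s₀ 1, ∀ r ∈ Set.Icc 0 τbar,
      ByPartsExists (scaledKernel w τbar r) (B ω) 0 (Function.update 1 0 s)) ∧
    -- weak convergence in `D([s₀,1] × [0,τbar₁] × [0,τbar₂] × [0,τbar₃])` as `min n_j → ∞`
    ConvergesWeakly (Fin.cons s₀ 0 : Fin 4 → ℝ) (Fin.cons 1 τbar : Fin 4 → ℝ) P P'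
      (fun n ω x => detectionProcess w τ f₀ n (fun i => y n i ω) (x 0) (Fin.tail x))
      atTop
      (fun ω x => nullLimit w τbar σ (B ω) (x 0) (Fin.tail x) +
        drift w τbar δ (x 0) (Fin.tail x)) := by
  have hD : AdmissibleDrift τbar τ δ := by
    rcases hδ with ⟨hδ, hT⟩ | ⟨hδ, hT⟩
    · exact admissibleDrift_of_continuousOn hτbar hτ hδ hT
    · exact admissibleDrift_of_hardyKrause hτbar hτ hδ hT
  refine ⟨fun s hs r _ => hD.integrableOn hτbar hs.2 r, ?_, ?_⟩
  · filter_upwards [hB.continuous_paths, hB.zero_on_axes] with ω hc h0 s hs r _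
    exact byPartsExists_of_continuousOn (fun j => contDiff_kernelFactor (w j)) hc h0 τbar r
      (update_one_mem_cube ⟨hs₀.le.trans hs.1, hs.2⟩)
  refine ⟨fun n ω => detectionPath w τ f₀ n fun i => y n i ω,
    fun ω => limitPath (w := w) hτbar hD (cubeRestrict fun v => σ * B ω v),
    fun n => Eventually.of_forall fun ω x => rfl, ?_, ?_⟩
  · filter_upwards [hB.continuous_paths, hB.zero_on_axes] with ω hc h0 x
    exact limitPath_cubeRestrict hs₀ hτbar hD hc h0 x
  obtain ⟨Z, Z', hZ, hZ', hlim⟩ := hε.fclt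
  -- The sets `G n` are the almost sure events on which the `D`-valued map really is the partial sum
  -- process; closeness is only claimed there.
  refine tendstoInDistribution_of_eventually_edist_lt hlim (fun n => ?_)
    (hB.aemeasurable_limitPath σ hs₀ hτbar hD)
    (fun n => {ω | ∀ x : Box (0 : Fin 3 → ℝ) 1,
      (Z n ω).1 x = partialSumProcess ε n ω fun p => (x p : ℝ)}) hZ ?_
  · refine aemeasurable_detectionPath w τ f₀ n fun i hi hin => ?_
    rw [funext (hy n i hi hin)]
    exact (hε.memLp _).aestronglyMeasurable.aemeasurable.const_add _
  filter_upwards [hB.continuous_paths, hZ'] with ω' hc hω' e he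
  -- The tolerance `e` may be infinite; a finite `a` below it is split equally between noise and
  -- drift.
  obtain ⟨a, ha, hae⟩ := ENNReal.lt_iff_exists_nnreal_btwn.1 he
  have ha0 : (0 : ℝ) < a := NNReal.coe_pos.2 (ENNReal.coe_pos.1 ha)
  have hc' : ContinuousOn (fun v => σ * B ω' v) (Set.Icc 0 1) := continuousOn_const.mul hc
  set g := cubeRestrict fun v => σ * B ω' v
  obtain ⟨θ, hθ, hclose⟩ := stieltjesByParts_close (fun j => contDiff_kernelFactor (w j))
    hD.horizon (continuous_cubeExtend g).measurable (abs_cubeExtend_le g) (half_pos ha0)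
  obtain ⟨η, hη, hZη⟩ := exists_forall_abs_sub_le_of_edist_lt hc' hθ
  refine ⟨η, hη, ?_⟩
  filter_upwards [hclose, hD.drift_close (w := w) hτbar (half_pos ha0), eventually_ge_atTop 1]
    with n hn hdn hn1 ω hω hdist
  -- The approximation is uniform, so the identity time change is enough in the target space.
  refine lt_of_le_of_lt (SkorohodSpace.edist_le_of_forall (C := a) fun x => ?_) hae
  have hs := box_time_mem hs₀ x
  have hr := box_tail_mem x
  have hdata : ∀ i, 1 ≤ i → i ≤ n → y n i ω - f₀ (site τ n i) =
      δ (site τ n i) / (∏ j, (n j : ℝ) ^ (1 / 2 : ℝ)) + ε (fun j => (i j : ℤ)) ω := by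
    intro i hi hin
    rw [hy n i hi hin, ← hf n hn1 _ (Or.inr ⟨n, i, hi, hin, rfl⟩)]
    ring
  have k1 := hn _ (measurable_partialSumProcess ε n ω) (fun v hv => by
    rw [cubeExtend_cubeRestrict hc' hv]
    have := hZη _ _ hω' hdist fun p => ⟨v p, hv.1 p, hv.2 p⟩
    rwa [hω] at this) _ hs _ hr
  have k2 := hdn _ hs _ hr
  rw [edist_dist, ← ENNReal.ofReal_coe_nnreal]
  refine ENNReal.ofReal_le_ofReal ?_
  simp only [detectionPath, limitPath]
  rw [detectionProcess_eq_add hτ ε ω hn1 hdata hs, Real.dist_eq, add_sub_add_comm]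
  exact (abs_add_le _ _).trans (by linarith)
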